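/- **Setting.** Let $(M,g,J)$ be a Kähler manifold of dimension $2n\ge 4$ with Levi-Civita connection $\nabla$. Let $\mathcal D$ be the rank-$2$, $J$-invariant distribution tangent to a complex homothetic foliation by curves on $M$ that is totally geodesic and holomorphic. That is: - *involutive and totally geodesic*: $[X,Y]$ and $\nabla_XY$ belong to $\Gamma(\mathcal D)$ for all local sections $X,Y\in\Gamma(\mathcal D)$; - *holomorphic*: $(L_XJ)(TM)\subset\mathcal D$ for all local sections $X\in\Gamma(\mathcal D)$; - *homothetic*: there is a closed $1$-form $\alpha$ on $M$, vanishing on $\mathcal E=\mathcal D^\perp$, such that $L_Vg=\alpha(V)g$ on $\mathcal E$ for all local sections $V\in\Gamma(\mathcal D)$. For a local section $X$ of $\mathcal D$ put $\operatorname{div}_{\mathcal E}X=\sum_i g(\nabla_{e_i}X,e_i)$, where $(e_i)$ is an orthonormal basis of $\mathcal E$. Let $\kappa=\sqrt{(\operatorname{div}_{\mathcal E}\xi)^2+(\operatorname{div}_{\mathcal E}J\xi)^2}$ for any local unit section $\xi$ of $\mathcal D$ (the value does not depend on $\xi$). Let $U=\{\kappa\neq 0\}$ and $K=\{\kappa=0\}$.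 A *principal section* on an open set $V\subset U$ is a smooth unit section $\xi$ of $\mathcal D$ over $V$ with $\operatorname{div}_{\mathcal E}J\xi=0$. A *special local Killing field* on $V$ is a field $X_V=e^{F}J\xi$, where $\xi$ is a principal section on $V$ and $F\in C^\infty(V)$ satisfies $dF=-p^*\,g(\xi,\cdot)$ with $p^*=g(\nabla_{J\xi}J\xi,\xi)$. Let $l>0$ and let $c:[0,l]\to M$ be a unit speed geodesic with $c([0,l))\subset U$ and $c(l)\in K$. A vector field $C$ along $c$ is a *special Jacobi field* if $\nabla_{\dot c}^2C-R(\dot c,C)\dot c=0$, where $R(u,v)w=\nabla_u\nabla_vw-\nabla_v\nabla_uw-\nabla_{[u,v]}w$, and if there are an open geodesically convex neighbourhood $V\subset U$ of $c(0)$ (any two points of $V$ are joined by exactly one geodesic $[0,1]\to V$) and a special local Killing field $X_V$ on $V$ with $C(0)=X_V(c(0))$ and $(\nabla_{\dot c}C)(0)=\nabla_{\dot c(0)}X_V$. **Lemma 5.1.** If $C$ is a special Jacobi field along $c$, then $$\lim_{t\to l^-}|C(t)|=0\qquad\text{and}\qquad g(\dot c(t),C(t))=0\ \text{ for all } t\in[0,l].$$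 -/

import Mathlib

open Set Filter Topology Bundle Manifold
open scoped ContDiff

noncomputable section

namespace HomotheticFoliation

variable {E : Type*} [NormedAddCommGroup E] [NormedSpace ℝ E]
  {M : Type*} [TopologicalSpace M] [ChartedSpace E M]

variable (E M) in
/-- Vector fields on a manifold `M` modelled on `E` (local fields are functions whose values
outside the set of interest are irrelevant). -/
abbrev VecField : Type _ := Π x : M, TangentSpace 𝓘(ℝ, E) x

variable (E M) in
/-- Fields of endomorphisms of the tangent spaces. -/
abbrev EndField : Type _ := Π x : M, TangentSpace 𝓘(ℝ, E) x →L[ℝ] TangentSpace 𝓘(ℝ, E) x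

variable (E M) in
/-- One-forms. -/
abbrev OneForm : Type _ := Π x : M, TangentSpace 𝓘(ℝ, E) x →L[ℝ] ℝ

variable (E M) in
/-- Distributions, i.e. fields of subspaces of the tangent spaces. -/
abbrev Distribution : Type _ := Π x : M, Submodule ℝ (TangentSpace 𝓘(ℝ, E) x)

variable (E M) in
/-- Affine connections (covariant derivatives on the tangent bundle). If `nab` is one, then
`nab Y x v` is `(∇_v Y)(x)`. -/
abbrev Connection [IsManifold 𝓘(ℝ, E) ∞ M] : Type _ :=
  CovariantDerivative 𝓘(ℝ, E) E (TangentSpace 𝓘(ℝ, E) : M → Type _)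

/-- The field `J X`. -/
def applyJ (J : EndField E M) (X : VecField E M) : VecField E M := fun x ↦ J x (X x)

section NoMetric

variable [IsManifold 𝓘(ℝ, E) ∞ M]

/-- The vector field `X` is smooth on the set `W`. -/
def SmoothOn (X : VecField E M) (W : Set M) : Prop :=
  ContMDiffOn 𝓘(ℝ, E) 𝓘(ℝ, E).tangent ∞
    (fun x ↦ (⟨x, X x⟩ : TangentBundle 𝓘(ℝ, E) M)) W

/-- `X ∈ Γ(W, D)`: `X` is a smooth section of the distribution `D` over `W`. -/
def IsSectionOn (D : Distribution E M) (X : VecField E M) (W : Set M) : Prop :=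
  SmoothOn X W ∧ ∀ x ∈ W, X x ∈ D x

/-- `D` is a smooth distribution of rank `k`. -/
def IsSmoothDistribution (D : Distribution E M) (k : ℕ) : Prop :=
  (∀ x, Module.finrank ℝ (D x) = k) ∧
  ∀ x : M, ∃ W : Set M, IsOpen W ∧ x ∈ W ∧ ∃ s : Fin k → VecField E M,
    (∀ i, SmoothOn (s i) W) ∧ ∀ y ∈ W, D y = Submodule.span ℝ (Set.range fun i ↦ s i y)

/-- `D` is closed under brackets; by the Frobenius theorem, such a smooth distribution is the
same thing as a foliation. -/
def IsInvolutive (D : Distribution E M) : Prop :=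
  ∀ (W : Set M) (X Y : VecField E M), IsOpen W → IsSectionOn D X W → IsSectionOn D Y W →
    ∀ x ∈ W, VectorField.mlieBracket 𝓘(ℝ, E) X Y x ∈ D x

/-- The leaves of (the foliation tangent to) `D` are totally geodesic. -/
def IsTotallyGeodesic (nab : Connection E M) (D : Distribution E M) : Prop :=
  ∀ (W : Set M) (X Y : VecField E M), IsOpen W → IsSectionOn D X W → IsSectionOn D Y W →
    ∀ x ∈ W, nab Y x (X x) ∈ D x

/-- `D` is holomorphic: `(L_X J)(TM) ⊆ D` for every local section `X` of `D`, where
`(L_X J) Y = [X, J Y] - J [X, Y]`. -/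
def IsHolomorphicDistribution (J : EndField E M) (D : Distribution E M) : Prop :=
  ∀ (W : Set M) (X Y : VecField E M), IsOpen W → IsSectionOn D X W → SmoothOn Y W →
    ∀ x ∈ W, VectorField.mlieBracket 𝓘(ℝ, E) X (applyJ J Y) x
      - J x (VectorField.mlieBracket 𝓘(ℝ, E) X Y x) ∈ D x

/-- The one-form `α` is closed: `dα(X, Y) = X(α(Y)) - Y(α(X)) - α([X, Y])` vanishes for all
local smooth vector fields. -/
def IsClosedForm (α : OneForm E M) : Prop :=
  ∀ (W : Set M) (X Y : VecField E M), IsOpen W → SmoothOn X W → SmoothOn Y W →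
    ∀ x ∈ W, mvfderiv 𝓘(ℝ, E) (fun y ↦ α y (Y y)) x (X x)
      - mvfderiv 𝓘(ℝ, E) (fun y ↦ α y (X y)) x (Y x)
      - α x (VectorField.mlieBracket 𝓘(ℝ, E) X Y x) = 0

/-- The curvature operator `R(u, v) w` of a connection at `x`, that is the value at `x` of
`∇_U ∇_V Z - ∇_V ∇_U Z - ∇_[U, V] Z` for the extensions `U`, `V`, `Z` of the vectors `u`, `v`, `w`
that are constant in the preferred trivialization of `TM` at `x`. -/
def curvature (nab : Connection E M) (x : M) (u v w : TangentSpace 𝓘(ℝ, E) x) :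
    TangentSpace 𝓘(ℝ, E) x :=
  letI U : VecField E M := FiberBundle.extend E u
  letI V : VecField E M := FiberBundle.extend E v
  letI Z : VecField E M := FiberBundle.extend E w
  nab (fun y ↦ nab Z y (V y)) x u - nab (fun y ↦ nab Z y (U y)) x v
    - nab Z x (VectorField.mlieBracket 𝓘(ℝ, E) U V x)

/-! ### Curves -/

variable (E) in
/-- The velocity of the curve `c`, defined on the set `S` of parameters (one-sided at the end
points of a compact interval). -/
def velocity (c : ℝ → M) (S : Set ℝ) (t : ℝ) : TangentSpace 𝓘(ℝ, E) (c t) :=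
  mfderivWithin 𝓘(ℝ, ℝ) 𝓘(ℝ, E) c S t (1 : ℝ)

/-- The vector field `C` along the curve `c` is smooth on `S`. -/
def SmoothAlong (c : ℝ → M) (S : Set ℝ) (C : Π t : ℝ, TangentSpace 𝓘(ℝ, E) (c t)) : Prop :=
  ContMDiffOn 𝓘(ℝ, ℝ) 𝓘(ℝ, E).tangent ∞
    (fun t ↦ (⟨c t, C t⟩ : TangentBundle 𝓘(ℝ, E) M)) S

/-- The covariant derivative `∇_ċ C` of a vector field `C` along `c` (with parameters in `S`).
If `e₁, …, e_m` is the local frame of `TM` which is constant in the preferred trivialization at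
`c t`, and if `C = ∑ Cⁱ (eᵢ ∘ c)` near `t`, then
`(∇_ċ C)(t) = ∑ (Cⁱ)'(t) eᵢ + ∇_{ċ(t)} (∑ Cⁱ(t) eᵢ)`: the two summands below. -/
def covAlong (nab : Connection E M) (c : ℝ → M) (S : Set ℝ)
    (C : Π t : ℝ, TangentSpace 𝓘(ℝ, E) (c t)) (t : ℝ) : TangentSpace 𝓘(ℝ, E) (c t) :=
  letI triv := trivializationAt E (TangentSpace 𝓘(ℝ, E) : M → Type _) (c t)
  triv.symm (c t) (derivWithin (fun s ↦ (triv ⟨c s, C s⟩).2) S t)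
    + nab (FiberBundle.extend E (C t)) (c t) (velocity E c S t)

/-- `c` is a geodesic with parameter interval `S`. -/
def IsGeodesicOn (nab : Connection E M) (c : ℝ → M) (S : Set ℝ) : Prop :=
  ContMDiffOn 𝓘(ℝ, ℝ) 𝓘(ℝ, E) ∞ c S ∧
  ∀ t ∈ S, covAlong nab c S (velocity E c S) t = 0

/-- `C` is a Jacobi field along `c`: `∇_ċ² C - R(ċ, C) ċ = 0`. -/
def IsJacobiOn (nab : Connection E M) (c : ℝ → M) (S : Set ℝ)
    (C : Π t : ℝ, TangentSpace 𝓘(ℝ, E) (c t)) : Prop :=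
  SmoothAlong c S C ∧
  ∀ t ∈ S, covAlong nab c S (covAlong nab c S C) t
    - curvature nab (c t) (velocity E c S t) (C t) (velocity E c S t) = 0

/-- `V` is geodesically convex: any two of its points are joined by exactly one geodesic
`[0, 1] → V`. -/
def IsGeodesicallyConvex (nab : Connection E M) (V : Set M) : Prop :=
  ∀ x ∈ V, ∀ y ∈ V,
    ∃ c : ℝ → M, (IsGeodesicOn nab c (Icc 0 1) ∧ MapsTo c (Icc 0 1) V ∧ c 0 = x ∧ c 1 = y) ∧
      ∀ c' : ℝ → M,
        (IsGeodesicOn nab c' (Icc 0 1) ∧ MapsTo c' (Icc 0 1) V ∧ c' 0 = x ∧ c' 1 = y) →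
        EqOn c' c (Icc 0 1)

end NoMetric

section Metric

variable [FiniteDimensional ℝ E] [IsManifold 𝓘(ℝ, E) ∞ M]
  [RiemannianBundle (fun x : M ↦ TangentSpace 𝓘(ℝ, E) x)]
  [IsContMDiffRiemannianBundle 𝓘(ℝ, E) ∞ E (fun x : M ↦ TangentSpace 𝓘(ℝ, E) x)]

instance (x : M) : FiniteDimensional ℝ (TangentSpace 𝓘(ℝ, E) x) :=
  inferInstanceAs (FiniteDimensional ℝ E)

/-- `nab` is the Levi-Civita connection: torsion free and compatible with the metric. -/
def IsLeviCivita (nab : Connection E M) : Prop :=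
  nab.torsion = 0 ∧ CovariantDerivative.IsMetricCompatible (I := 𝓘(ℝ, E)) (F := E)
    (M := M) (V := fun x : M ↦ TangentSpace 𝓘(ℝ, E) x) (by exact nab)

/-- `(g, J)` is a Kähler structure, where `g` is the Riemannian metric of `M` and `nab` its
Levi-Civita connection: `J` is a smooth orthogonal almost complex structure with `∇ J = 0`. -/
structure IsKaehler (nab : Connection E M) (J : EndField E M) : Prop where
  smooth : ContMDiff 𝓘(ℝ, E) (𝓘(ℝ, E).prod 𝓘(ℝ, E →L[ℝ] E)) ∞
    (fun x ↦ TotalSpace.mk' (E →L[ℝ] E)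
      (E := fun x : M ↦ TangentSpace 𝓘(ℝ, E) x →L[ℝ] TangentSpace 𝓘(ℝ, E) x) x (J x))
  sq : ∀ (x : M) (v : TangentSpace 𝓘(ℝ, E) x), J x (J x v) = -v
  orthogonal : ∀ (x : M) (v w : TangentSpace 𝓘(ℝ, E) x), inner ℝ (J x v) (J x w) = inner ℝ v w
  parallel : ∀ (W : Set M) (X : VecField E M), IsOpen W → SmoothOn X W →
    ∀ x ∈ W, ∀ v : TangentSpace 𝓘(ℝ, E) x, nab (applyJ J X) x v = J x (nab X x v)

/-- The Lie derivative of the metric, `(L_V g)(X, Y) = V(g(X, Y)) - g([V, X], Y) - g(X, [V, Y])`,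
at the point `x`. -/
def lieDerivMetric (V X Y : VecField E M) (x : M) : ℝ :=
  mvfderiv 𝓘(ℝ, E) (fun y ↦ (inner ℝ (X y) (Y y) : ℝ)) x (V x)
    - inner ℝ (VectorField.mlieBracket 𝓘(ℝ, E) V X x) (Y x)
    - inner ℝ (X x) (VectorField.mlieBracket 𝓘(ℝ, E) V Y x)

/-- `L_V g = α(V) g` holds on `Dᗮ` for all local sections `V` of `D`, and `α` is a smooth one-form
that vanishes on `Dᗮ`. -/
def IsConformalWith (D : Distribution E M) (α : OneForm E M) : Prop :=
  ContMDiff 𝓘(ℝ, E) (𝓘(ℝ, E).prod 𝓘(ℝ, E →L[ℝ] ℝ)) ∞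
    (fun x ↦ TotalSpace.mk' (E →L[ℝ] ℝ)
      (E := fun x : M ↦ TangentSpace 𝓘(ℝ, E) x →L[ℝ] ℝ) x (α x)) ∧
  (∀ x : M, ∀ v ∈ (D x)ᗮ, α x v = 0) ∧
  ∀ (W : Set M) (V X Y : VecField E M), IsOpen W → IsSectionOn D V W →
    SmoothOn X W → SmoothOn Y W →
    ∀ x ∈ W, X x ∈ (D x)ᗮ → Y x ∈ (D x)ᗮ →
      lieDerivMetric V X Y x = α x (V x) * inner ℝ (X x) (Y x)

/-- `D` is homothetic: conformal, with a closed one-form `α`. -/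
def IsHomothetic (D : Distribution E M) : Prop :=
  ∃ α : OneForm E M, IsConformalWith D α ∧ IsClosedForm α

/-- `D` is tangent to a totally geodesic, holomorphic, complex homothetic foliation by (complex)
curves. -/
structure IsComplexHomotheticFoliation (nab : Connection E M) (J : EndField E M)
    (D : Distribution E M) : Prop where
  smooth : IsSmoothDistribution D 2
  involutive : IsInvolutive D
  complex : ∀ x : M, ∀ v ∈ D x, J x v ∈ D x
  totallyGeodesic : IsTotallyGeodesic nab D
  holomorphic : IsHolomorphicDistribution J D
  homothetic : IsHomothetic D

/-- The partial divergence `div_𝓔 X = ∑ᵢ g(∇_{eᵢ} X, eᵢ)`, where `e₁, e₂, …` is an orthonormal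
basis of `𝓔 = Dᗮ`. -/
def divE (nab : Connection E M) (D : Distribution E M) (X : VecField E M) (x : M) : ℝ :=
  ∑ i, inner ℝ (nab X x (stdOrthonormalBasis ℝ (D x)ᗮ i : TangentSpace 𝓘(ℝ, E) x))
    (stdOrthonormalBasis ℝ (D x)ᗮ i : TangentSpace 𝓘(ℝ, E) x)

/-- `X` is a smooth unit section of `D` on `W`. -/
def IsUnitSectionOn (D : Distribution E M) (X : VecField E M) (W : Set M) : Prop :=
  IsSectionOn D X W ∧ ∀ x ∈ W, ‖X x‖ = 1

/-- `κ = √((div_𝓔 ξ)² + (div_𝓔 Jξ)²)`, where `ξ` is a local unit section of `D` around the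
given point; the value does not depend on the choice of `ξ`. -/
def kappa (nab : Connection E M) (J : EndField E M) (D : Distribution E M) (x : M) : ℝ :=
  letI ξ : VecField E M := Classical.epsilon fun ξ : VecField E M ↦
    ∃ W : Set M, IsOpen W ∧ x ∈ W ∧ IsUnitSectionOn D ξ W
  Real.sqrt (divE nab D ξ x ^ 2 + divE nab D (applyJ J ξ) x ^ 2)

/-- The set `U = {κ ≠ 0}`. -/
def setU (nab : Connection E M) (J : EndField E M) (D : Distribution E M) : Set M :=
  {x | kappa nab J D x ≠ 0}

/-- The set `K = {κ = 0}`. -/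
def setK (nab : Connection E M) (J : EndField E M) (D : Distribution E M) : Set M :=
  {x | kappa nab J D x = 0}

/-- `ξ` is a principal section of `D` on the subset `V` of `U` : a smooth unit section of `D`
with `div_𝓔 Jξ = 0` (on a connected set, `ξ` is unique up to sign). -/
def IsPrincipalOn (nab : Connection E M) (J : EndField E M) (D : Distribution E M)
    (ξ : VecField E M) (V : Set M) : Prop :=
  IsUnitSectionOn D ξ V ∧ ∀ x ∈ V, divE nab D (applyJ J ξ) x = 0

/-- The function `p* = g(∇_{Jξ} Jξ, ξ)`. -/
def pStar (nab : Connection E M) (J : EndField E M) (ξ : VecField E M) (x : M) : ℝ :=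
  inner ℝ (nab (applyJ J ξ) x (J x (ξ x))) (ξ x)

/-- `X` is a special local Killing field on the open set `V ⊆ U`: `X = f Jξ`, where `ξ` is a
principal section and `f = exp F` with `dF = -p* η`, `η = g(ξ, ·)`. -/
def IsSpecialFieldOn (nab : Connection E M) (J : EndField E M) (D : Distribution E M)
    (X : VecField E M) (V : Set M) : Prop :=
  IsOpen V ∧ V ⊆ setU nab J D ∧
  ∃ (ξ : VecField E M) (F : M → ℝ), IsPrincipalOn nab J D ξ V ∧
    ContMDiffOn 𝓘(ℝ, E) 𝓘(ℝ, ℝ) ∞ F V ∧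
    (∀ x ∈ V, ∀ v : TangentSpace 𝓘(ℝ, E) x,
      mvfderiv 𝓘(ℝ, E) F x v = -(pStar nab J ξ x) * inner ℝ (ξ x) v) ∧
    ∀ x ∈ V, X x = Real.exp (F x) • J x (ξ x)

/-- `C` is a special Jacobi field along `c : [0, l] → M`: a Jacobi field whose initial data at
`t = 0` are those of a special local Killing field on an open geodesically convex neighbourhood
of `c 0`. -/
def IsSpecialJacobi (nab : Connection E M) (J : EndField E M) (D : Distribution E M)
    (c : ℝ → M) (l : ℝ) (C : Π t : ℝ, TangentSpace 𝓘(ℝ, E) (c t)) : Prop :=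
  IsJacobiOn nab c (Icc 0 l) C ∧
  ∃ (V : Set M) (X : VecField E M), c 0 ∈ V ∧ IsGeodesicallyConvex nab V ∧
    IsSpecialFieldOn nab J D X V ∧ C 0 = X (c 0) ∧
    covAlong nab c (Icc 0 l) C 0 = nab X (c 0) (velocity E c (Icc 0 l) 0)

end Metric

end HomotheticFoliation

end

/-! Let `N` be the vector field dual to the closed one-form `α` (the Lee field). It is smooth on all
of `M`, tangent to `D`, and it vanishes exactly where `κ` does. Closedness of `α` makes `∇N`
symmetric; the homothety condition and total geodesy give `∇_w N = ½ |N|² w` for `w ⊥ D`. On `U` a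
principal section is `±N / |N|`, and a special Killing field has the form `b J N` with `db = b g(N,
·)`. This description, unlike the one by `ξ`, has no singularity at `K`.

The geometric core is that `e^A J N` is a Killing field wherever `N ≠ 0` and `dA = g(N, ·)`. Its
covariant derivative is `e^A K` with `K v = J (∇_v N + g(N, v) N)`. For `w ⊥ D` the curvature `R(w,
V) N` can be computed from the known part of `∇N`; comparing it with `R(Jw, JV) N` by the Kähler
symmetries yields the missing part: `N` and `J N` are eigenvectors of `∇N`, with eigenvalues `λ` and
`λ + |N|²` (`cov_radial_eq`, `inner_cov_JN_N`, `inner_cov_JN_JN`). Adding `g(N, ·) N` equalizes the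
two, so the symmetric operator inside `K` commutes with `J`, and `K` is skew
(`inner_killingEnd_self`). The classical argument from the Ricci identity, skewness and pair
symmetry then gives the Jacobi equation along geodesics (`covEnd_killingEnd_self`).

Along `c` no potential `A` is needed: the scalar equation `a' = ⟨N, ċ⟩ a` has a solution on all of
`[0, l]`, since `N` is smooth across `K`. The field `a J N` is Jacobi on `[0, l)` and, for the right
`a 0`, has the initial data of `C` (`special_initial_data`), so `C = a J N` there by uniqueness.
Hence `|C| = |a| |N|` tends to `0` as `N (c l) = 0`. Moreover `⟨ċ, C⟩' = a ⟨ċ, K ċ⟩ = 0`, and the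
constant `⟨ċ, C⟩` is `0` because `C l = 0`. -/

noncomputable section

set_option linter.unusedSectionVars false
set_option maxSynthPendingDepth 3

namespace HomotheticFoliation

variable {E : Type*} [NormedAddCommGroup E] [NormedSpace ℝ E]
  {M : Type*} [TopologicalSpace M] [ChartedSpace E M]

/-! ### Vector fields, smoothness and brackets read in a chart -/

section ChartBridge

variable [IsManifold 𝓘(ℝ, E) ∞ M]

/-- Tangent vectors at `x` read in the preferred chart at `x₀`. -/
def toChart (x₀ x : M) : TangentSpace 𝓘(ℝ, E) x →L[ℝ] E :=
  (trivializationAt E (TangentSpace 𝓘(ℝ, E) : M → Type _) x₀).continuousLinearMapAt ℝ x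

/-- The tangent vector at `x` with given coordinates in the preferred chart at `x₀`. -/
def ofChart (x₀ x : M) : E →L[ℝ] TangentSpace 𝓘(ℝ, E) x :=
  (trivializationAt E (TangentSpace 𝓘(ℝ, E) : M → Type _) x₀).symmL ℝ x

/-- The coordinate expression of a vector field in the preferred chart at `x₀`. -/
def hat (x₀ : M) (X : VecField E M) : E → E := fun y ↦
  toChart x₀ ((extChartAt 𝓘(ℝ, E) x₀).symm y) (X ((extChartAt 𝓘(ℝ, E) x₀).symm y))

/-- The vector field with a given coordinate expression. -/
def chartField (x₀ : M) (Y : E → E) : VecField E M := fun x ↦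
  ofChart x₀ x (Y (extChartAt 𝓘(ℝ, E) x₀ x))

variable {x₀ x : M}

lemma mem_baseSet (hx : x ∈ (extChartAt 𝓘(ℝ, E) x₀).source) :
    x ∈ (trivializationAt E (TangentSpace 𝓘(ℝ, E) : M → Type _) x₀).baseSet := by
  simpa [TangentBundle.trivializationAt_baseSet] using hx

lemma ofChart_toChart (hx : x ∈ (extChartAt 𝓘(ℝ, E) x₀).source) (v : TangentSpace 𝓘(ℝ, E) x) :
    ofChart x₀ x (toChart x₀ x v) = v :=
  Trivialization.symmL_continuousLinearMapAt _ (mem_baseSet hx) v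

lemma toChart_ofChart (hx : x ∈ (extChartAt 𝓘(ℝ, E) x₀).source) (v : E) :
    toChart x₀ x (ofChart x₀ x v) = v :=
  Trivialization.continuousLinearMapAt_symmL _ (mem_baseSet hx) v

lemma toChart_injective (hx : x ∈ (extChartAt 𝓘(ℝ, E) x₀).source) :
    Function.Injective (toChart (E := E) x₀ x) := fun v w h ↦ by
  rw [← ofChart_toChart hx v, h, ofChart_toChart hx]

lemma toChart_apply (hx : x ∈ (extChartAt 𝓘(ℝ, E) x₀).source) (v : TangentSpace 𝓘(ℝ, E) x) :
    toChart x₀ x v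
      = (trivializationAt E (TangentSpace 𝓘(ℝ, E) : M → Type _) x₀ ⟨x, v⟩).2 :=
  Trivialization.linearMapAt_apply .. |>.trans (if_pos (mem_baseSet hx))

lemma toChart_eq_mfderiv (hx : x ∈ (extChartAt 𝓘(ℝ, E) x₀).source) :
    toChart x₀ x = mfderiv 𝓘(ℝ, E) 𝓘(ℝ, E) (extChartAt 𝓘(ℝ, E) x₀) x :=
  TangentBundle.continuousLinearMapAt_trivializationAt (by simpa using hx)

lemma hat_apply (hx : x ∈ (extChartAt 𝓘(ℝ, E) x₀).source) (X : VecField E M) :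
    hat x₀ X (extChartAt 𝓘(ℝ, E) x₀ x) = toChart x₀ x (X x) := by
  simp only [hat]
  rw [(extChartAt 𝓘(ℝ, E) x₀).left_inv hx]

lemma target_mem_nhds (hx : x ∈ (extChartAt 𝓘(ℝ, E) x₀).source) :
    (extChartAt 𝓘(ℝ, E) x₀).target ∈ 𝓝 (extChartAt 𝓘(ℝ, E) x₀ x) :=
  (isOpen_extChartAt_target x₀).mem_nhds ((extChartAt 𝓘(ℝ, E) x₀).map_source hx)

lemma source_mem_nhds (hx : x ∈ (extChartAt 𝓘(ℝ, E) x₀).source) :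
    (extChartAt 𝓘(ℝ, E) x₀).source ∈ 𝓝 x :=
  (isOpen_extChartAt_source x₀).mem_nhds hx

lemma hat_chartField {y : E} (hy : y ∈ (extChartAt 𝓘(ℝ, E) x₀).target) (Y : E → E) :
    hat x₀ (chartField x₀ Y : VecField E M) y = Y y := by
  simp only [hat, chartField]
  rw [toChart_ofChart ((extChartAt 𝓘(ℝ, E) x₀).map_target hy),
    (extChartAt 𝓘(ℝ, E) x₀).right_inv hy]

section Functions

variable {F : Type*} [NormedAddCommGroup F] [NormedSpace ℝ F]

lemma contMDiffAt_iff_chart {n : ℕ∞} (hx : x ∈ (extChartAt 𝓘(ℝ, E) x₀).source) {f : M → F} :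
    ContMDiffAt 𝓘(ℝ, E) 𝓘(ℝ, F) n f x ↔
      ContDiffAt ℝ n (f ∘ (extChartAt 𝓘(ℝ, E) x₀).symm) (extChartAt 𝓘(ℝ, E) x₀ x) := by
  have : IsManifold 𝓘(ℝ, E) n M := IsManifold.of_le (n := ∞) (by exact_mod_cast le_top)
  rw [contMDiffAt_iff_source_of_mem_source (x := x₀) (by simpa using hx)]
  simp [contMDiffWithinAt_univ, contMDiffAt_iff_contDiffAt]

lemma mdifferentiableAt_extChartAt_of_mem (hx : x ∈ (extChartAt 𝓘(ℝ, E) x₀).source) :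
    MDifferentiableAt 𝓘(ℝ, E) 𝓘(ℝ, E) (extChartAt 𝓘(ℝ, E) x₀) x :=
  mdifferentiableAt_extChartAt (by simpa using hx)

lemma mdifferentiableAt_extChartAt_symm (hx : x ∈ (extChartAt 𝓘(ℝ, E) x₀).source) :
    MDifferentiableAt 𝓘(ℝ, E) 𝓘(ℝ, E) (extChartAt 𝓘(ℝ, E) x₀).symm
      (extChartAt 𝓘(ℝ, E) x₀ x) := by
  have := mdifferentiableWithinAt_extChartAt_symm (I := 𝓘(ℝ, E))
    ((extChartAt 𝓘(ℝ, E) x₀).map_source hx)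
  rwa [modelWithCornersSelf_coe, range_id, mdifferentiableWithinAt_univ] at this

lemma eventuallyEq_comp_chart (hx : x ∈ (extChartAt 𝓘(ℝ, E) x₀).source) (f : M → F) :
    (f ∘ (extChartAt 𝓘(ℝ, E) x₀).symm) ∘ (extChartAt 𝓘(ℝ, E) x₀) =ᶠ[𝓝 x] f := by
  filter_upwards [source_mem_nhds hx] with z hz
  rw [Function.comp_apply, Function.comp_apply, (extChartAt 𝓘(ℝ, E) x₀).left_inv hz]

lemma mdifferentiableAt_iff_chart (hx : x ∈ (extChartAt 𝓘(ℝ, E) x₀).source) {f : M → F} :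
    MDifferentiableAt 𝓘(ℝ, E) 𝓘(ℝ, F) f x ↔
      DifferentiableAt ℝ (f ∘ (extChartAt 𝓘(ℝ, E) x₀).symm) (extChartAt 𝓘(ℝ, E) x₀ x) := by
  rw [← mdifferentiableAt_iff_differentiableAt]
  constructor
  · intro h
    refine MDifferentiableAt.comp _ ?_ (mdifferentiableAt_extChartAt_symm hx)
    rwa [(extChartAt 𝓘(ℝ, E) x₀).left_inv hx]
  · intro h
    exact (h.comp x (mdifferentiableAt_extChartAt_of_mem hx)).congr_of_eventuallyEq
      (eventuallyEq_comp_chart hx f).symm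

lemma mvfderiv_eq_chart (hx : x ∈ (extChartAt 𝓘(ℝ, E) x₀).source) {f : M → F}
    (hf : DifferentiableAt ℝ (f ∘ (extChartAt 𝓘(ℝ, E) x₀).symm) (extChartAt 𝓘(ℝ, E) x₀ x))
    (v : TangentSpace 𝓘(ℝ, E) x) :
    mvfderiv 𝓘(ℝ, E) f x v
      = fderiv ℝ (f ∘ (extChartAt 𝓘(ℝ, E) x₀).symm) (extChartAt 𝓘(ℝ, E) x₀ x)
          (toChart x₀ x v) := by
  have h1 : mfderiv 𝓘(ℝ, E) 𝓘(ℝ, F) f x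
      = mfderiv 𝓘(ℝ, E) 𝓘(ℝ, F)
        ((f ∘ (extChartAt 𝓘(ℝ, E) x₀).symm) ∘ (extChartAt 𝓘(ℝ, E) x₀)) x :=
    (eventuallyEq_comp_chart hx f).symm.mfderiv_eq
  have h2 := mfderiv_comp x hf.mdifferentiableAt (mdifferentiableAt_extChartAt_of_mem hx)
  rw [mfderiv_eq_fderiv, ← toChart_eq_mfderiv hx] at h2
  change mfderiv 𝓘(ℝ, E) 𝓘(ℝ, F) f x v = _
  rw [h1, h2]
  rfl

end Functions

lemma contMDiffAt_field_iff {n : ℕ∞} (hx : x ∈ (extChartAt 𝓘(ℝ, E) x₀).source)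
    {X : VecField E M} :
    ContMDiffAt 𝓘(ℝ, E) 𝓘(ℝ, E).tangent n (fun x ↦ (⟨x, X x⟩ : TangentBundle 𝓘(ℝ, E) M)) x ↔
      ContDiffAt ℝ n (hat x₀ X) (extChartAt 𝓘(ℝ, E) x₀ x) := by
  have h := (trivializationAt E (TangentSpace 𝓘(ℝ, E) : M → Type _) x₀).contMDiffAt_section_iff
    (IB := 𝓘(ℝ, E)) (n := (n : ℕ∞ω)) (s := X) (mem_baseSet hx)
  refine h.trans ((contMDiffAt_iff_chart hx).trans ?_)
  have h' : hat x₀ X =ᶠ[𝓝 (extChartAt 𝓘(ℝ, E) x₀ x)]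
      (fun x ↦ (trivializationAt E (TangentSpace 𝓘(ℝ, E) : M → Type _) x₀ ⟨x, X x⟩).2) ∘
        (extChartAt 𝓘(ℝ, E) x₀).symm := by
    filter_upwards [target_mem_nhds hx] with y hy
    exact toChart_apply ((extChartAt 𝓘(ℝ, E) x₀).map_target hy) _
  exact ⟨fun h ↦ h.congr_of_eventuallyEq h', fun h ↦ h.congr_of_eventuallyEq h'.symm⟩

lemma mdifferentiableAt_field_iff (hx : x ∈ (extChartAt 𝓘(ℝ, E) x₀).source) {X : VecField E M} :
    MDifferentiableAt 𝓘(ℝ, E) 𝓘(ℝ, E).tangent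
      (fun x ↦ (⟨x, X x⟩ : TangentBundle 𝓘(ℝ, E) M)) x ↔
      DifferentiableAt ℝ (hat x₀ X) (extChartAt 𝓘(ℝ, E) x₀ x) := by
  have h := (trivializationAt E (TangentSpace 𝓘(ℝ, E) : M → Type _) x₀).mdifferentiableAt_section_iff
    𝓘(ℝ, E) X (mem_baseSet hx)
  refine h.trans ((mdifferentiableAt_iff_chart hx).trans ?_)
  refine Filter.EventuallyEq.differentiableAt_iff ?_
  filter_upwards [target_mem_nhds hx] with y hy
  exact (toChart_apply ((extChartAt 𝓘(ℝ, E) x₀).map_target hy) _).symm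

lemma hat_chartField_eventuallyEq (hx : x ∈ (extChartAt 𝓘(ℝ, E) x₀).source) (Y : E → E) :
    hat x₀ (chartField x₀ Y : VecField E M) =ᶠ[𝓝 (extChartAt 𝓘(ℝ, E) x₀ x)] Y := by
  filter_upwards [target_mem_nhds hx] with y hy using hat_chartField hy Y

lemma contMDiffAt_chartField {n : ℕ∞} (hx : x ∈ (extChartAt 𝓘(ℝ, E) x₀).source) {Y : E → E}
    (hY : ContDiffAt ℝ n Y (extChartAt 𝓘(ℝ, E) x₀ x)) :
    ContMDiffAt 𝓘(ℝ, E) 𝓘(ℝ, E).tangent n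
      (fun x ↦ (⟨x, chartField x₀ Y x⟩ : TangentBundle 𝓘(ℝ, E) M)) x :=
  (contMDiffAt_field_iff hx).2 (hY.congr_of_eventuallyEq (hat_chartField_eventuallyEq hx Y))

lemma smoothOn_chartField_const (x₀ : M) (w : E) :
    SmoothOn (chartField x₀ (fun _ ↦ w) : VecField E M) (extChartAt 𝓘(ℝ, E) x₀).source :=
  fun _ hx ↦ (contMDiffAt_chartField (n := ⊤) hx contDiffAt_const).contMDiffWithinAt

lemma mdifferentiableAt_chartField (hx : x ∈ (extChartAt 𝓘(ℝ, E) x₀).source) {Y : E → E}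
    (hY : DifferentiableAt ℝ Y (extChartAt 𝓘(ℝ, E) x₀ x)) :
    MDifferentiableAt 𝓘(ℝ, E) 𝓘(ℝ, E).tangent
      (fun x ↦ (⟨x, chartField x₀ Y x⟩ : TangentBundle 𝓘(ℝ, E) M)) x :=
  (mdifferentiableAt_field_iff hx).2
    ((hat_chartField_eventuallyEq hx Y).differentiableAt_iff.2 hY)

/-- A constant vector field on the model space. -/
def constField (w : E) : VecField E E := fun _ ↦ w

lemma chartField_eq_mpullback (hx : x ∈ (extChartAt 𝓘(ℝ, E) x₀).source) (w : E) :
    chartField x₀ (fun _ ↦ w) x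
      = VectorField.mpullback 𝓘(ℝ, E) 𝓘(ℝ, E) (extChartAt 𝓘(ℝ, E) x₀) (constField w) x := by
  apply toChart_injective hx
  rw [chartField, toChart_ofChart hx]
  have h := isInvertible_mfderiv_extChartAt (I := 𝓘(ℝ, E)) hx
  have h2 := h.self_apply_inverse (constField w (extChartAt 𝓘(ℝ, E) x₀ x))
  rw [toChart_eq_mfderiv hx]
  exact h2.symm

lemma mdifferentiableAt_constField (w y : E) :
    MDifferentiableAt 𝓘(ℝ, E) 𝓘(ℝ, E).tangent
      (fun x ↦ (⟨x, constField w x⟩ : TangentBundle 𝓘(ℝ, E) E)) y :=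
  (contMDiffAt_vectorSpace_iff_contDiffAt (V := constField w) (n := 1).2
    contDiffAt_const).mdifferentiableAt one_ne_zero

/-- Coordinate fields are pullbacks of constant fields under the chart, and pullback commutes with
the bracket. -/
lemma mlieBracket_chartField_const [CompleteSpace E]
    (hx : x ∈ (extChartAt 𝓘(ℝ, E) x₀).source) (u v : E) :
    VectorField.mlieBracket 𝓘(ℝ, E) (chartField x₀ (fun _ ↦ u) : VecField E M)
      (chartField x₀ (fun _ ↦ v)) x = 0 := by
  have key : ∀ w : E, (chartField x₀ (fun _ ↦ w) : VecField E M) =ᶠ[𝓝 x]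
      VectorField.mpullback 𝓘(ℝ, E) 𝓘(ℝ, E) (extChartAt 𝓘(ℝ, E) x₀) (constField w) := by
    intro w
    filter_upwards [source_mem_nhds hx] with z hz using chartField_eq_mpullback hz _
  have : IsManifold 𝓘(ℝ, E) (minSmoothness ℝ 2) M := by
    rw [minSmoothness_of_isRCLikeNormedField]; infer_instance
  rw [(key u).mlieBracket_vectorField_eq (key v),
    ← VectorField.mpullback_mlieBracket (n := 2) (mdifferentiableAt_constField _ _)
      (mdifferentiableAt_constField _ _) (contMDiffAt_extChartAt' (by simpa using hx))
      (by simp [minSmoothness_of_isRCLikeNormedField]),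
    VectorField.mpullback_apply, ← VectorField.mlieBracketWithin_univ,
    VectorField.mlieBracketWithin_eq_lieBracketWithin]
  have h0 : VectorField.lieBracketWithin ℝ (fun _ : E ↦ u) (fun _ : E ↦ v) univ
      (extChartAt 𝓘(ℝ, E) x₀ x) = 0 := by
    simp [VectorField.lieBracketWithin]
  exact (congrArg _ h0).trans (map_zero _)

end ChartBridge

/-! ### Riemannian geometry of a metric on an open subset of a vector space -/

section Coordinates

variable [FiniteDimensional ℝ E] {G : E → E →L[ℝ] E →L[ℝ] ℝ} {Ω : Set E}

/-- `G` is a smooth Riemannian metric on the open subset `Ω` of the vector space `E`. -/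
structure IsMetricOn (G : E → E →L[ℝ] E →L[ℝ] ℝ) (Ω : Set E) : Prop where
  isOpen : IsOpen Ω
  smooth : ∀ y ∈ Ω, ContDiffAt ℝ ∞ G y
  symm : ∀ y u v, G y u v = G y v u
  pos : ∀ y ∈ Ω, ∀ v, v ≠ 0 → 0 < G y v v

/-- The Koszul expression `½ (D_u G(v, w) + D_v G(u, w) - D_w G(u, v))`. -/
def koszul (G : E → E →L[ℝ] E →L[ℝ] ℝ) (y : E) : E →L[ℝ] E →L[ℝ] E →L[ℝ] ℝ :=
  letI T : E →L[ℝ] E →L[ℝ] E →L[ℝ] ℝ := fderiv ℝ G y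
  (1 / 2 : ℝ) • (T + T.flip
    - ((ContinuousLinearMap.flipₗᵢ ℝ E E ℝ).toContinuousLinearEquiv :
        (E →L[ℝ] E →L[ℝ] ℝ) →L[ℝ] (E →L[ℝ] E →L[ℝ] ℝ)).comp T.flip)

lemma koszul_apply (y u v w : E) :
    koszul G y u v w
      = (1 / 2 : ℝ) * (fderiv ℝ G y u v w + fderiv ℝ G y v u w - fderiv ℝ G y w u v) := by
  simp [koszul]

/-- The Christoffel symbols of the metric `G`. -/
def christoffel (G : E → E →L[ℝ] E →L[ℝ] ℝ) (y : E) : E →L[ℝ] E →L[ℝ] E :=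
  (ContinuousLinearMap.compL ℝ E (E →L[ℝ] ℝ) E (G y).inverse).comp (koszul G y)

/-- The covariant derivative of a vector field. -/
def cov (G : E → E →L[ℝ] E →L[ℝ] ℝ) (Y : E → E) (y : E) : E →L[ℝ] E :=
  fderiv ℝ Y y + (christoffel G y).flip (Y y)

/-- The covariant derivative of a field of endomorphisms. -/
def covEnd (G : E → E →L[ℝ] E →L[ℝ] ℝ) (A : E → E →L[ℝ] E) (y u v : E) : E :=
  fderiv ℝ A y u v + christoffel G y u (A y v) - A y (christoffel G y u v)

/-- The curvature operator `R(u, v) w` of the metric `G`. -/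
def curv (G : E → E →L[ℝ] E →L[ℝ] ℝ) (y u v w : E) : E :=
  fderiv ℝ (christoffel G) y u v w - fderiv ℝ (christoffel G) y v u w
    + christoffel G y u (christoffel G y v w) - christoffel G y v (christoffel G y u w)

lemma cov_apply (Y : E → E) (y u : E) :
    cov G Y y u = fderiv ℝ Y y u + christoffel G y u (Y y) := rfl

lemma cov_add {X Y : E → E} {y : E} (hX : DifferentiableAt ℝ X y) (hY : DifferentiableAt ℝ Y y)
    (u : E) : cov G (fun z ↦ X z + Y z) y u = cov G X y u + cov G Y y u := by
  simp only [cov_apply, fderiv_fun_add hX hY, add_apply, map_add]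
  abel

lemma cov_sub {X Y : E → E} {y : E} (hX : DifferentiableAt ℝ X y) (hY : DifferentiableAt ℝ Y y)
    (u : E) : cov G (fun z ↦ X z - Y z) y u = cov G X y u - cov G Y y u := by
  simp only [cov_apply, fderiv_fun_sub hX hY, sub_apply, map_sub]
  abel

lemma cov_smul {f : E → ℝ} {Y : E → E} {y : E} (hf : DifferentiableAt ℝ f y)
    (hY : DifferentiableAt ℝ Y y) (u : E) :
    cov G (fun z ↦ f z • Y z) y u = fderiv ℝ f y u • Y y + f y • cov G Y y u := by
  simp only [cov_apply, fderiv_fun_smul hf hY, add_apply,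
    smul_apply, ContinuousLinearMap.smulRight_apply, map_smul, smul_add]
  abel

lemma cov_clm_apply {A : E → E →L[ℝ] E} {Y : E → E} {y : E} (hA : DifferentiableAt ℝ A y)
    (hY : DifferentiableAt ℝ Y y) (u : E) :
    cov G (fun z ↦ A z (Y z)) y u = covEnd G A y u (Y y) + A y (cov G Y y u) := by
  simp only [cov_apply, covEnd, fderiv_clm_apply hA hY, add_apply,
    ContinuousLinearMap.coe_comp, Function.comp_apply, ContinuousLinearMap.flip_apply, map_add]
  abel

lemma cov_congr {X Y : E → E} {y : E} (h : X =ᶠ[𝓝 y] Y) : cov G X y = cov G Y y := by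
  rw [cov, cov, h.fderiv_eq, h.eq_of_nhds]

lemma cov_const (w y u : E) : cov G (fun _ ↦ w) y u = christoffel G y u w := by
  simp [cov_apply]

lemma curv_antisymm (y u v w : E) : curv G y u v w = -curv G y v u w := by
  simp only [curv]; abel

namespace IsMetricOn

variable (hG : IsMetricOn G Ω) {y : E} (hy : y ∈ Ω)
include hG hy

/-- Positivity makes `G y` injective, hence bijective by dimension. So `(G y).inverse` in
`christoffel` is a true inverse and not its default value `0`. -/
lemma exists_equiv : ∃ e : E ≃L[ℝ] (E →L[ℝ] ℝ), (e : E →L[ℝ] (E →L[ℝ] ℝ)) = G y := by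
  have hinj : Function.Injective (G y) := by
    rw [injective_iff_map_eq_zero]
    intro v hv
    by_contra h
    have := hG.pos y hy v h
    rw [hv] at this
    simp at this
  have hdim : Module.finrank ℝ E = Module.finrank ℝ (E →L[ℝ] ℝ) :=
    (Subspace.dual_finrank_eq (K := ℝ) (V := E)).symm.trans
      (LinearMap.toContinuousLinearMap (𝕜 := ℝ) (E := E) (F' := ℝ)).finrank_eq
  refine ⟨(LinearEquiv.ofInjectiveOfFinrankEq (G y : E →ₗ[ℝ] (E →L[ℝ] ℝ)) hinj
    hdim).toContinuousLinearEquiv, ?_⟩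
  ext u v
  rfl

lemma ext_inner {u v : E} (h : ∀ w, G y u w = G y v w) : u = v := by
  obtain ⟨e, he⟩ := hG.exists_equiv hy
  apply e.injective
  ext w
  have := h w
  rwa [← he] at this

lemma contDiffAt_koszul : ContDiffAt ℝ ∞ (koszul G) y := by
  have hT : ContDiffAt ℝ ∞ (fderiv ℝ G) y := (hG.smooth y hy).fderiv_right (by simp)
  have hF : ContDiffAt ℝ ∞ (fun y ↦ (fderiv ℝ G y).flip) y :=
    (ContinuousLinearMap.flipₗᵢ ℝ E E (E →L[ℝ] ℝ)).contDiff.contDiffAt.comp y hT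
  exact ((hT.add hF).sub (contDiffAt_const.clm_comp hF)).const_smul (1 / 2 : ℝ)

lemma inner_christoffel (u v w : E) : G y (christoffel G y u v) w = koszul G y u v w := by
  obtain ⟨e, he⟩ := hG.exists_equiv hy
  have h : (G y).IsInvertible := ⟨e, he⟩
  exact congrArg (fun L : E →L[ℝ] ℝ ↦ L w) (h.self_apply_inverse (koszul G y u v))

lemma contDiffAt_inverse : ContDiffAt ℝ ∞ (fun y ↦ (G y).inverse) y := by
  obtain ⟨e, he⟩ := hG.exists_equiv hy
  have := contDiffAt_map_inverse (𝕜 := ℝ) (n := ∞) e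
  rw [he] at this
  exact this.comp y (hG.smooth y hy)

lemma contDiffAt_christoffel : ContDiffAt ℝ ∞ (christoffel G) y :=
  ((ContinuousLinearMap.compL ℝ E (E →L[ℝ] ℝ) E).contDiff.contDiffAt.comp y
    (hG.contDiffAt_inverse hy)).clm_comp (hG.contDiffAt_koszul hy)

lemma differentiableAt_christoffel : DifferentiableAt ℝ (christoffel G) y :=
  (hG.contDiffAt_christoffel hy).differentiableAt (by simp)

lemma differentiableAt : DifferentiableAt ℝ G y :=
  (hG.smooth y hy).differentiableAt (by simp)

lemma fderiv_apply_apply (u v w : E) :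
    fderiv ℝ (fun z ↦ G z v w) y u = fderiv ℝ G y u v w := by
  have h := (hG.differentiableAt hy).hasFDerivAt
  have h2 := (h.clm_apply (hasFDerivAt_const v y)).clm_apply (hasFDerivAt_const w y)
  rw [h2.fderiv]
  simp

lemma fderiv_symm (u v w : E) : fderiv ℝ G y u v w = fderiv ℝ G y u w v := by
  rw [← hG.fderiv_apply_apply hy, ← hG.fderiv_apply_apply hy]
  simp_rw [hG.symm _ v w]

lemma christoffel_symm (u v : E) : christoffel G y u v = christoffel G y v u := by
  refine hG.ext_inner hy fun w ↦ ?_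
  rw [hG.inner_christoffel hy, hG.inner_christoffel hy, koszul_apply, koszul_apply,
    hG.fderiv_symm hy w u v]
  ring

/-- Compatibility of the metric with its Christoffel symbols: in the sum of the two Koszul
expressions all but the derivative along `u` cancels. -/
lemma fderiv_eq (u v w : E) :
    fderiv ℝ G y u v w = G y (christoffel G y u v) w + G y v (christoffel G y u w) := by
  rw [hG.symm y v, hG.inner_christoffel hy, hG.inner_christoffel hy, koszul_apply, koszul_apply,
    hG.fderiv_symm hy u w v, hG.fderiv_symm hy v u w, hG.fderiv_symm hy w u v]
  ring

lemma fderiv_inner {X Y : E → E} (hX : DifferentiableAt ℝ X y) (hY : DifferentiableAt ℝ Y y)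
    (u : E) :
    fderiv ℝ (fun z ↦ G z (X z) (Y z)) y u = G y (cov G X y u) (Y y) + G y (X y) (cov G Y y u) := by
  have h2 := (((hG.differentiableAt hy).hasFDerivAt.clm_apply hX.hasFDerivAt).clm_apply
    hY.hasFDerivAt)
  rw [h2.fderiv]
  have := hG.fderiv_eq hy u (X y) (Y y)
  simp only [add_apply, ContinuousLinearMap.coe_comp, Function.comp_apply,
    ContinuousLinearMap.flip_apply, cov_apply, map_add, this]
  ring

lemma differentiableAt_inner {X Y : E → E} (hX : DifferentiableAt ℝ X y)
    (hY : DifferentiableAt ℝ Y y) : DifferentiableAt ℝ (fun z ↦ G z (X z) (Y z)) y :=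
  ((hG.differentiableAt hy).clm_apply hX).clm_apply hY

lemma contDiffAt_cov {Y : E → E} (hY : ContDiffAt ℝ ∞ Y y) : ContDiffAt ℝ ∞ (cov G Y) y := by
  have h1 : ContDiffAt ℝ ∞ (fderiv ℝ Y) y := hY.fderiv_right (by simp)
  have h2 : ContDiffAt ℝ ∞ (fun y ↦ (christoffel G y).flip) y :=
    (ContinuousLinearMap.flipₗᵢ ℝ E E E).contDiff.contDiffAt.comp y (hG.contDiffAt_christoffel hy)
  exact h1.add (h2.clm_apply hY)

lemma fderiv_christoffel_symm (u v w : E) :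
    fderiv ℝ (christoffel G) y u v w = fderiv ℝ (christoffel G) y u w v := by
  have h := (hG.differentiableAt_christoffel hy).hasFDerivAt
  have key (v w : E) : fderiv ℝ (fun z ↦ christoffel G z v w) y u
      = fderiv ℝ (christoffel G) y u v w := by
    rw [((h.clm_apply (hasFDerivAt_const v y)).clm_apply (hasFDerivAt_const w y)).fderiv]
    simp
  rw [← key, ← key]
  have : (fun z ↦ christoffel G z v w) =ᶠ[𝓝 y] fun z ↦ christoffel G z w v := by
    filter_upwards [hG.isOpen.mem_nhds hy] with z hz using hG.christoffel_symm hz v w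
  rw [this.fderiv_eq]

lemma curv_bianchi (u v w : E) : curv G y u v w + curv G y v w u + curv G y w u v = 0 := by
  simp only [curv]
  rw [hG.fderiv_christoffel_symm hy v w u, hG.fderiv_christoffel_symm hy w v u,
    hG.fderiv_christoffel_symm hy u w v, hG.christoffel_symm hy w u, hG.christoffel_symm hy v u,
    hG.christoffel_symm hy w v]
  abel

/-- The Ricci identity. -/
lemma cov_cov_sub {Y : E → E} (hY : ContDiffAt ℝ ∞ Y y) (u v : E) :
    cov G (fun z ↦ cov G Y z v) y u - cov G (fun z ↦ cov G Y z u) y v = curv G y u v (Y y) := by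
  have hY1 : DifferentiableAt ℝ Y y := hY.differentiableAt (by simp)
  have hY2 : DifferentiableAt ℝ (fderiv ℝ Y) y :=
    (hY.fderiv_right (m := ∞) (by simp)).differentiableAt (by simp)
  have hΓ := hG.differentiableAt_christoffel hy
  have key (u v : E) : fderiv ℝ (fun z ↦ cov G Y z v) y u
      = fderiv ℝ (fderiv ℝ Y) y u v + fderiv ℝ (christoffel G) y u v (Y y)
        + christoffel G y v (fderiv ℝ Y y u) := by
    have h := (hY2.hasFDerivAt.clm_apply (hasFDerivAt_const v y)).add
      ((hΓ.hasFDerivAt.clm_apply (hasFDerivAt_const v y)).clm_apply hY1.hasFDerivAt)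
    have h' : HasFDerivAt (fun z ↦ cov G Y z v) _ y := h
    rw [h'.fderiv]
    simp
    abel
  have hsymm : fderiv ℝ (fderiv ℝ Y) y u v = fderiv ℝ (fderiv ℝ Y) y v u :=
    (hY.isSymmSndFDerivAt (by simp [minSmoothness_of_isRCLikeNormedField]; exact WithTop.coe_le_coe.2 le_top)) u v
  rw [cov_apply (fun z ↦ cov G Y z v), cov_apply (fun z ↦ cov G Y z u), key, key, hsymm, cov_apply, cov_apply, map_add, map_add, curv]
  abel

lemma contDiffAt_cov_apply {Y : E → E} (hY : ContDiffAt ℝ ∞ Y y) (v : E) :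
    ContDiffAt ℝ ∞ (fun z ↦ cov G Y z v) y :=
  (hG.contDiffAt_cov hy hY).clm_apply contDiffAt_const

/-- The Ricci identity for the tensorial second derivative. It differs from the version with
constant `u`, `v` by `∇Y` of a Christoffel term, symmetric in `u` and `v`. -/
lemma covEnd_cov_sub {Y : E → E} (hY : ContDiffAt ℝ ∞ Y y) (u v : E) :
    covEnd G (cov G Y) y u v - covEnd G (cov G Y) y v u = curv G y u v (Y y) := by
  have hd := (hG.contDiffAt_cov hy hY).differentiableAt (by simp)
  have key (u v : E) : cov G (fun z ↦ cov G Y z v) y u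
      = covEnd G (cov G Y) y u v + cov G Y y (christoffel G y u v) := by
    rw [cov_clm_apply hd (differentiableAt_const v), cov_const]
  rw [← hG.cov_cov_sub hy hY, key, key, hG.christoffel_symm hy v u]
  abel

/-- The second derivative of the function `G(w, w)`, with `w` constant, is symmetric. Expanded by
metric compatibility, its antisymmetric part is `2 G(R(u, v) w, w)`. -/
lemma inner_curv_self (u v w : E) : G y (curv G y u v w) w = 0 := by
  have hw : ∀ z, ContDiffAt ℝ ∞ (fun _ : E ↦ w) z := fun z ↦ contDiffAt_const
  have key (v : E) : (fun z ↦ fderiv ℝ (fun z ↦ G z w w) z v) =ᶠ[𝓝 y]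
      fun z ↦ 2 * G z (cov G (fun _ ↦ w) z v) w := by
    filter_upwards [hG.isOpen.mem_nhds hy] with z hz
    rw [hG.fderiv_inner hz (differentiableAt_const w) (differentiableAt_const w),
      hG.symm z w]
    ring
  have hf : ContDiffAt ℝ ∞ (fun z ↦ G z w w) y :=
    ((hG.smooth y hy).clm_apply contDiffAt_const).clm_apply contDiffAt_const
  have hf2 : DifferentiableAt ℝ (fderiv ℝ fun z ↦ G z w w) y :=
    (hf.fderiv_right (m := ∞) (by simp)).differentiableAt (by simp)
  have key2 (u v : E) : fderiv ℝ (fderiv ℝ fun z ↦ G z w w) y u v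
      = 2 * (G y (cov G (fun z ↦ cov G (fun _ ↦ w) z v) y u) w
        + G y (cov G (fun _ ↦ w) y v) (cov G (fun _ ↦ w) y u)) := by
    have h1 : fderiv ℝ (fderiv ℝ fun z ↦ G z w w) y u v
        = fderiv ℝ (fun z ↦ fderiv ℝ (fun z ↦ G z w w) z v) y u := by
      rw [(hf2.hasFDerivAt.clm_apply (hasFDerivAt_const v y)).fderiv]
      simp
    have hd := (hG.contDiffAt_cov_apply hy (hw y) v).differentiableAt (by simp)
    rw [h1, (key v).fderiv_eq, fderiv_const_mul
      (hG.differentiableAt_inner hy hd (differentiableAt_const w)),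
      smul_apply, hG.fderiv_inner hy hd (differentiableAt_const w), smul_eq_mul]
  have hsymm : fderiv ℝ (fderiv ℝ fun z ↦ G z w w) y u v
      = fderiv ℝ (fderiv ℝ fun z ↦ G z w w) y v u :=
    (hf.isSymmSndFDerivAt (by simp [minSmoothness_of_isRCLikeNormedField]; exact WithTop.coe_le_coe.2 le_top)) u v
  rw [key2, key2, hG.symm y (cov G (fun _ ↦ w) y v)] at hsymm
  have h := hG.cov_cov_sub hy (hw y) u v
  rw [← h, map_sub, sub_apply]
  linarith

lemma curv_add (u v w z : E) : curv G y u v (w + z) = curv G y u v w + curv G y u v z := by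
  simp only [curv, map_add]; abel

lemma inner_curv_skew (u v w z : E) : G y (curv G y u v w) z = -G y (curv G y u v z) w := by
  have h := hG.inner_curv_self hy u v (w + z)
  rw [hG.curv_add hy, map_add, map_add, add_apply,
    add_apply, hG.inner_curv_self hy, hG.inner_curv_self hy] at h
  linarith

lemma inner_curv_pair_symm (u v w z : E) : G y (curv G y u v w) z = G y (curv G y w z u) v := by
  have b (u v w z : E) : G y (curv G y u v w) z + G y (curv G y v w u) z
      + G y (curv G y w u v) z = 0 := by
    have := congrArg (fun a ↦ G y a z) (hG.curv_bianchi hy u v w)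
    simpa using this
  have a (u v w z : E) : G y (curv G y u v w) z = -G y (curv G y v u w) z := by
    rw [curv_antisymm]; simp
  have s := hG.inner_curv_skew hy
  linarith [b u v w z, b v w z u, b w z u v, b z u v w, a u v w z, a v w u z, a w u v z, a v w z u,
    a w z v u, a z v w u, a w z u v, a z u w v, a u w z v, a z u v w, a u v z w, a v z u w,
    s u v w z, s v w u z, s w u v z, s w z u v, s z u w v, s z v w u, s u w z v, s v z u w,
    s z u v w, s w z v u, s v w z u, s u v z w]

-- The preceding pair symmetry is the usual linear combination of Bianchi identities over the cyclic
-- triples, with the two skew-symmetries.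
end IsMetricOn

end Coordinates

/-! ### Kähler structures in coordinates -/

section KaehlerCoordinates

variable [FiniteDimensional ℝ E] {G : E → E →L[ℝ] E →L[ℝ] ℝ} {J : E → E →L[ℝ] E} {N : E → E}
  {Ω : Set E}

/-- `(G, J)` is a Kähler structure on the open subset `Ω` of the vector space `E`. -/
structure IsKaehlerOn (G : E → E →L[ℝ] E →L[ℝ] ℝ) (J : E → E →L[ℝ] E) (Ω : Set E) : Prop
    extends IsMetricOn G Ω where
  smooth_J : ∀ y ∈ Ω, ContDiffAt ℝ ∞ J y
  sq : ∀ y ∈ Ω, ∀ v, J y (J y v) = -v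
  orthogonal : ∀ y ∈ Ω, ∀ u v, G y (J y u) (J y v) = G y u v
  parallel : ∀ y ∈ Ω, ∀ u v, covEnd G J y u v = 0

lemma covEnd_smul (A : E → E →L[ℝ] E) (y u v : E) (a : ℝ) :
    covEnd G A y u (a • v) = a • covEnd G A y u v := by
  simp only [covEnd, map_smul, smul_add, smul_sub]

lemma covEnd_eq {A : E → E →L[ℝ] E} {y : E} (hA : DifferentiableAt ℝ A y) (u v : E) :
    covEnd G A y u v = cov G (fun z ↦ A z v) y u - A y (christoffel G y u v) := by
  rw [cov_clm_apply hA (differentiableAt_const v), cov_const]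
  abel

namespace IsMetricOn

variable (hG : IsMetricOn G Ω) {y : E} (hy : y ∈ Ω)
include hG hy

lemma fderiv_inner_clm {A B : E → E →L[ℝ] E} (hA : DifferentiableAt ℝ A y)
    (hB : DifferentiableAt ℝ B y) (u v w : E) :
    fderiv ℝ (fun z ↦ G z (A z v) (B z w)) y u
      = G y (covEnd G A y u v + A y (christoffel G y u v)) (B y w)
        + G y (A y v) (covEnd G B y u w + B y (christoffel G y u w)) := by
  rw [hG.fderiv_inner hy (hA.clm_apply (differentiableAt_const v))
    (hB.clm_apply (differentiableAt_const w)),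
    cov_clm_apply hA (differentiableAt_const v), cov_clm_apply hB (differentiableAt_const w),
    cov_const, cov_const]

lemma covEnd_id (u v : E) : covEnd G (fun _ ↦ ContinuousLinearMap.id ℝ E) y u v = 0 := by
  simp [covEnd]

/-- The covariant derivative of a field of symmetric endomorphisms is symmetric; the sign allows
for fields of skew-symmetric ones. -/
lemma inner_covEnd {A : E → E →L[ℝ] E} (ε : ℝ) (hA : DifferentiableAt ℝ A y)
    (h : ∀ z ∈ Ω, ∀ v w, G z (A z v) w = ε * G z v (A z w)) (u v w : E) :
    G y (covEnd G A y u v) w = ε * G y v (covEnd G A y u w) := by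
  have hI : DifferentiableAt ℝ (fun _ : E ↦ ContinuousLinearMap.id ℝ E) y :=
    differentiableAt_const _
  have h1 := hG.fderiv_inner_clm hy hA hI u v w
  have h2 := hG.fderiv_inner_clm hy hI hA u v w
  have h3 : (fun z ↦ G z (A z v) (ContinuousLinearMap.id ℝ E w))
      =ᶠ[𝓝 y] fun z ↦ ε * G z (ContinuousLinearMap.id ℝ E v) (A z w) := by
    filter_upwards [hG.isOpen.mem_nhds hy] with z hz using h z hz v w
  rw [h3.fderiv_eq, fderiv_const_mul, smul_apply, smul_eq_mul, h2] at h1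
  · simp only [hG.covEnd_id hy, zero_add, map_add, add_apply, ContinuousLinearMap.id_apply] at h1
    rw [h y hy, h y hy] at h1
    linarith
  · exact hG.differentiableAt_inner hy (differentiableAt_const v)
      (hA.clm_apply (differentiableAt_const w))

end IsMetricOn

namespace IsKaehlerOn

variable (hG : IsKaehlerOn G J Ω) {y : E} (hy : y ∈ Ω)
include hG hy

lemma differentiableAt_J : DifferentiableAt ℝ J y :=
  (hG.smooth_J y hy).differentiableAt (by simp)

lemma inner_J_left (u v : E) : G y (J y u) v = -G y u (J y v) := by
  rw [← hG.orthogonal y hy u (J y v), hG.sq y hy, map_neg, neg_neg]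

lemma inner_J_self (u : E) : G y (J y u) u = 0 := by
  have h := hG.inner_J_left hy u u
  rw [hG.symm y u] at h
  linarith

lemma cov_J {Y : E → E} (hY : DifferentiableAt ℝ Y y) (u : E) :
    cov G (fun z ↦ J z (Y z)) y u = J y (cov G Y y u) := by
  rw [cov_clm_apply (hG.differentiableAt_J hy) hY, hG.parallel y hy, zero_add]

/-- A parallel `J` commutes with both covariant derivatives in the Ricci identity. -/
lemma curv_J (u v w : E) : curv G y u v (J y w) = J y (curv G y u v w) := by
  have hw : ∀ z, ContDiffAt ℝ ∞ (fun _ : E ↦ w) z := fun z ↦ contDiffAt_const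
  have key (u v : E) : cov G (fun z ↦ cov G (fun z ↦ J z w) z v) y u
      = J y (cov G (fun z ↦ cov G (fun _ ↦ w) z v) y u) := by
    have h : (fun z ↦ cov G (fun z ↦ J z w) z v)
        =ᶠ[𝓝 y] fun z ↦ J z (cov G (fun _ ↦ w) z v) := by
      filter_upwards [hG.isOpen.mem_nhds hy] with z hz
        using hG.cov_J hz (differentiableAt_const w) v
    rw [cov_congr h, hG.cov_J hy ((hG.contDiffAt_cov_apply hy (hw y) v).differentiableAt
      (by simp))]
  rw [← hG.cov_cov_sub hy (hw y), map_sub, ← key, ← key]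
  exact (hG.cov_cov_sub hy ((hG.smooth_J y hy).clm_apply contDiffAt_const) u v).symm

/-- Pair symmetry moves `J` from the first two arguments to the last two, where it commutes with the
curvature and is orthogonal. -/
lemma curv_J_J (u v w : E) : curv G y (J y u) (J y v) w = curv G y u v w := by
  refine hG.ext_inner hy fun z ↦ ?_
  rw [hG.inner_curv_pair_symm hy, hG.curv_J hy, hG.orthogonal y hy,
    ← hG.inner_curv_pair_symm hy]

end IsKaehlerOn

/-! ### The eigenstructure of `∇N` and the Killing identity -/

/-- `N` is the gradient of a local potential on a Kähler domain; `∇N` is `½ |N|²` times the identity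
on the complement of `span {N, J N}`, as it happens for complex homothetic foliations. -/
structure IsHomotheticGradientOn (G : E → E →L[ℝ] E →L[ℝ] ℝ) (J : E → E →L[ℝ] E) (N : E → E)
    (Ω : Set E) : Prop extends IsKaehlerOn G J Ω where
  smooth_N : ∀ y ∈ Ω, ContDiffAt ℝ ∞ N y
  ne_zero : ∀ y ∈ Ω, N y ≠ 0
  cov_symm : ∀ y ∈ Ω, ∀ u v, G y (cov G N y u) v = G y u (cov G N y v)
  cov_perp : ∀ y ∈ Ω, ∀ w, G y w (N y) = 0 → G y w (J y (N y)) = 0 →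
    cov G N y w = ((1 / 2 : ℝ) * G y (N y) (N y)) • w
  exists_perp : ∀ y ∈ Ω, ∃ w, w ≠ 0 ∧ G y w (N y) = 0 ∧ G y w (J y (N y)) = 0

/-- The endomorphism `v ↦ J (∇_v N + g(N, v) N)`. -/
def killingEnd (G : E → E →L[ℝ] E →L[ℝ] ℝ) (J : E → E →L[ℝ] E) (N : E → E) (y : E) : E →L[ℝ] E :=
  (J y).comp (cov G N y + (G y (N y)).smulRight (N y))

lemma killingEnd_apply (y v : E) :
    killingEnd G J N y v = J y (cov G N y v + G y (N y) v • N y) := rfl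

namespace IsHomotheticGradientOn

variable (hN : IsHomotheticGradientOn G J N Ω) {y : E} (hy : y ∈ Ω)
include hN hy

lemma differentiableAt_N : DifferentiableAt ℝ N y :=
  (hN.smooth_N y hy).differentiableAt (by simp)

lemma differentiableAt_JN : DifferentiableAt ℝ (fun z ↦ J z (N z)) y :=
  (hN.differentiableAt_J hy).clm_apply (hN.differentiableAt_N hy)

lemma differentiableAt_cov : DifferentiableAt ℝ (cov G N) y :=
  (hN.contDiffAt_cov hy (hN.smooth_N y hy)).differentiableAt (by simp)

lemma inner_N_pos : 0 < G y (N y) (N y) := hN.pos y hy _ (hN.ne_zero y hy)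

lemma inner_JN_N : G y (J y (N y)) (N y) = 0 := hN.inner_J_self hy _

lemma inner_JN_JN : G y (J y (N y)) (J y (N y)) = G y (N y) (N y) := hN.orthogonal y hy _ _

/-- The component orthogonal to `span {N, J N}` is an eigenvector. -/
lemma cov_projection (w : E) :
    cov G N y (G y (N y) (N y) • w - G y w (N y) • N y - G y w (J y (N y)) • J y (N y))
      = ((1 / 2 : ℝ) * G y (N y) (N y)) •
        (G y (N y) (N y) • w - G y w (N y) • N y - G y w (J y (N y)) • J y (N y)) := by
  have h1 := hN.inner_JN_N hy
  have h2 := hN.inner_JN_JN hy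
  have h3 : G y (N y) (J y (N y)) = 0 := by rw [hN.symm, h1]
  apply hN.cov_perp y hy
  · simp only [map_sub, map_smul, sub_apply, smul_apply, smul_eq_mul, h1]
    ring
  · simp only [map_sub, map_smul, sub_apply, smul_apply, smul_eq_mul, h2, h3]
    ring

/-- Derivative of the eigenvector equation `cov_projection`. A constant `w` is orthogonal to `N` and
`J N` at `y` only; the projection, scaled by `|N|²` to avoid division, keeps the equation valid near
`y`. -/
lemma covEnd_cov_perp {w : E} (h1 : G y w (N y) = 0) (h2 : G y w (J y (N y)) = 0) (u : E) :
    G y (N y) (N y) • covEnd G (cov G N) y u w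
      = (G y (N y) (N y) * G y (cov G N y u) (N y)) • w
        + G y w (cov G N y u) • (cov G N y (N y) - ((1 / 2 : ℝ) * G y (N y) (N y)) • N y)
        + G y w (J y (cov G N y u)) •
          (cov G N y (J y (N y)) - ((1 / 2 : ℝ) * G y (N y) (N y)) • J y (N y)) := by
  have dN := hN.differentiableAt_N hy
  have dJN := hN.differentiableAt_JN hy
  have dw : DifferentiableAt ℝ (fun _ : E ↦ w) y := differentiableAt_const w
  have dρ := hN.differentiableAt_inner hy dN dN
  have da := hN.differentiableAt_inner hy dw dN
  have db := hN.differentiableAt_inner hy dw dJN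
  have dY := ((dρ.fun_smul dw).fun_sub (da.fun_smul dN)).fun_sub (db.fun_smul dJN)
  have key := cov_congr (G := G) (y := y)
    (X := fun z ↦ cov G N z (G z (N z) (N z) • w - G z w (N z) • N z
      - G z w (J z (N z)) • J z (N z)))
    (Y := fun z ↦ ((1 / 2 : ℝ) * G z (N z) (N z)) • (G z (N z) (N z) • w - G z w (N z) • N z
      - G z w (J z (N z)) • J z (N z)))
    (by filter_upwards [hN.isOpen.mem_nhds hy] with z hz using hN.cov_projection hz w)
  replace key := congrArg (fun L : E →L[ℝ] E ↦ L u) key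
  rw [cov_clm_apply (hN.differentiableAt_cov hy) dY, cov_smul (dρ.const_mul _) dY,
    cov_sub ((dρ.fun_smul dw).fun_sub (da.fun_smul dN)) (db.fun_smul dJN),
    cov_sub (dρ.fun_smul dw) (da.fun_smul dN), cov_smul dρ dw, cov_smul da dN, cov_smul db dJN,
    fderiv_const_mul dρ, smul_apply,
    hN.fderiv_inner hy dN dN, hN.fderiv_inner hy dw dN, hN.fderiv_inner hy dw dJN,
    hN.cov_J hy dN, cov_const, h1, h2, hN.symm y (N y) (cov G N y u)] at key
  -- The constant field `w` has covariant derivative `Γ(u, w)`; its contribution is again of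
  -- projected form and is removed by the same eigenvector equation.
  have hq := hN.cov_projection hy (christoffel G y u w)
  have hw := hN.cov_perp y hy w h1 h2
  simp only [zero_smul, sub_zero, covEnd_smul, map_sub, map_add, map_smul, add_zero, hw,
    smul_eq_mul] at key hq
  linear_combination (norm := module) key - hq

/-- By symmetry of `∇N` and the eigenvector equation for `w`. For `V = N` and `V = J N` it shows
that `∇N` preserves `span {N, J N}`. -/
lemma inner_cov_perp_radial {w V : E} (h1 : G y w (N y) = 0) (h2 : G y w (J y (N y)) = 0)
    (hV : G y w V = 0) : G y w (cov G N y V) = 0 := by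
  rw [← hN.cov_symm y hy, hN.cov_perp y hy w h1 h2, map_smul, smul_apply, hV, smul_zero]

lemma perp_J {w : E} (h1 : G y w (N y) = 0) (h2 : G y w (J y (N y)) = 0) :
    G y (J y w) (N y) = 0 ∧ G y (J y w) (J y (N y)) = 0 :=
  ⟨by rw [hN.inner_J_left hy, h2, neg_zero], by rw [hN.orthogonal y hy, h1]⟩

/-- For `V ⊥ w, J w` both correction terms of `covEnd_cov_perp` vanish; only the derivative `g(∇_V
N, N)` of the eigenvalue `½ |N|²` is left. -/
lemma covEnd_cov_radial_perp {w V : E} (h1 : G y w (N y) = 0) (h2 : G y w (J y (N y)) = 0)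
    (hV : G y w V = 0) (hV' : G y (J y w) V = 0) :
    covEnd G (cov G N) y V w = G y (cov G N y V) (N y) • w := by
  have hρ := (hN.inner_N_pos hy).ne'
  have h := hN.covEnd_cov_perp hy h1 h2 V
  have h3 := hN.perp_J hy h1 h2
  have h4 : G y w (J y (cov G N y V)) = 0 := by
    have := hN.inner_cov_perp_radial hy h3.1 h3.2 hV'
    rw [hN.inner_J_left hy] at this
    linarith
  rw [hN.inner_cov_perp_radial hy h1 h2 hV, h4, zero_smul, zero_smul, add_zero, add_zero,
    mul_smul] at h
  exact smul_right_injective E hρ h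

lemma covEnd_cov_perp_self {w : E} (h1 : G y w (N y) = 0) (h2 : G y w (J y (N y)) = 0) :
    covEnd G (cov G N) y w w = ((1 / 2 : ℝ) * G y w w) •
      (cov G N y (N y) - ((1 / 2 : ℝ) * G y (N y) (N y)) • N y) := by
  have hρ := (hN.inner_N_pos hy).ne'
  have h := hN.covEnd_cov_perp hy h1 h2 w
  have h3 : G y w (J y w) = 0 := by rw [hN.symm, hN.inner_J_self hy]
  rw [hN.cov_perp y hy w h1 h2] at h
  simp only [map_smul, smul_apply, h1, h3, smul_eq_mul, mul_zero, zero_smul, zero_add,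
    add_zero] at h
  refine smul_right_injective E hρ ?_
  simp only
  rw [h, smul_smul]
  congr 1
  ring

lemma covEnd_cov_perp_J {w : E} (h1 : G y w (N y) = 0) (h2 : G y w (J y (N y)) = 0) :
    covEnd G (cov G N) y w (J y w) = ((1 / 2 : ℝ) * G y w w) •
      (cov G N y (J y (N y)) - ((1 / 2 : ℝ) * G y (N y) (N y)) • J y (N y)) := by
  have hρ := (hN.inner_N_pos hy).ne'
  have h5 := hN.perp_J hy h1 h2
  have h := hN.covEnd_cov_perp hy h5.1 h5.2 w
  have h3 : G y (J y w) w = 0 := hN.inner_J_self hy w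
  rw [hN.cov_perp y hy w h1 h2] at h
  simp only [map_smul, smul_apply, h1, h3, hN.orthogonal y hy, smul_eq_mul, mul_zero, zero_smul,
    zero_add] at h
  refine smul_right_injective E hρ ?_
  simp only
  rw [h, smul_smul]
  congr 1
  ring

lemma inner_covEnd_cov (u v w : E) :
    G y (covEnd G (cov G N) y u v) w = G y v (covEnd G (cov G N) y u w) := by
  have h := hN.inner_covEnd hy 1 (hN.differentiableAt_cov hy)
    (fun z hz v w ↦ by rw [one_mul, hN.cov_symm z hz]) u v w
  rwa [one_mul] at h

/-- The Ricci identity expresses `R(w, V) N` by the derivative of `∇N`; its symmetry lets every term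
be evaluated on `w`, where `∇N` is known. The next lemma tests the same vector against `J w`. -/
lemma inner_curv_perp_self {w V : E} (h1 : G y w (N y) = 0) (h2 : G y w (J y (N y)) = 0)
    (hV : G y w V = 0) (hV' : G y (J y w) V = 0) :
    G y (curv G y w V (N y)) w
      = G y w w * ((1 / 2 : ℝ) * G y V (cov G N y (N y))
        - (1 / 4 : ℝ) * (G y (N y) (N y) * G y V (N y)) - G y (cov G N y V) (N y)) := by
  rw [← hN.covEnd_cov_sub hy (hN.smooth_N y hy), map_sub, sub_apply,
    hN.inner_covEnd_cov hy w V w, hN.covEnd_cov_perp_self hy h1 h2,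
    hN.covEnd_cov_radial_perp hy h1 h2 hV hV']
  simp only [map_smul, map_sub, smul_apply, smul_eq_mul]
  ring

lemma inner_curv_perp_J {w V : E} (h1 : G y w (N y) = 0) (h2 : G y w (J y (N y)) = 0)
    (hV : G y w V = 0) (hV' : G y (J y w) V = 0) :
    G y (curv G y w V (N y)) (J y w)
      = G y w w * ((1 / 2 : ℝ) * G y V (cov G N y (J y (N y)))
        - (1 / 4 : ℝ) * (G y (N y) (N y) * G y V (J y (N y)))) := by
  have h3 : G y w (J y w) = 0 := by rw [hN.symm, hN.inner_J_self hy]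
  rw [← hN.covEnd_cov_sub hy (hN.smooth_N y hy), map_sub, sub_apply,
    hN.inner_covEnd_cov hy w V (J y w), hN.covEnd_cov_perp_J hy h1 h2,
    hN.covEnd_cov_radial_perp hy h1 h2 hV hV']
  simp only [map_smul, map_sub, smul_apply, smul_eq_mul, h3]
  ring

/-- Comparison of the curvatures `R(w, V) N` and `R(J w, J V) N`, for `w ⊥ span {N, J N}`. -/
lemma cov_radial_eq {w V : E} (hw : w ≠ 0) (h1 : G y w (N y) = 0) (h2 : G y w (J y (N y)) = 0)
    (hV : G y w V = 0) (hV' : G y (J y w) V = 0) :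
    (1 / 2 : ℝ) * G y V (cov G N y (N y))
        - (1 / 4 : ℝ) * (G y (N y) (N y) * G y V (N y)) - G y (cov G N y V) (N y)
      = -((1 / 2 : ℝ) * G y (J y V) (cov G N y (J y (N y)))
        - (1 / 4 : ℝ) * (G y (N y) (N y) * G y V (N y))) := by
  have h3 := hN.perp_J hy h1 h2
  have hJV : G y (J y w) (J y V) = 0 := by rw [hN.orthogonal y hy, hV]
  have hJV' : G y (J y (J y w)) (J y V) = 0 := by rw [hN.orthogonal y hy, hV']
  have a := hN.inner_curv_perp_self hy h1 h2 hV hV'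
  -- For the pair `(J w, J V)` the test vector is `J (J w) = -w`, so by `curv_J_J` this is minus the
  -- quantity in `a`.
  have b := hN.inner_curv_perp_J hy h3.1 h3.2 hJV hJV'
  rw [hN.curv_J_J hy, hN.sq y hy, map_neg, a, hN.orthogonal y hy w w,
    hN.orthogonal y hy V] at b
  have hpos := (hN.pos y hy w hw).ne'
  apply mul_left_cancel₀ hpos
  linarith

/-- With `V = J N`, the comparison `cov_radial_eq` says that half this number equals minus half of
it. -/
lemma inner_cov_JN_N : G y (cov G N y (J y (N y))) (N y) = 0 := by
  obtain ⟨w, hw, h1, h2⟩ := hN.exists_perp y hy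
  have h3 := hN.perp_J hy h1 h2
  have h := hN.cov_radial_eq hy hw h1 h2 h2 h3.2
  rw [hN.inner_JN_N hy, hN.sq y hy, map_neg, neg_apply,
    hN.symm y (N y) (cov G N y (J y (N y)))] at h
  have h4 := hN.cov_symm y hy (J y (N y)) (N y)
  linarith

/-- The case `V = N` of `cov_radial_eq`. After division by `|N|²` it says that the eigenvalues on
`N` and `J N` differ by `|N|²`. -/
lemma inner_cov_JN_JN : G y (cov G N y (J y (N y))) (J y (N y))
    = G y (cov G N y (N y)) (N y) + G y (N y) (N y) ^ 2 := by
  obtain ⟨w, hw, h1, h2⟩ := hN.exists_perp y hy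
  have h3 := hN.perp_J hy h1 h2
  have h := hN.cov_radial_eq hy hw h1 h2 h1 h3.1
  rw [← hN.cov_symm y hy, ← hN.cov_symm y hy] at h
  linarith

/-- The difference `q` of the two sides is orthogonal to `N` and `J N`, hence to `V` by hypothesis,
hence to itself. -/
lemma radial_eq {V : E}
    (hV : ∀ w, G y w (N y) = 0 → G y w (J y (N y)) = 0 → G y w V = 0) :
    G y (N y) (N y) • V = G y V (N y) • N y + G y V (J y (N y)) • J y (N y) := by
  have h1 := hN.inner_JN_N hy
  have h2 := hN.inner_JN_JN hy
  have h3 : G y (N y) (J y (N y)) = 0 := by rw [hN.symm, h1]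
  set q := G y (N y) (N y) • V - G y V (N y) • N y - G y V (J y (N y)) • J y (N y) with hq
  have q1 : G y q (N y) = 0 := by
    simp only [hq, map_sub, map_smul, sub_apply, smul_apply, smul_eq_mul, h1]
    ring
  have q2 : G y q (J y (N y)) = 0 := by
    simp only [hq, map_sub, map_smul, sub_apply, smul_apply, smul_eq_mul, h2, h3]
    ring
  have q3 := hV q q1 q2
  have q4 : G y q q = 0 := by
    conv_lhs => rw [hq]
    rw [← hN.symm y q]
    simp only [map_sub, map_smul, q1, q2, q3, smul_eq_mul, mul_zero, sub_zero]
  have q5 : q = 0 := by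
    by_contra h
    exact (hN.pos y hy q h).ne' q4
  rw [hq, sub_sub, sub_eq_zero] at q5
  exact q5

lemma smul_cov_N :
    G y (N y) (N y) • cov G N y (N y) = G y (cov G N y (N y)) (N y) • N y := by
  rw [hN.radial_eq hy (V := cov G N y (N y))
    (fun w h1 h2 ↦ hN.inner_cov_perp_radial hy h1 h2 h1), hN.cov_symm y hy (N y) (J y (N y)),
    hN.symm y (N y), hN.inner_cov_JN_N hy, zero_smul, add_zero]

lemma smul_cov_JN :
    G y (N y) (N y) • cov G N y (J y (N y))
      = (G y (cov G N y (N y)) (N y) + G y (N y) (N y) ^ 2) • J y (N y) := by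
  rw [hN.radial_eq hy (V := cov G N y (J y (N y)))
    (fun w h1 h2 ↦ hN.inner_cov_perp_radial hy h1 h2 h2), hN.inner_cov_JN_N hy,
    hN.inner_cov_JN_JN hy, zero_smul, zero_add]

/-- The term `g(N, ·) N` raises the eigenvalue on `N` to that on `J N`. Thus `∇N + g(N, ·) N`
combines the identity with a multiple of the projection to the complex line of `N`; composed with
`J` it is skew. -/
lemma inner_killingEnd_self (v : E) : G y (killingEnd G J N y v) v = 0 := by
  have hρ := (hN.inner_N_pos hy).ne'
  have h1 := hN.smul_cov_N hy
  have h2 := hN.smul_cov_JN hy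
  have h3 := hN.cov_projection hy v
  set ρ := G y (N y) (N y)
  set a := G y (cov G N y (N y)) (N y)
  -- The common eigenvalue on `span {N, J N}` is `a / ρ + ρ`, the one on the complement is `ρ / 2`;
  -- everything is multiplied by `ρ²` to clear denominators.
  have key : ρ ^ 2 • (cov G N y v + G y (N y) v • N y) = ((1 / 2 : ℝ) * ρ ^ 3) • v
      + ((a + (1 / 2 : ℝ) * ρ ^ 2) * G y v (N y)) • N y
      + ((a + (1 / 2 : ℝ) * ρ ^ 2) * G y v (J y (N y))) • J y (N y) := by
    rw [hN.symm y (N y) v]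
    simp only [map_sub, map_smul] at h3
    linear_combination (norm := module) ρ • h3 + G y v (N y) • h1 + G y v (J y (N y)) • h2
  have key2 := congrArg (fun z ↦ G y (J y z) v) key
  simp only [map_smul, map_add, add_apply, smul_apply, hN.sq y hy, map_neg, neg_apply,
    hN.inner_J_self hy, smul_eq_mul] at key2
  rw [killingEnd_apply]
  rw [hN.symm y (J y (N y)), hN.symm y (N y)] at key2
  apply mul_left_cancel₀ (pow_ne_zero 2 hρ)
  simp only [map_smul, map_add, add_apply, smul_apply, smul_eq_mul]
  rw [hN.symm y (J y (N y)), hN.symm y (N y)]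
  linarith

lemma inner_killingEnd (v w : E) :
    G y (killingEnd G J N y v) w = -G y v (killingEnd G J N y w) := by
  have h := hN.inner_killingEnd_self hy (v + w)
  simp only [map_add, add_apply, hN.inner_killingEnd_self hy] at h
  rw [hN.symm y v]
  linarith

lemma differentiableAt_killingEnd : DifferentiableAt ℝ (killingEnd G J N) y := by
  have h1 : DifferentiableAt ℝ (fun z ↦ G z (N z)) y :=
    (hN.differentiableAt hy).clm_apply (hN.differentiableAt_N hy)
  have h2 : DifferentiableAt ℝ (fun z ↦ (G z (N z)).smulRight (N z)) y :=
    ((ContinuousLinearMap.smulRightL ℝ E E).differentiableAt.comp y h1).clm_apply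
      (hN.differentiableAt_N hy)
  exact (hN.differentiableAt_J hy).clm_comp ((hN.differentiableAt_cov hy).add h2)

lemma covEnd_killingEnd (u v : E) :
    covEnd G (killingEnd G J N) y u v
      = J y (covEnd G (cov G N) y u v + G y (cov G N y u) v • N y
        + G y (N y) v • cov G N y u) := by
  have dN := hN.differentiableAt_N hy
  have dv : DifferentiableAt ℝ (fun _ : E ↦ v) y := differentiableAt_const v
  have dP := (hN.differentiableAt_cov hy).clm_apply dv
  have da := hN.differentiableAt_inner hy dN dv
  rw [covEnd_eq (hN.differentiableAt_killingEnd hy)]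
  simp only [killingEnd_apply]
  rw [hN.cov_J hy (dP.fun_add (da.fun_smul dN)), cov_add dP (da.fun_smul dN), cov_smul da dN,
    cov_clm_apply (hN.differentiableAt_cov hy) dv, hN.fderiv_inner hy dN dv, cov_const, ← map_sub]
  congr 1
  module

/-- The Killing identity: `e^A J N` is a Killing field if `dA = g(N, ·)`. -/
lemma covEnd_killingEnd_self (u : E) :
    covEnd G (killingEnd G J N) y u u + G y (N y) u • killingEnd G J N y u
      = curv G y u (J y (N y)) u := by
  -- Up to the factor `e^A`, the expression `∇_u K v + g(N, u) K v` is the second covariant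
  -- derivative of `e^A J N`. Antisymmetrized in `u`, `v` it is the curvature, as `g(N, ·)` is
  -- closed.
  have ricci (u v : E) :
      covEnd G (killingEnd G J N) y u v + G y (N y) u • killingEnd G J N y v
        - (covEnd G (killingEnd G J N) y v u + G y (N y) v • killingEnd G J N y u)
      = curv G y u v (J y (N y)) := by
    rw [hN.covEnd_killingEnd hy, hN.covEnd_killingEnd hy, killingEnd_apply, killingEnd_apply,
      hN.curv_J hy, ← hN.covEnd_cov_sub hy (hN.smooth_N y hy), hN.cov_symm y hy u v,
      hN.symm y u]
    simp only [map_add, map_sub, map_smul]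
    module
  have skew (u v w : E) :
      G y (covEnd G (killingEnd G J N) y u v + G y (N y) u • killingEnd G J N y v) w
      = -G y (covEnd G (killingEnd G J N) y u w + G y (N y) u • killingEnd G J N y w) v := by
    have h := hN.inner_covEnd hy (-1) (hN.differentiableAt_killingEnd hy)
      (fun z hz v w ↦ by rw [neg_one_mul, hN.inner_killingEnd hz]) u v w
    rw [map_add, add_apply, h, map_smul, smul_apply, hN.inner_killingEnd hy v w, map_add,
      add_apply, map_smul, smul_apply, hN.symm y v, hN.symm y v]
    simp only [smul_eq_mul]
    ring
  refine hN.ext_inner hy fun w ↦ ?_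
  -- With `P(u, v)` for this second derivative: `⟨P(u, u), w⟩ = -⟨P(u, w), u⟩`, the Ricci identity
  -- exchanges `u` and `w`, `⟨P(w, u), u⟩ = 0`, and pair symmetry rewrites the curvature that
  -- remains.
  have h1 := skew u u w
  have h2 := congrArg (fun z ↦ G y z u) (ricci u w)
  have h3 := skew w u u
  have h4 := hN.inner_curv_pair_symm hy u w (J y (N y)) u
  rw [curv_antisymm y (J y (N y)), map_neg, neg_apply] at h4
  simp only [map_sub, sub_apply] at h2
  linarith

end IsHomotheticGradientOn

end KaehlerCoordinates

/-! ### The Levi-Civita connection in a chart -/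

section ChartConnection

variable [FiniteDimensional ℝ E] [IsManifold 𝓘(ℝ, E) ∞ M]
  [RiemannianBundle (fun x : M ↦ TangentSpace 𝓘(ℝ, E) x)]
  [IsContMDiffRiemannianBundle 𝓘(ℝ, E) ∞ E (fun x : M ↦ TangentSpace 𝓘(ℝ, E) x)]

/-- The metric read in the preferred chart at `x₀`. -/
def chartMetric (x₀ : M) (y : E) : E →L[ℝ] E →L[ℝ] ℝ :=
  letI x := (extChartAt 𝓘(ℝ, E) x₀).symm y
  (innerSL ℝ : TangentSpace 𝓘(ℝ, E) x →L[ℝ] TangentSpace 𝓘(ℝ, E) x →L[ℝ] ℝ).bilinearComp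
    (ofChart x₀ x) (ofChart x₀ x)

/-- A field of endomorphisms read in the preferred chart at `x₀`. -/
def chartEnd (x₀ : M) (A : EndField E M) (y : E) : E →L[ℝ] E :=
  letI x := (extChartAt 𝓘(ℝ, E) x₀).symm y
  ((toChart x₀ x).comp (A x)).comp (ofChart x₀ x)

variable {x₀ x : M}

lemma chartMetric_apply (y u v : E) :
    chartMetric x₀ y u v = inner ℝ (ofChart x₀ ((extChartAt 𝓘(ℝ, E) x₀).symm y) u)
      (ofChart x₀ ((extChartAt 𝓘(ℝ, E) x₀).symm y) v) := rfl

lemma chartMetric_eq (hx : x ∈ (extChartAt 𝓘(ℝ, E) x₀).source) (v w : E) :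
    chartMetric x₀ (extChartAt 𝓘(ℝ, E) x₀ x) v w
      = inner ℝ (ofChart x₀ x v) (ofChart x₀ x w) := by
  rw [chartMetric_apply, (extChartAt 𝓘(ℝ, E) x₀).left_inv hx]

lemma chartMetric_toChart (hx : x ∈ (extChartAt 𝓘(ℝ, E) x₀).source)
    (v w : TangentSpace 𝓘(ℝ, E) x) :
    chartMetric x₀ (extChartAt 𝓘(ℝ, E) x₀ x) (toChart x₀ x v) (toChart x₀ x w) = inner ℝ v w := by
  rw [chartMetric_eq hx, ofChart_toChart hx, ofChart_toChart hx]

lemma chartEnd_toChart (hx : x ∈ (extChartAt 𝓘(ℝ, E) x₀).source) (A : EndField E M)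
    (v : TangentSpace 𝓘(ℝ, E) x) :
    chartEnd x₀ A (extChartAt 𝓘(ℝ, E) x₀ x) (toChart x₀ x v) = toChart x₀ x (A x v) := by
  have h : (extChartAt 𝓘(ℝ, E) x₀).symm (extChartAt 𝓘(ℝ, E) x₀ x) = x :=
    (extChartAt 𝓘(ℝ, E) x₀).left_inv hx
  simp only [chartEnd, ContinuousLinearMap.coe_comp, Function.comp_apply]
  rw [h, ofChart_toChart hx]

lemma hat_applyJ {y : E} (hy : y ∈ (extChartAt 𝓘(ℝ, E) x₀).target) (J : EndField E M)
    (X : VecField E M) : hat x₀ (applyJ J X) y = chartEnd x₀ J y (hat x₀ X y) := by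
  have h := chartEnd_toChart ((extChartAt 𝓘(ℝ, E) x₀).map_target hy) J
    (X ((extChartAt 𝓘(ℝ, E) x₀).symm y))
  rw [(extChartAt 𝓘(ℝ, E) x₀).right_inv hy] at h
  exact h.symm

lemma isMetricOn_chartMetric (x₀ : M) :
    IsMetricOn (chartMetric x₀) (extChartAt 𝓘(ℝ, E) x₀).target where
  isOpen := isOpen_extChartAt_target x₀
  symm y u v := by rw [chartMetric_apply, chartMetric_apply, real_inner_comm]
  pos y hy v hv := by
    rw [chartMetric_apply, real_inner_self_eq_norm_sq]
    have : ofChart x₀ ((extChartAt 𝓘(ℝ, E) x₀).symm y) v ≠ 0 := by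
      intro h
      apply hv
      rw [← toChart_ofChart ((extChartAt 𝓘(ℝ, E) x₀).map_target hy) v, h, map_zero]
    positivity
  smooth y hy := by
    suffices h : ContDiffOn ℝ ∞ (chartMetric x₀) (extChartAt 𝓘(ℝ, E) x₀).target from
      h.contDiffAt ((isOpen_extChartAt_target x₀).mem_nhds hy)
    refine contDiffOn_clm_apply.2 fun u ↦ contDiffOn_clm_apply.2 fun v z hz ↦ ?_
    have hx := (extChartAt 𝓘(ℝ, E) x₀).map_target hz
    have hU (w : E) : ContMDiffAt 𝓘(ℝ, E) 𝓘(ℝ, E).tangent ∞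
        (fun x ↦ (⟨x, chartField x₀ (fun _ ↦ w) x⟩ : TangentBundle 𝓘(ℝ, E) M))
        ((extChartAt 𝓘(ℝ, E) x₀).symm z) :=
      contMDiffAt_chartField (n := ⊤) hx contDiffAt_const
    have h := ContMDiffAt.inner_bundle (IB := 𝓘(ℝ, E)) (IM := 𝓘(ℝ, E)) (F := E)
      (E := fun x : M ↦ TangentSpace 𝓘(ℝ, E) x) (b := fun x ↦ x) (hU u) (hU v)
    have h' := (contMDiffAt_iff_chart (n := ⊤) hx).1 h
    rw [(extChartAt 𝓘(ℝ, E) x₀).right_inv hz] at h'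
    exact h'.contDiffWithinAt

section LeviCivita

variable {nab : Connection E M}

lemma IsLeviCivita.mlieBracket_eq (hnab : IsLeviCivita nab) {X Y : VecField E M}
    (hX : MDifferentiableAt 𝓘(ℝ, E) 𝓘(ℝ, E).tangent
      (fun x ↦ (⟨x, X x⟩ : TangentBundle 𝓘(ℝ, E) M)) x)
    (hY : MDifferentiableAt 𝓘(ℝ, E) 𝓘(ℝ, E).tangent
      (fun x ↦ (⟨x, Y x⟩ : TangentBundle 𝓘(ℝ, E) M)) x) :
    VectorField.mlieBracket 𝓘(ℝ, E) X Y x = nab Y x (X x) - nab X x (Y x) :=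
  ((CovariantDerivative.torsion_eq_zero_iff nab).1 hnab.1 hX hY).symm

lemma IsLeviCivita.mvfderiv_inner (hnab : IsLeviCivita nab) {X Y : VecField E M}
    (hX : MDifferentiableAt 𝓘(ℝ, E) 𝓘(ℝ, E).tangent
      (fun x ↦ (⟨x, X x⟩ : TangentBundle 𝓘(ℝ, E) M)) x)
    (hY : MDifferentiableAt 𝓘(ℝ, E) 𝓘(ℝ, E).tangent
      (fun x ↦ (⟨x, Y x⟩ : TangentBundle 𝓘(ℝ, E) M)) x) (v : TangentSpace 𝓘(ℝ, E) x) :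
    mvfderiv 𝓘(ℝ, E) (fun y ↦ (inner ℝ (X y) (Y y) : ℝ)) x v
      = inner ℝ (nab X x v) (Y x) + inner ℝ (X x) (nab Y x v) := by
  have h := CovariantDerivative.IsMetricCompatible.mvfderiv_inner_eq hnab.2
    (FiberBundle.extend E v) hX hY
  simpa using h

/-- The difference of two connections, here `nab` and the flat one of the chart, is tensorial. -/
lemma toChart_nab_sub (hx : x ∈ (extChartAt 𝓘(ℝ, E) x₀).source) {X Y : VecField E M}
    (hX : MDifferentiableAt 𝓘(ℝ, E) 𝓘(ℝ, E).tangent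
      (fun x ↦ (⟨x, X x⟩ : TangentBundle 𝓘(ℝ, E) M)) x)
    (hY : MDifferentiableAt 𝓘(ℝ, E) 𝓘(ℝ, E).tangent
      (fun x ↦ (⟨x, Y x⟩ : TangentBundle 𝓘(ℝ, E) M)) x) (hXY : X x = Y x)
    (v : TangentSpace 𝓘(ℝ, E) x) :
    toChart x₀ x (nab X x v)
        - fderiv ℝ (hat x₀ X) (extChartAt 𝓘(ℝ, E) x₀ x) (toChart x₀ x v)
      = toChart x₀ x (nab Y x v)
        - fderiv ℝ (hat x₀ Y) (extChartAt 𝓘(ℝ, E) x₀ x) (toChart x₀ x v) := by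
  have h : TensorialAt 𝓘(ℝ, E) E (fun X : VecField E M ↦ toChart x₀ x (nab X x v)
      - fderiv ℝ (hat x₀ X) (extChartAt 𝓘(ℝ, E) x₀ x) (toChart x₀ x v)) x := by
    constructor
    · intro f σ hf hσ
      have h1 := nab.isCovariantDerivativeOnUniv.leibniz hσ hf
      have h2 : hat x₀ (f • σ) = fun y ↦ (f ∘ (extChartAt 𝓘(ℝ, E) x₀).symm) y • hat x₀ σ y := by
        ext1 y
        exact map_smul _ _ _
      have h3 := (mdifferentiableAt_iff_chart hx).1 hf
      rw [h1, h2, fderiv_fun_smul h3 ((mdifferentiableAt_field_iff hx).1 hσ)]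
      simp only [add_apply, smul_apply, ContinuousLinearMap.smulRight_apply, map_add, map_smul,
        mvfderiv_eq_chart hx h3, hat_apply hx, smul_sub, Function.comp_apply,
        (extChartAt 𝓘(ℝ, E) x₀).left_inv hx]
      abel
    · intro σ σ' hσ hσ'
      have h1 := nab.isCovariantDerivativeOnUniv.add hσ hσ'
      have h2 : hat x₀ (σ + σ') = fun y ↦ hat x₀ σ y + hat x₀ σ' y := by
        ext1 y
        exact map_add _ _ _
      rw [h1, h2, fderiv_fun_add ((mdifferentiableAt_field_iff hx).1 hσ)
        ((mdifferentiableAt_field_iff hx).1 hσ')]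
      simp only [add_apply, map_add]
      abel
  exact h.pointwise hX hY hXY

/-- Koszul's formula: `hmet` is metric compatibility, and `htor` is vanishing torsion for commuting
coordinate fields. These determine the connection on such fields. -/
lemma IsLeviCivita.toChart_nab_const (hnab : IsLeviCivita nab)
    (hx : x ∈ (extChartAt 𝓘(ℝ, E) x₀).source) (v w : E) :
    toChart x₀ x (nab (chartField x₀ fun _ ↦ w) x (ofChart x₀ x v))
      = christoffel (chartMetric x₀) (extChartAt 𝓘(ℝ, E) x₀ x) v w := by
  have hG := isMetricOn_chartMetric (E := E) x₀
  have hy := (extChartAt 𝓘(ℝ, E) x₀).map_source hx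
  have dC (w : E) := mdifferentiableAt_chartField (M := M) hx
    (differentiableAt_const w)
  set y := extChartAt 𝓘(ℝ, E) x₀ x with hydef
  have hval (w : E) : (chartField x₀ (fun _ ↦ w) : VecField E M) x = ofChart x₀ x w := rfl
  let F (u v w : E) : ℝ :=
    inner ℝ (nab (chartField x₀ fun _ ↦ v) x (ofChart x₀ x u)) (ofChart x₀ x w)
  have hmet (u v w : E) : fderiv ℝ (chartMetric x₀) y u v w = F u v w + F u w v := by
    have h := hnab.mvfderiv_inner (dC v) (dC w) (ofChart x₀ x u)
    have hd := hG.differentiableAt_inner hy (differentiableAt_const v) (differentiableAt_const w)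
    have h2 := mvfderiv_eq_chart hx (f := fun z ↦ (inner ℝ
      ((chartField x₀ (fun _ ↦ v) : VecField E M) z)
      ((chartField x₀ (fun _ ↦ w) : VecField E M) z) : ℝ)) hd (ofChart x₀ x u)
    rw [h2, toChart_ofChart hx] at h
    have h3 := hG.fderiv_apply_apply hy u v w
    rw [← h3]
    refine h.trans ?_
    rw [real_inner_comm _ (chartField x₀ (fun _ ↦ v) x)]
    rfl
  have htor (u v w : E) : F u v w = F v u w := by
    have h := hnab.mlieBracket_eq (dC u) (dC v)
    rw [mlieBracket_chartField_const hx, eq_comm, sub_eq_zero, hval, hval] at h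
    simp only [F, h]
  refine hG.ext_inner hy fun z ↦ ?_
  rw [hG.inner_christoffel hy, koszul_apply, hmet, hmet, hmet, chartMetric_eq hx,
    ofChart_toChart hx]
  change F v w z = _
  rw [htor w v, htor z v, htor z w]
  ring

lemma IsLeviCivita.toChart_nab (hnab : IsLeviCivita nab)
    (hx : x ∈ (extChartAt 𝓘(ℝ, E) x₀).source) {X : VecField E M}
    (hX : MDifferentiableAt 𝓘(ℝ, E) 𝓘(ℝ, E).tangent
      (fun x ↦ (⟨x, X x⟩ : TangentBundle 𝓘(ℝ, E) M)) x) (v : TangentSpace 𝓘(ℝ, E) x) :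
    toChart x₀ x (nab X x v)
      = cov (chartMetric x₀) (hat x₀ X) (extChartAt 𝓘(ℝ, E) x₀ x) (toChart x₀ x v) := by
  have hc := mdifferentiableAt_chartField (M := M) hx (differentiableAt_const (toChart x₀ x (X x)))
  have h := toChart_nab_sub (nab := nab) hx hX hc (ofChart_toChart hx (X x)).symm v
  have h2 := hnab.toChart_nab_const hx (toChart x₀ x v) (toChart x₀ x (X x))
  rw [ofChart_toChart hx] at h2
  rw [(hat_chartField_eventuallyEq hx _).fderiv_eq, fderiv_const_apply, zero_apply, sub_zero,
    h2] at h
  rw [cov_apply, hat_apply hx, ← h]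
  abel

lemma IsLeviCivita.hat_nab (hnab : IsLeviCivita nab) {y : E}
    (hy : y ∈ (extChartAt 𝓘(ℝ, E) x₀).target) {X V : VecField E M}
    (hX : DifferentiableAt ℝ (hat x₀ X) y) :
    hat x₀ (fun x ↦ nab X x (V x)) y = cov (chartMetric x₀) (hat x₀ X) y (hat x₀ V y) := by
  have hx := (extChartAt 𝓘(ℝ, E) x₀).map_target hy
  have hr := (extChartAt 𝓘(ℝ, E) x₀).right_inv hy
  have h := hnab.toChart_nab hx (X := X) ((mdifferentiableAt_field_iff hx).2 (by rwa [hr]))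
    (V ((extChartAt 𝓘(ℝ, E) x₀).symm y))
  rw [hr] at h
  exact h

end LeviCivita

end ChartConnection

/-! ### Kähler structure and curvature in a chart -/

section ChartCurvature

variable [FiniteDimensional ℝ E] [IsManifold 𝓘(ℝ, E) ∞ M]
  [RiemannianBundle (fun x : M ↦ TangentSpace 𝓘(ℝ, E) x)]
  [IsContMDiffRiemannianBundle 𝓘(ℝ, E) ∞ E (fun x : M ↦ TangentSpace 𝓘(ℝ, E) x)]

variable {x₀ x : M} {nab : Connection E M} {J : EndField E M}

lemma IsKaehler.smoothOn_applyJ (hJ : IsKaehler nab J) {X : VecField E M} {W : Set M}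
    (hX : SmoothOn X W) : SmoothOn (applyJ J X) W :=
  ContMDiffOn.clm_bundle_apply (F₁ := E) (F₂ := E)
    (E₁ := (TangentSpace 𝓘(ℝ, E) : M → Type _)) (E₂ := (TangentSpace 𝓘(ℝ, E) : M → Type _))
    (b := fun x : M ↦ x) (hJ.smooth.contMDiffOn) hX

lemma SmoothOn.contDiffAt_hat {X : VecField E M} {W : Set M} (hX : SmoothOn X W)
    (hx : x ∈ (extChartAt 𝓘(ℝ, E) x₀).source) (hW : W ∈ 𝓝 x) :
    ContDiffAt ℝ ∞ (hat x₀ X) (extChartAt 𝓘(ℝ, E) x₀ x) :=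
  (contMDiffAt_field_iff (n := ⊤) hx).1 (hX.contMDiffAt hW)

lemma SmoothOn.mdifferentiableAt {X : VecField E M} {W : Set M} (hX : SmoothOn X W)
    (hW : W ∈ 𝓝 x) : MDifferentiableAt 𝓘(ℝ, E) 𝓘(ℝ, E).tangent
      (fun x ↦ (⟨x, X x⟩ : TangentBundle 𝓘(ℝ, E) M)) x :=
  (hX.contMDiffAt hW).mdifferentiableAt (by simp)

lemma isKaehlerOn_chart (hnab : IsLeviCivita nab) (hJ : IsKaehler nab J) (x₀ : M) :
    IsKaehlerOn (chartMetric x₀) (chartEnd x₀ J) (extChartAt 𝓘(ℝ, E) x₀).target := by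
  have hG := isMetricOn_chartMetric (E := E) x₀
  have hcf (w : E) : ∀ y ∈ (extChartAt 𝓘(ℝ, E) x₀).target,
      chartEnd x₀ J y w = hat x₀ (applyJ J (chartField x₀ fun _ ↦ w)) y := by
    intro y hy
    rw [hat_applyJ hy, hat_chartField hy]
  have hev (w : E) : ∀ y ∈ (extChartAt 𝓘(ℝ, E) x₀).target, (fun z ↦ chartEnd x₀ J z w)
      =ᶠ[𝓝 y] hat x₀ (applyJ J (chartField x₀ fun _ ↦ w)) := by
    intro y hy
    filter_upwards [hG.isOpen.mem_nhds hy] with z hz using hcf w z hz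
  have hsm : ∀ y ∈ (extChartAt 𝓘(ℝ, E) x₀).target, ContDiffAt ℝ ∞ (chartEnd x₀ J) y := by
    intro y hy
    suffices h : ContDiffOn ℝ ∞ (chartEnd x₀ J) (extChartAt 𝓘(ℝ, E) x₀).target from
      h.contDiffAt (hG.isOpen.mem_nhds hy)
    refine contDiffOn_clm_apply.2 fun w z hz ↦ ContDiffAt.contDiffWithinAt ?_
    have hx := (extChartAt 𝓘(ℝ, E) x₀).map_target hz
    have h := (hJ.smoothOn_applyJ (smoothOn_chartField_const x₀ w)).contDiffAt_hat hx
      (source_mem_nhds hx)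
    rw [(extChartAt 𝓘(ℝ, E) x₀).right_inv hz] at h
    exact h.congr_of_eventuallyEq (hev w z hz)
  refine ⟨hG, hsm, fun y hy v ↦ ?_, fun y hy u v ↦ ?_, fun y hy u v ↦ ?_⟩
  all_goals
    have hx := (extChartAt 𝓘(ℝ, E) x₀).map_target hy
    have hr := (extChartAt 𝓘(ℝ, E) x₀).right_inv hy
    have hv := toChart_ofChart hx v
  · have h1 := chartEnd_toChart hx J (ofChart x₀ _ v)
    have h2 := chartEnd_toChart hx J (J _ (ofChart x₀ _ v))
    rw [hr, hv] at h1
    rw [hr, ← h1, hJ.sq, map_neg, hv] at h2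
    exact h2
  · have hu := toChart_ofChart hx u
    have h1 := chartEnd_toChart hx J (ofChart x₀ _ u)
    have h2 := chartEnd_toChart hx J (ofChart x₀ _ v)
    rw [hr, hu] at h1
    rw [hr, hv] at h2
    have h3 := chartMetric_toChart hx (J _ (ofChart x₀ _ u)) (J _ (ofChart x₀ _ v))
    rw [hJ.orthogonal, ← chartMetric_toChart hx, hr, hu, hv, ← h1, ← h2] at h3
    exact h3
  · have hu := toChart_ofChart hx u
    have hs := smoothOn_chartField_const (M := M) x₀ v
    have h1 := hJ.parallel _ _ (isOpen_extChartAt_source x₀) hs _ hx (ofChart x₀ _ u)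
    have h2 := hnab.toChart_nab hx
      ((hJ.smoothOn_applyJ hs).mdifferentiableAt (source_mem_nhds hx)) (ofChart x₀ _ u)
    have h3 := hnab.toChart_nab_const hx u v
    rw [h1, ← chartEnd_toChart hx, h3, hr, hu, ← cov_congr (hev v y hy)] at h2
    rw [covEnd_eq ((hsm y hy).differentiableAt (by simp)), ← h2, sub_self]

lemma IsLeviCivita.toChart_curvature (hnab : IsLeviCivita nab)
    (hx : x ∈ (extChartAt 𝓘(ℝ, E) x₀).source) (u v w : TangentSpace 𝓘(ℝ, E) x) :
    toChart x₀ x (curvature nab x u v w)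
      = curv (chartMetric x₀) (extChartAt 𝓘(ℝ, E) x₀ x) (toChart x₀ x u) (toChart x₀ x v)
          (toChart x₀ x w) := by
  have hG := isMetricOn_chartMetric (E := E) x₀
  have hy := (extChartAt 𝓘(ℝ, E) x₀).map_source hx
  have hext (u : TangentSpace 𝓘(ℝ, E) x) :
      ContDiffAt ℝ ∞ (hat x₀ (FiberBundle.extend E u)) (extChartAt 𝓘(ℝ, E) x₀ x) :=
    (contMDiffAt_field_iff (n := ⊤) hx).1 (FiberBundle.contMDiffAt_extend 𝓘(ℝ, E) E u)
  have hmd (u : TangentSpace 𝓘(ℝ, E) x) : MDifferentiableAt 𝓘(ℝ, E) 𝓘(ℝ, E).tangent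
      (fun x' ↦ (⟨x', FiberBundle.extend E u x'⟩ : TangentBundle 𝓘(ℝ, E) M)) x :=
    FiberBundle.mdifferentiableAt_extend 𝓘(ℝ, E) E u
  have hval (u : TangentSpace 𝓘(ℝ, E) x) : hat x₀ (FiberBundle.extend E u)
      (extChartAt 𝓘(ℝ, E) x₀ x) = toChart x₀ x u := by
    rw [hat_apply hx, FiberBundle.extend_apply_self]
  have hev (w v : TangentSpace 𝓘(ℝ, E) x) :
      hat x₀ (fun y ↦ nab (FiberBundle.extend E w) y (FiberBundle.extend E v y))
        =ᶠ[𝓝 (extChartAt 𝓘(ℝ, E) x₀ x)]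
      fun z ↦ cov (chartMetric x₀) (hat x₀ (FiberBundle.extend E w)) z
        (hat x₀ (FiberBundle.extend E v) z) := by
    filter_upwards [((hext w).of_le (m := 1) (by simp)).eventually (by simp), target_mem_nhds hx]
      with z hz hz' using hnab.hat_nab hz' (hz.differentiableAt (by simp))
  have hd (w : TangentSpace 𝓘(ℝ, E) x) := (hG.contDiffAt_cov hy (hext w)).differentiableAt
    (by simp)
  -- The term with the derivative of the extension of `v` is kept separate: antisymmetrized, it
  -- cancels against the bracket term.
  have hnn (u v w : TangentSpace 𝓘(ℝ, E) x) :
      toChart x₀ x (nab (fun y ↦ nab (FiberBundle.extend E w) y (FiberBundle.extend E v y)) x u)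
        = covEnd (chartMetric x₀) (cov (chartMetric x₀) (hat x₀ (FiberBundle.extend E w)))
            (extChartAt 𝓘(ℝ, E) x₀ x) (toChart x₀ x u) (toChart x₀ x v)
          + toChart x₀ x (nab (FiberBundle.extend E w) x (nab (FiberBundle.extend E v) x u)) := by
    have hdv := (hext v).differentiableAt (by simp)
    rw [hnab.toChart_nab hx, cov_congr (hev w v), cov_clm_apply (hd w) hdv, hval,
      hnab.toChart_nab hx (hmd w), hnab.toChart_nab hx (hmd v)]
    exact (mdifferentiableAt_field_iff hx).2 ((hev w v).differentiableAt_iff.2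
      ((hd w).clm_apply hdv))
  rw [curvature, map_sub, map_sub, hnn, hnn, hnab.mlieBracket_eq (hmd u) (hmd v),
    FiberBundle.extend_apply_self, FiberBundle.extend_apply_self, map_sub, map_sub,
    ← hval w, ← hG.covEnd_cov_sub hy (hext w)]
  abel

end ChartCurvature


/-! ### Vector fields along curves and change of chart -/

section AlongCurves

variable [FiniteDimensional ℝ E] [IsManifold 𝓘(ℝ, E) ∞ M]
  {x₀ x₁ x : M} {c : ℝ → M} {S : Set ℝ} {t : ℝ} {C : Π t : ℝ, TangentSpace 𝓘(ℝ, E) (c t)}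

/-- The coordinate expression of a vector field along a curve. -/
def along (x₀ : M) (c : ℝ → M) (C : Π t : ℝ, TangentSpace 𝓘(ℝ, E) (c t)) (s : ℝ) : E :=
  toChart x₀ (c s) (C s)

/-- The coordinate change of tangent vectors between two charts. -/
def transition (x₀ x₁ : M) (z : E) : E →L[ℝ] E :=
  (toChart x₀ ((extChartAt 𝓘(ℝ, E) x₀).symm z)).comp
    (ofChart x₁ ((extChartAt 𝓘(ℝ, E) x₀).symm z))

lemma transition_toChart (h0 : x ∈ (extChartAt 𝓘(ℝ, E) x₀).source)
    (h1 : x ∈ (extChartAt 𝓘(ℝ, E) x₁).source) (v : TangentSpace 𝓘(ℝ, E) x) :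
    transition x₀ x₁ (extChartAt 𝓘(ℝ, E) x₀ x) (toChart x₁ x v) = toChart x₀ x v := by
  have h : (extChartAt 𝓘(ℝ, E) x₀).symm (extChartAt 𝓘(ℝ, E) x₀ x) = x :=
    (extChartAt 𝓘(ℝ, E) x₀).left_inv h0
  simp only [transition, ContinuousLinearMap.coe_comp, Function.comp_apply]
  rw [h, ofChart_toChart h1]

lemma contDiffAt_transition (h0 : x ∈ (extChartAt 𝓘(ℝ, E) x₀).source)
    (h1 : x ∈ (extChartAt 𝓘(ℝ, E) x₁).source) :
    ContDiffAt ℝ ∞ (transition x₀ x₁) (extChartAt 𝓘(ℝ, E) x₀ x) := by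
  set A : Set E := (extChartAt 𝓘(ℝ, E) x₀).target ∩
    (extChartAt 𝓘(ℝ, E) x₀).symm ⁻¹' (extChartAt 𝓘(ℝ, E) x₁).source with hA
  have hAo : IsOpen A := (continuousOn_extChartAt_symm x₀).isOpen_inter_preimage
    (isOpen_extChartAt_target x₀) (isOpen_extChartAt_source x₁)
  have hmem : extChartAt 𝓘(ℝ, E) x₀ x ∈ A := by
    refine ⟨(extChartAt 𝓘(ℝ, E) x₀).map_source h0, ?_⟩
    rwa [mem_preimage, (extChartAt 𝓘(ℝ, E) x₀).left_inv h0]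
  suffices h : ContDiffOn ℝ ∞ (transition x₀ x₁) A from h.contDiffAt (hAo.mem_nhds hmem)
  refine contDiffOn_clm_apply.2 fun w z hz ↦ ContDiffAt.contDiffWithinAt ?_
  have hx := (extChartAt 𝓘(ℝ, E) x₀).map_target hz.1
  have h := (contMDiffAt_field_iff (n := ⊤) hx).1
    ((smoothOn_chartField_const (M := M) x₁ w).contMDiffAt (source_mem_nhds hz.2))
  rw [(extChartAt 𝓘(ℝ, E) x₀).right_inv hz.1] at h
  exact h

lemma continuousWithinAt_chart_mem {y : M} (hc : ContinuousWithinAt c S t)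
    (hx : c t ∈ (extChartAt 𝓘(ℝ, E) y).source) :
    ∀ᶠ s in 𝓝[S] t, c s ∈ (extChartAt 𝓘(ℝ, E) y).source :=
  hc.eventually (source_mem_nhds hx)

lemma hasDerivWithinAt_chart (hx : c t ∈ (extChartAt 𝓘(ℝ, E) x₀).source)
    (hc : MDifferentiableWithinAt 𝓘(ℝ, ℝ) 𝓘(ℝ, E) c S t) :
    HasDerivWithinAt (fun s ↦ extChartAt 𝓘(ℝ, E) x₀ (c s))
      (along x₀ c (velocity E c S) t) S t := by
  have h := (mdifferentiableAt_extChartAt_of_mem hx).hasMFDerivAt.comp_hasMFDerivWithinAt t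
    hc.hasMFDerivWithinAt
  rw [← toChart_eq_mfderiv hx] at h
  have h' : HasFDerivWithinAt (fun s ↦ extChartAt 𝓘(ℝ, E) x₀ (c s))
      ((toChart x₀ (c t)).comp (mfderivWithin 𝓘(ℝ, ℝ) 𝓘(ℝ, E) c S t) : ℝ →L[ℝ] E) S t :=
    hasMFDerivWithinAt_iff_hasFDerivWithinAt.1 h
  exact h'.hasDerivWithinAt

lemma contDiffWithinAt_chart (hx : c t ∈ (extChartAt 𝓘(ℝ, E) x₀).source)
    (hc : ContMDiffWithinAt 𝓘(ℝ, ℝ) 𝓘(ℝ, E) ∞ c S t) :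
    ContDiffWithinAt ℝ ∞ (fun s ↦ extChartAt 𝓘(ℝ, E) x₀ (c s)) S t :=
  ((contMDiffAt_extChartAt' (I := 𝓘(ℝ, E)) (n := ∞) (by simpa using hx)).comp_contMDiffWithinAt t
    hc).contDiffWithinAt

lemma continuousWithinAt_comp_chart {F : Type*} [TopologicalSpace F] {f : E → F}
    (hx : c t ∈ (extChartAt 𝓘(ℝ, E) x₀).source) (hc : ContinuousWithinAt c S t)
    (hf : ContinuousAt f (extChartAt 𝓘(ℝ, E) x₀ (c t))) :
    ContinuousWithinAt (fun s ↦ f (extChartAt 𝓘(ℝ, E) x₀ (c s))) S t :=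
  ContinuousAt.comp_continuousWithinAt (f := fun s ↦ extChartAt 𝓘(ℝ, E) x₀ (c s)) (g := f) hf
    (ContinuousAt.comp_continuousWithinAt (f := c) (g := extChartAt 𝓘(ℝ, E) x₀)
      (continuousAt_extChartAt' hx) hc)

lemma SmoothAlong.contDiffWithinAt (hC : SmoothAlong c S C) (ht : t ∈ S)
    (hx : c t ∈ (extChartAt 𝓘(ℝ, E) x₀).source) :
    ContDiffWithinAt ℝ ∞ (along x₀ c C) S t := by
  have h := ((trivializationAt E (TangentSpace 𝓘(ℝ, E) : M → Type _) x₀).contMDiffWithinAt_iff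
    (IB := 𝓘(ℝ, E)) (f := fun s ↦ (⟨c s, C s⟩ : TangentBundle 𝓘(ℝ, E) M))
    ((Trivialization.mem_source _).2 (mem_baseSet hx))).1 (hC t ht)
  refine h.2.contDiffWithinAt.congr_of_eventuallyEq ?_ (toChart_apply hx _)
  filter_upwards [continuousWithinAt_chart_mem h.1.continuousWithinAt hx] with s hs
    using toChart_apply hs _

lemma along_transition (h0 : c t ∈ (extChartAt 𝓘(ℝ, E) x₀).source)
    (h1 : c t ∈ (extChartAt 𝓘(ℝ, E) x₁).source) :
    along x₀ c C t = transition x₀ x₁ (extChartAt 𝓘(ℝ, E) x₀ (c t)) (along x₁ c C t) :=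
  (transition_toChart h0 h1 _).symm

lemma differentiableWithinAt_along (h0 : c t ∈ (extChartAt 𝓘(ℝ, E) x₀).source)
    (h1 : c t ∈ (extChartAt 𝓘(ℝ, E) x₁).source)
    (hc : MDifferentiableWithinAt 𝓘(ℝ, ℝ) 𝓘(ℝ, E) c S t)
    (hC : DifferentiableWithinAt ℝ (along x₁ c C) S t) :
    DifferentiableWithinAt ℝ (along x₀ c C) S t := by
  have hT := ((contDiffAt_transition h0 h1).differentiableAt (by simp)).comp_differentiableWithinAt
    t (hasDerivWithinAt_chart h0 hc).differentiableWithinAt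
  refine (hT.clm_apply hC).congr_of_eventuallyEq ?_ (along_transition h0 h1)
  filter_upwards [continuousWithinAt_chart_mem hc.continuousWithinAt h0,
    continuousWithinAt_chart_mem hc.continuousWithinAt h1] with s hs hs'
    using along_transition hs hs'

end AlongCurves

/-! ### The covariant derivative along a curve in an arbitrary chart -/

section CovariantDerivativeAlong

variable [FiniteDimensional ℝ E] [IsManifold 𝓘(ℝ, E) ∞ M]
  [RiemannianBundle (fun x : M ↦ TangentSpace 𝓘(ℝ, E) x)]
  [IsContMDiffRiemannianBundle 𝓘(ℝ, E) ∞ E (fun x : M ↦ TangentSpace 𝓘(ℝ, E) x)]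
  {x₀ : M} {c : ℝ → M} {S : Set ℝ} {t : ℝ} {A B C : Π t : ℝ, TangentSpace 𝓘(ℝ, E) (c t)}
  {nab : Connection E M}

lemma hat_extend_eventuallyEq {x₁ : M} (h0 : x₁ ∈ (extChartAt 𝓘(ℝ, E) x₀).source)
    (v : TangentSpace 𝓘(ℝ, E) x₁) :
    hat x₀ (FiberBundle.extend E v) =ᶠ[𝓝 (extChartAt 𝓘(ℝ, E) x₀ x₁)]
      fun z ↦ transition x₀ x₁ z (toChart x₁ x₁ v) := by
  have h1 := mem_extChartAt_source (I := 𝓘(ℝ, E)) x₁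
  have hcont : ContinuousAt (extChartAt 𝓘(ℝ, E) x₀).symm (extChartAt 𝓘(ℝ, E) x₀ x₁) :=
    continuousAt_extChartAt_symm' h0
  have hmem : ∀ᶠ z in 𝓝 (extChartAt 𝓘(ℝ, E) x₀ x₁),
      (extChartAt 𝓘(ℝ, E) x₀).symm z ∈ (extChartAt 𝓘(ℝ, E) x₁).source := by
    refine hcont.eventually ?_
    rw [(extChartAt 𝓘(ℝ, E) x₀).left_inv h0]
    exact source_mem_nhds h1
  filter_upwards [hmem] with z hz
  rw [hat, transition, ContinuousLinearMap.coe_comp, Function.comp_apply, toChart_apply h1]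
  congr 1
  exact (Trivialization.symmL_apply _ (mem_baseSet hz) _).symm

/-- `covAlong` is defined by the chart centred at `c t`, which varies with `t`; this gives its
formula in one fixed chart. The derivative of the transition map occurs both in the product rule for
`C` and in `∇` of the extension of `C t`, and cancels. -/
lemma IsLeviCivita.hasDerivWithinAt_along (hnab : IsLeviCivita nab)
    (hx : c t ∈ (extChartAt 𝓘(ℝ, E) x₀).source)
    (hc : MDifferentiableWithinAt 𝓘(ℝ, ℝ) 𝓘(ℝ, E) c S t)
    (hC : DifferentiableWithinAt ℝ (along x₀ c C) S t) :
    HasDerivWithinAt (along x₀ c C) (along x₀ c (covAlong nab c S C) t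
      - christoffel (chartMetric x₀) (extChartAt 𝓘(ℝ, E) x₀ (c t))
        (along x₀ c (velocity E c S) t) (along x₀ c C t)) S t := by
  have h1 := mem_extChartAt_source (I := 𝓘(ℝ, E)) (c t)
  have hk : DifferentiableWithinAt ℝ (along (c t) c C) S t := differentiableWithinAt_along h1 hx hc hC
  have hT := (contDiffAt_transition hx h1).differentiableAt (by simp)
  have hγ := hasDerivWithinAt_chart hx hc
  have hT' : HasDerivWithinAt (fun s ↦ transition x₀ (c t) (extChartAt 𝓘(ℝ, E) x₀ (c s)))
      (fderiv ℝ (transition x₀ (c t)) (extChartAt 𝓘(ℝ, E) x₀ (c t))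
        (along x₀ c (velocity E c S) t)) S t :=
    HasFDerivAt.comp_hasDerivWithinAt (l := transition x₀ (c t))
      (f := fun s ↦ extChartAt 𝓘(ℝ, E) x₀ (c s)) t hT.hasFDerivAt hγ
  have hd : HasDerivWithinAt (along x₀ c C)
      (fderiv ℝ (transition x₀ (c t)) (extChartAt 𝓘(ℝ, E) x₀ (c t))
        (along x₀ c (velocity E c S) t) (along (c t) c C t)
        + transition x₀ (c t) (extChartAt 𝓘(ℝ, E) x₀ (c t)) (derivWithin (along (c t) c C) S t))
      S t := by
    refine (hT'.clm_apply hk.hasDerivWithinAt).congr_of_eventuallyEq ?_ (along_transition hx h1)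
    filter_upwards [continuousWithinAt_chart_mem hc.continuousWithinAt hx,
      continuousWithinAt_chart_mem hc.continuousWithinAt h1] with s hs hs'
      using along_transition hs hs'
  refine hd.congr_deriv ?_
  have hk2 : derivWithin (fun s ↦ ((trivializationAt E (TangentSpace 𝓘(ℝ, E) : M → Type _) (c t))
      ⟨c s, C s⟩).2) S t = derivWithin (along (c t) c C) S t := by
    refine Filter.EventuallyEq.derivWithin_eq ?_ (toChart_apply h1 _).symm
    filter_upwards [continuousWithinAt_chart_mem hc.continuousWithinAt h1] with s hs
      using (toChart_apply hs _).symm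
  have hn := hnab.toChart_nab hx (FiberBundle.mdifferentiableAt_extend 𝓘(ℝ, E) E (C t))
    (velocity E c S t)
  rw [cov_apply, hat_apply hx, FiberBundle.extend_apply_self,
    (hat_extend_eventuallyEq hx _).fderiv_eq, ((hT.hasFDerivAt.clm_apply (hasFDerivAt_const _ _))).fderiv] at hn
  have h3 : covAlong nab c S C t = ofChart (c t) (c t) (derivWithin (along (c t) c C) S t)
      + nab (FiberBundle.extend E (C t)) (c t) (velocity E c S t) := by
    rw [covAlong, ← hk2, ofChart, Trivialization.symmL_apply _ (mem_baseSet h1)]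
  have h4 := transition_toChart hx h1 (ofChart (c t) (c t) (derivWithin (along (c t) c C) S t))
  rw [toChart_ofChart h1] at h4
  have h5 : along x₀ c (covAlong nab c S C) t = _ :=
    (congrArg (toChart x₀ (c t)) h3).trans (map_add _ _ _)
  rw [hn, ← h4] at h5
  rw [h5]
  simp [along]
  abel

lemma inner_eq_along (hx : c t ∈ (extChartAt 𝓘(ℝ, E) x₀).source) :
    inner ℝ (A t) (B t) = chartMetric x₀ (extChartAt 𝓘(ℝ, E) x₀ (c t)) (along x₀ c A t)
      (along x₀ c B t) := (chartMetric_toChart hx _ _).symm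

lemma IsLeviCivita.hasDerivWithinAt_inner (hnab : IsLeviCivita nab)
    (hx : c t ∈ (extChartAt 𝓘(ℝ, E) x₀).source)
    (hc : MDifferentiableWithinAt 𝓘(ℝ, ℝ) 𝓘(ℝ, E) c S t)
    (hA : DifferentiableWithinAt ℝ (along x₀ c A) S t)
    (hB : DifferentiableWithinAt ℝ (along x₀ c B) S t) :
    HasDerivWithinAt (fun s ↦ (inner ℝ (A s) (B s) : ℝ))
      (inner ℝ (covAlong nab c S A t) (B t) + inner ℝ (A t) (covAlong nab c S B t)) S t := by
  have hG := isMetricOn_chartMetric (E := E) x₀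
  have hy := (extChartAt 𝓘(ℝ, E) x₀).map_source hx
  have hγ := hasDerivWithinAt_chart hx hc
  have hGd : HasDerivWithinAt (fun s ↦ chartMetric x₀ (extChartAt 𝓘(ℝ, E) x₀ (c s)))
      (fderiv ℝ (chartMetric x₀) (extChartAt 𝓘(ℝ, E) x₀ (c t))
        (along x₀ c (velocity E c S) t)) S t :=
    HasFDerivAt.comp_hasDerivWithinAt (l := chartMetric x₀)
      (f := fun s ↦ extChartAt 𝓘(ℝ, E) x₀ (c s)) t (hG.differentiableAt hy).hasFDerivAt hγ
  have hd := (hGd.clm_apply (hnab.hasDerivWithinAt_along hx hc hA)).clm_apply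
    (hnab.hasDerivWithinAt_along hx hc hB)
  have h1 := inner_eq_along (c := c) (A := covAlong nab c S A) (B := B) hx
  have h2 := inner_eq_along (c := c) (A := A) (B := covAlong nab c S B) hx
  rw [h1, h2]
  refine (hd.congr_of_eventuallyEq ?_ (inner_eq_along hx)).congr_deriv ?_
  · filter_upwards [continuousWithinAt_chart_mem hc.continuousWithinAt hx] with s hs
      using inner_eq_along hs
  · simp only [add_apply, map_sub, sub_apply, hG.fderiv_eq hy]
    ring

end CovariantDerivativeAlong

/-! ### Uniqueness for linear differential equations -/

section Uniqueness

lemma eq_zero_of_norm_deriv_le {F : Type*} [NormedAddCommGroup F] [NormedSpace ℝ F]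
    {f f' : ℝ → F} {K a b s : ℝ} (hs : s ∈ Icc a b)
    (hf : ∀ x ∈ Icc a b, HasDerivWithinAt f (f' x) (Icc a b) x)
    (bound : ∀ x ∈ Icc a b, ‖f' x‖ ≤ K * ‖f x‖) (h0 : f s = 0) {x : ℝ} (hx : x ∈ Icc a b) :
    f x = 0 := by
  have hcont : ContinuousOn f (Icc a b) := fun y hy ↦ (hf y hy).continuousWithinAt
  rcases le_total s x with h | h
  · refine eq_zero_of_abs_deriv_le_mul_abs_self_of_eq_zero_right (K := K) (f' := f')
      (hcont.mono (Icc_subset_Icc_left hs.1)) (fun y hy ↦ ?_) h0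
      (fun y hy ↦ bound y ⟨hs.1.trans hy.1, hy.2.le⟩) x ⟨h, hx.2⟩
    exact (hf y ⟨hs.1.trans hy.1, hy.2.le⟩).mono_of_mem_nhdsWithin
      (Icc_mem_nhdsGE_of_mem ⟨hs.1.trans hy.1, hy.2⟩)
  -- To the left of `s`, reverse time and use the forward Grönwall estimate.
  · have hmaps : MapsTo (fun y : ℝ ↦ -y) (Icc (-s) (-a)) (Icc a b) :=
      fun y hy ↦ ⟨by linarith [hy.2], by linarith [hy.1, hs.2]⟩
    have key := eq_zero_of_abs_deriv_le_mul_abs_self_of_eq_zero_right (K := K)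
      (f := f ∘ fun y ↦ -y) (f' := fun y ↦ (-1 : ℝ) • f' (-y)) (a := -s) (b := -a)
      (hcont.comp continuous_neg.continuousOn hmaps) (fun y hy ↦ ?_) (by simpa using h0)
      (fun y hy ↦ by simpa using bound _ (hmaps ⟨hy.1, hy.2.le⟩)) (-x)
      ⟨by linarith, by linarith [hx.1]⟩
    · simpa using key
    · refine (HasDerivWithinAt.scomp y (hf _ (hmaps ⟨hy.1, hy.2.le⟩))
        (hasDerivAt_neg y).hasDerivWithinAt hmaps).mono_of_mem_nhdsWithin
        (Icc_mem_nhdsGE_of_mem hy)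

lemma eq_zero_of_linear_system {z w : ℝ → E} {Γ R : ℝ → E → E} {g r a b s : ℝ} (hs : s ∈ Icc a b)
    (hz : ∀ x ∈ Icc a b, HasDerivWithinAt z (w x - Γ x (z x)) (Icc a b) x)
    (hw : ∀ x ∈ Icc a b, HasDerivWithinAt w (R x (z x) - Γ x (w x)) (Icc a b) x)
    (hΓ : ∀ x ∈ Icc a b, ∀ v, ‖Γ x v‖ ≤ g * ‖v‖) (hR : ∀ x ∈ Icc a b, ∀ v, ‖R x v‖ ≤ r * ‖v‖)
    (hz0 : z s = 0) (hw0 : w s = 0) {x : ℝ} (hx : x ∈ Icc a b) : z x = 0 ∧ w x = 0 := by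
  have key := eq_zero_of_norm_deriv_le (f := fun x ↦ (z x, w x)) (K := 1 + |g| + |r|) hs
    (fun x hx ↦ (hz x hx).prodMk (hw x hx)) (fun x hx ↦ ?_) (by simp [hz0, hw0]) hx
  · simpa using key
  · have h1 : ‖z x‖ ≤ ‖(z x, w x)‖ := le_max_left _ _
    have h2 : ‖w x‖ ≤ ‖(z x, w x)‖ := le_max_right _ _
    set m := ‖(z x, w x)‖
    have hb {c d : ℝ} (hd : d ≤ m) (hd0 : 0 ≤ d) : c * d ≤ |c| * m := by
      have := le_abs_self c
      have := abs_nonneg c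
      nlinarith
    have h3 := (hΓ x hx (z x)).trans (hb h1 (norm_nonneg _))
    have h4 := (hΓ x hx (w x)).trans (hb h2 (norm_nonneg _))
    have h5 := (hR x hx (z x)).trans (hb h1 (norm_nonneg _))
    have hm : 0 ≤ m := (norm_nonneg _).trans h1
    have hr := mul_nonneg (abs_nonneg r) hm
    refine max_le ?_ ?_
    · refine (norm_sub_le _ _).trans ?_
      linarith
    · refine (norm_sub_le _ _).trans ?_
      linarith

lemma norm_curv_le (G : E → E →L[ℝ] E →L[ℝ] ℝ) [FiniteDimensional ℝ E] (y u v w : E) :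
    ‖curv G y u v w‖
      ≤ (2 * ‖fderiv ℝ (christoffel G) y‖ + 2 * ‖christoffel G y‖ ^ 2) * ‖u‖ * ‖w‖ * ‖v‖ := by
  have h1 (u v w : E) : ‖fderiv ℝ (christoffel G) y u v w‖
      ≤ ‖fderiv ℝ (christoffel G) y‖ * ‖u‖ * ‖v‖ * ‖w‖ :=
    ((fderiv ℝ (christoffel G) y u).le_opNorm₂ v w).trans (by
      gcongr
      exact (fderiv ℝ (christoffel G) y).le_opNorm u)
  have h2 (u v w : E) : ‖christoffel G y u (christoffel G y v w)‖
      ≤ ‖christoffel G y‖ ^ 2 * ‖u‖ * ‖v‖ * ‖w‖ := by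
    refine ((christoffel G y).le_opNorm₂ _ _).trans ?_
    have := (christoffel G y).le_opNorm₂ v w
    calc ‖christoffel G y‖ * ‖u‖ * ‖christoffel G y v w‖
        ≤ ‖christoffel G y‖ * ‖u‖ * (‖christoffel G y‖ * ‖v‖ * ‖w‖) := by gcongr
      _ = _ := by ring
  have h3 := norm_sub_le (fderiv ℝ (christoffel G) y u v w - fderiv ℝ (christoffel G) y v u w
    + christoffel G y u (christoffel G y v w)) (christoffel G y v (christoffel G y u w))
  have h4 := norm_add_le (fderiv ℝ (christoffel G) y u v w - fderiv ℝ (christoffel G) y v u w)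
    (christoffel G y u (christoffel G y v w))
  have h5 := norm_sub_le (fderiv ℝ (christoffel G) y u v w) (fderiv ℝ (christoffel G) y v u w)
  rw [curv]
  linarith [h1 u v w, h1 v u w, h2 u v w, h2 v u w]

end Uniqueness

/-! ### Uniqueness of Jacobi fields -/

section JacobiPairs

variable [FiniteDimensional ℝ E] [IsManifold 𝓘(ℝ, E) ∞ M]
  [RiemannianBundle (fun x : M ↦ TangentSpace 𝓘(ℝ, E) x)]
  [IsContMDiffRiemannianBundle 𝓘(ℝ, E) ∞ E (fun x : M ↦ TangentSpace 𝓘(ℝ, E) x)]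

/-- `A` is a Jacobi field along `c` over `T`, with covariant derivative `B`; the equations are
expressed in the preferred charts. -/
def IsJacobiPairOn (c : ℝ → M) (S T : Set ℝ) (A B : Π t : ℝ, TangentSpace 𝓘(ℝ, E) (c t)) : Prop :=
  ∀ t ∈ T, ∀ x₀ : M, c t ∈ (extChartAt 𝓘(ℝ, E) x₀).source →
    letI y := extChartAt 𝓘(ℝ, E) x₀ (c t)
    letI u := along x₀ c (velocity E c S) t
    HasDerivWithinAt (along x₀ c A) (along x₀ c B t
      - christoffel (chartMetric x₀) y u (along x₀ c A t)) S t ∧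
    HasDerivWithinAt (along x₀ c B) (curv (chartMetric x₀) y u (along x₀ c A t) u
      - christoffel (chartMetric x₀) y u (along x₀ c B t)) S t

variable {c : ℝ → M} {S T : Set ℝ} {A B A' B' : Π t : ℝ, TangentSpace 𝓘(ℝ, E) (c t)}

lemma curv_sub_middle (G : E → E →L[ℝ] E →L[ℝ] ℝ) (y u v v' w : E) :
    curv G y u (v - v') w = curv G y u v w - curv G y u v' w := by
  simp only [curv, map_sub, sub_apply]
  abel

lemma along_eq_zero_iff {x₀ : M} {t : ℝ} (hx : c t ∈ (extChartAt 𝓘(ℝ, E) x₀).source) :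
    along x₀ c A t - along x₀ c B t = 0 ↔ A t = B t :=
  sub_eq_zero.trans (toChart_injective hx).eq_iff

/-- Linear uniqueness inside a single chart. The equivalence makes agreement of the data both open
and closed in `T`, which is what passing between charts requires. -/
lemma IsJacobiPairOn.eventually_eq_iff (h : IsJacobiPairOn c S T A B)
    (h' : IsJacobiPairOn c S T A' B') (hTS : T ⊆ S) (hT : T.OrdConnected)
    (hc : ContMDiffOn 𝓘(ℝ, ℝ) 𝓘(ℝ, E) ∞ c S)
    (hv : ∀ t ∈ S, ContinuousWithinAt (along (c t) c (velocity E c S)) S t) {t : ℝ}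
    (ht : t ∈ T) :
    ∀ᶠ s in 𝓝[T] t, (A t = A' t ∧ B t = B' t ↔ A s = A' s ∧ B s = B' s) := by
  set x₀ := c t
  have hx := mem_extChartAt_source (I := 𝓘(ℝ, E)) x₀
  have hG := isMetricOn_chartMetric (E := E) x₀
  have hy := (extChartAt 𝓘(ℝ, E) x₀).map_source hx
  have hct := ((hc t (hTS ht)).continuousWithinAt)
  have hu : ContinuousWithinAt (along x₀ c (velocity E c S)) S t :=
    hv t (hTS ht)
  have hΓ : ContinuousWithinAt (fun s ↦ ‖christoffel (chartMetric x₀)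
      (extChartAt 𝓘(ℝ, E) x₀ (c s))‖) S t :=
    (continuousWithinAt_comp_chart hx hct (hG.contDiffAt_christoffel hy).continuousAt).norm
  have hΓ' : ContinuousWithinAt (fun s ↦ ‖fderiv ℝ (christoffel (chartMetric x₀))
      (extChartAt 𝓘(ℝ, E) x₀ (c s))‖) S t :=
    (continuousWithinAt_comp_chart hx hct
      ((hG.contDiffAt_christoffel hy).fderiv_right (m := ∞) (by simp)).continuousAt).norm
  set g : ℝ → ℝ := fun s ↦ ‖christoffel (chartMetric x₀) (extChartAt 𝓘(ℝ, E) x₀ (c s))‖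
    * ‖along x₀ c (velocity E c S) s‖ with hg
  set r : ℝ → ℝ := fun s ↦ (2 * ‖fderiv ℝ (christoffel (chartMetric x₀))
    (extChartAt 𝓘(ℝ, E) x₀ (c s))‖ + 2 * ‖christoffel (chartMetric x₀)
    (extChartAt 𝓘(ℝ, E) x₀ (c s))‖ ^ 2) * ‖along x₀ c (velocity E c S) s‖
    * ‖along x₀ c (velocity E c S) s‖ with hr
  have hgc : ContinuousWithinAt g S t := hΓ.mul hu.norm
  have hrc : ContinuousWithinAt r S t :=
    (((continuousWithinAt_const.mul hΓ').add (continuousWithinAt_const.mul (hΓ.pow 2))).mul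
      hu.norm).mul hu.norm
  -- By continuity the operator norms of the coefficients near `t` are at most their bounds at `t`
  -- plus `1`.
  have hev : ∀ᶠ s in 𝓝[T] t, c s ∈ (extChartAt 𝓘(ℝ, E) x₀).source ∧ g s < g t + 1 ∧
      r s < r t + 1 :=
    Filter.Eventually.filter_mono (nhdsWithin_mono t hTS)
      ((continuousWithinAt_chart_mem hct hx).and
        ((hgc.eventually_lt_const (by linarith)).and (hrc.eventually_lt_const (by linarith))))
  obtain ⟨ε, hε, hball⟩ := Metric.mem_nhdsWithin_iff.1 hev
  filter_upwards [inter_mem_nhdsWithin T (Metric.ball_mem_nhds t hε)] with s hs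
  have hsub : uIcc t s ⊆ Metric.ball t ε ∩ T := fun q hq ↦
    ⟨(Real.ball_eq_Ioo t ε).symm ▸ (ordConnected_Ioo.uIcc_subset
      (by constructor <;> linarith) ((Real.ball_eq_Ioo t ε) ▸ hs.2) hq),
      hT.uIcc_subset ht hs.1 hq⟩
  have hsubS : uIcc t s ⊆ S := fun q hq ↦ hTS (hsub hq).2
  have key {p q : ℝ} (hp : p ∈ uIcc t s) (hq : q ∈ uIcc t s) (h0 : A p = A' p ∧ B p = B' p) :
      A q = A' q ∧ B q = B' q := by
    have hcq := (hball (hsub hq)).1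
    have hcp := (hball (hsub hp)).1
    have := eq_zero_of_linear_system (z := fun s ↦ along x₀ c A s - along x₀ c A' s)
      (w := fun s ↦ along x₀ c B s - along x₀ c B' s)
      (Γ := fun s v ↦ christoffel (chartMetric x₀) (extChartAt 𝓘(ℝ, E) x₀ (c s))
        (along x₀ c (velocity E c S) s) v)
      (R := fun s v ↦ curv (chartMetric x₀) (extChartAt 𝓘(ℝ, E) x₀ (c s))
        (along x₀ c (velocity E c S) s) v (along x₀ c (velocity E c S) s))
      (g := g t + 1) (r := r t + 1) hp
      (fun q hq ↦ ?_) (fun q hq ↦ ?_) (fun q hq v ↦ ?_) (fun q hq v ↦ ?_)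
      ((along_eq_zero_iff hcp).2 h0.1) ((along_eq_zero_iff hcp).2 h0.2) hq
    · exact ⟨(along_eq_zero_iff hcq).1 this.1, (along_eq_zero_iff hcq).1 this.2⟩
    · have hq' := (hball (hsub hq)).1
      refine (((h q (hsub hq).2 x₀ hq').1.sub (h' q (hsub hq).2 x₀ hq').1).mono hsubS).congr_deriv ?_
      rw [map_sub]
      abel
    · have hq' := (hball (hsub hq)).1
      refine (((h q (hsub hq).2 x₀ hq').2.sub (h' q (hsub hq).2 x₀ hq').2).mono hsubS).congr_deriv ?_
      rw [map_sub, curv_sub_middle]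
      abel
    · refine ((christoffel (chartMetric x₀) (extChartAt 𝓘(ℝ, E) x₀ (c q))).le_opNorm₂ _ _).trans ?_
      exact mul_le_mul_of_nonneg_right (hball (hsub hq)).2.1.le (norm_nonneg _)
    · refine (norm_curv_le _ _ _ _ _).trans ?_
      exact mul_le_mul_of_nonneg_right (hball (hsub hq)).2.2.le (norm_nonneg _)
  exact ⟨key left_mem_uIcc right_mem_uIcc, key right_mem_uIcc left_mem_uIcc⟩

lemma IsJacobiPairOn.eqOn (h : IsJacobiPairOn c S T A B)
    (h' : IsJacobiPairOn c S T A' B') (hTS : T ⊆ S) (hT : T.OrdConnected)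
    (hc : ContMDiffOn 𝓘(ℝ, ℝ) 𝓘(ℝ, E) ∞ c S)
    (hv : ∀ t ∈ S, ContinuousWithinAt (along (c t) c (velocity E c S)) S t) {t s : ℝ}
    (ht : t ∈ T) (hs : s ∈ T) (h0 : A t = A' t ∧ B t = B' t) : A s = A' s ∧ B s = B' s := by
  refine (hT.isPreconnected.induction₂
    (fun t s ↦ (A t = A' t ∧ B t = B' t ↔ A s = A' s ∧ B s = B' s)) ?_ ?_ ?_ ht hs).1 h0
  · exact fun x hx ↦ h.eventually_eq_iff h' hTS hT hc hv hx
  · exact fun _ _ _ _ _ _ h1 h2 ↦ h1.trans h2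
  · exact fun _ _ _ _ h1 ↦ h1.symm

end JacobiPairs

/-! ### The Lee field and its covariant derivative -/

section LeeField

variable [FiniteDimensional ℝ E] [IsManifold 𝓘(ℝ, E) ∞ M]
  [RiemannianBundle (fun x : M ↦ TangentSpace 𝓘(ℝ, E) x)]
  [IsContMDiffRiemannianBundle 𝓘(ℝ, E) ∞ E (fun x : M ↦ TangentSpace 𝓘(ℝ, E) x)]

variable {x₀ x : M} {nab : Connection E M} {J : EndField E M} {D : Distribution E M}
  {N : VecField E M}

lemma exists_dual_field (α : OneForm E M) :
    ∃ N : VecField E M, ∀ x v, inner ℝ (N x) v = α x v := by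
  have h (x : M) : ∃ u : TangentSpace 𝓘(ℝ, E) x, ∀ v, inner ℝ u v = α x v := by
    have : CompleteSpace (TangentSpace 𝓘(ℝ, E) x) := FiniteDimensional.complete ℝ _
    exact ⟨(InnerProductSpace.toDual ℝ (TangentSpace 𝓘(ℝ, E) x)).symm (α x), fun v ↦
      InnerProductSpace.toDual_symm_apply⟩
  choose N hN using h
  exact ⟨N, hN⟩

lemma contMDiffOn_oneForm_apply {α : OneForm E M}
    (hα : ContMDiff 𝓘(ℝ, E) (𝓘(ℝ, E).prod 𝓘(ℝ, E →L[ℝ] ℝ)) ∞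
      (fun x ↦ TotalSpace.mk' (E →L[ℝ] ℝ)
        (E := fun x : M ↦ TangentSpace 𝓘(ℝ, E) x →L[ℝ] ℝ) x (α x)))
    {X : VecField E M} {W : Set M} (hX : SmoothOn X W) :
    ContMDiffOn 𝓘(ℝ, E) 𝓘(ℝ, ℝ) ∞ (fun x ↦ α x (X x)) W := by
  have h := ContMDiffOn.clm_bundle_apply (F₁ := E) (F₂ := ℝ)
    (E₁ := (TangentSpace 𝓘(ℝ, E) : M → Type _)) (E₂ := Bundle.Trivial M ℝ)
    (b := fun x : M ↦ x) (hα.contMDiffOn) hX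
  exact fun x hx ↦ ((contMDiffWithinAt_totalSpace).1 (h x hx)).2

/-- In a chart `N` is the smooth inverse of the metric applied to the coefficients of `α`. -/
lemma smoothOn_dual_field {α : OneForm E M}
    (hα : ContMDiff 𝓘(ℝ, E) (𝓘(ℝ, E).prod 𝓘(ℝ, E →L[ℝ] ℝ)) ∞
      (fun x ↦ TotalSpace.mk' (E →L[ℝ] ℝ)
        (E := fun x : M ↦ TangentSpace 𝓘(ℝ, E) x →L[ℝ] ℝ) x (α x)))
    {N : VecField E M} (hN : ∀ x v, inner ℝ (N x) v = α x v) : SmoothOn N univ := by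
  intro x₀ _
  have hx := mem_extChartAt_source (I := 𝓘(ℝ, E)) x₀
  have hy := (extChartAt 𝓘(ℝ, E) x₀).map_source hx
  have hG := isMetricOn_chartMetric (E := E) x₀
  refine ContMDiffAt.contMDiffWithinAt ((contMDiffAt_field_iff (n := ⊤) hx).2 ?_)
  let β : E → E →L[ℝ] ℝ := fun y ↦ (α ((extChartAt 𝓘(ℝ, E) x₀).symm y)).comp
    (ofChart x₀ ((extChartAt 𝓘(ℝ, E) x₀).symm y))
  have hβ : ContDiffAt ℝ ∞ β (extChartAt 𝓘(ℝ, E) x₀ x₀) := by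
    suffices h : ContDiffOn ℝ ∞ β (extChartAt 𝓘(ℝ, E) x₀).target from
      h.contDiffAt (hG.isOpen.mem_nhds hy)
    refine contDiffOn_clm_apply.2 fun w z hz ↦ ContDiffAt.contDiffWithinAt ?_
    have hz' := (extChartAt 𝓘(ℝ, E) x₀).map_target hz
    have h := (contMDiffAt_iff_chart (n := ⊤) hz').1
      ((contMDiffOn_oneForm_apply hα (smoothOn_chartField_const x₀ w)).contMDiffAt
        (source_mem_nhds hz'))
    rw [(extChartAt 𝓘(ℝ, E) x₀).right_inv hz] at h
    exact h
  refine ((hG.contDiffAt_inverse hy).clm_apply hβ).congr_of_eventuallyEq ?_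
  filter_upwards [target_mem_nhds hx] with z hz
  obtain ⟨e, he⟩ := hG.exists_equiv hz
  refine hG.ext_inner hz fun w ↦ ?_
  have h2 : (chartMetric x₀ z) ((chartMetric x₀ z).inverse (β z)) = β z :=
    ContinuousLinearMap.IsInvertible.self_apply_inverse ⟨e, he⟩ _
  rw [h2, chartMetric_apply]
  refine Eq.trans ?_ (hN _ _)
  rw [hat, ofChart_toChart ((extChartAt 𝓘(ℝ, E) x₀).map_target hz)]
  rfl

lemma SmoothOn.mono {X : VecField E M} {W W' : Set M} (hX : SmoothOn X W) (h : W' ⊆ W) :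
    SmoothOn X W' := ContMDiffOn.mono hX h

lemma IsSectionOn.mono {X : VecField E M} {W W' : Set M} (hX : IsSectionOn D X W) (h : W' ⊆ W) :
    IsSectionOn D X W' := ⟨hX.1.mono h, fun x hx ↦ hX.2 x (h hx)⟩

/-- A smooth field through a given tangent vector. -/
def fieldThrough (x : M) (v : TangentSpace 𝓘(ℝ, E) x) : VecField E M :=
  chartField x (fun _ ↦ toChart x x v)

lemma fieldThrough_self (v : TangentSpace 𝓘(ℝ, E) x) : fieldThrough x v x = v :=
  ofChart_toChart (mem_extChartAt_source x) v

lemma smoothOn_fieldThrough (v : TangentSpace 𝓘(ℝ, E) x) :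
    SmoothOn (fieldThrough x v) (extChartAt 𝓘(ℝ, E) x).source :=
  smoothOn_chartField_const _ _

lemma mdifferentiableAt_fieldThrough (v : TangentSpace 𝓘(ℝ, E) x) :
    MDifferentiableAt 𝓘(ℝ, E) 𝓘(ℝ, E).tangent
      (fun y ↦ (⟨y, fieldThrough x v y⟩ : TangentBundle 𝓘(ℝ, E) M)) x :=
  (smoothOn_fieldThrough v).mdifferentiableAt (source_mem_nhds (mem_extChartAt_source x))

/-- `N` is the field dual to the one-form of a totally geodesic homothetic distribution. -/
structure IsLeeField (nab : Connection E M) (D : Distribution E M) (N : VecField E M) : Prop where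
  smooth : SmoothOn N univ
  mem : ∀ x, N x ∈ D x
  nab_symm : ∀ x (u v : TangentSpace 𝓘(ℝ, E) x), inner ℝ (nab N x u) v = inner ℝ u (nab N x v)
  conformal : ∀ (W : Set M) (V : VecField E M), IsOpen W → IsSectionOn D V W → ∀ x ∈ W,
    ∀ v ∈ (D x)ᗮ, ∀ w ∈ (D x)ᗮ,
      inner ℝ (nab V x v) w + inner ℝ v (nab V x w) = inner ℝ (N x) (V x) * inner ℝ v w

lemma IsComplexHomotheticFoliation.exists_isLeeField (hnab : IsLeviCivita nab)
    (hD : IsComplexHomotheticFoliation nab J D) : ∃ N, IsLeeField nab D N := by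
  obtain ⟨α, ⟨hα, hα', hconf⟩, hclosed⟩ := hD.homothetic
  obtain ⟨N, hN⟩ := exists_dual_field α
  have hs := smoothOn_dual_field hα hN
  refine ⟨N, hs, fun x ↦ ?_, fun x u v ↦ ?_, fun W V hW hV x hx v hv w hw ↦ ?_⟩
  · rw [← (D x).orthogonal_orthogonal]
    -- Since `α` vanishes on `Dᗮ`, its dual vector lies in `Dᗮᗮ = D`.
    exact (Submodule.mem_orthogonal' _ _).2 fun v hv ↦ (hN x v).trans (hα' x v hv)
  · have h := hclosed _ _ _ (isOpen_extChartAt_source x) (smoothOn_fieldThrough u)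
      (smoothOn_fieldThrough v) x (mem_extChartAt_source x)
    have hdN : MDifferentiableAt 𝓘(ℝ, E) 𝓘(ℝ, E).tangent
      (fun y ↦ (⟨y, N y⟩ : TangentBundle 𝓘(ℝ, E) M)) x := hs.mdifferentiableAt univ_mem
    simp only [← hN] at h
    rw [hnab.mvfderiv_inner hdN (mdifferentiableAt_fieldThrough v),
      hnab.mvfderiv_inner hdN (mdifferentiableAt_fieldThrough u),
      hnab.mlieBracket_eq (mdifferentiableAt_fieldThrough u) (mdifferentiableAt_fieldThrough v),
      fieldThrough_self, fieldThrough_self, inner_sub_right] at h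
    rw [real_inner_comm (nab N x v) u]
    linarith
  · have hW' : W ∩ (extChartAt 𝓘(ℝ, E) x).source ∈ 𝓝 x :=
      inter_mem (hW.mem_nhds hx) (source_mem_nhds (mem_extChartAt_source x))
    have h := hconf (W ∩ (extChartAt 𝓘(ℝ, E) x).source) V (fieldThrough x v) (fieldThrough x w)
      (hW.inter (isOpen_extChartAt_source x)) (hV.mono inter_subset_left)
      ((smoothOn_fieldThrough v).mono inter_subset_right)
      ((smoothOn_fieldThrough w).mono inter_subset_right) x ⟨hx, mem_extChartAt_source x⟩
      (by rwa [fieldThrough_self]) (by rwa [fieldThrough_self])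
    have hdV : MDifferentiableAt 𝓘(ℝ, E) 𝓘(ℝ, E).tangent
      (fun y ↦ (⟨y, V y⟩ : TangentBundle 𝓘(ℝ, E) M)) x :=
      hV.1.mdifferentiableAt (hW.mem_nhds hx)
    rw [lieDerivMetric, hnab.mvfderiv_inner (mdifferentiableAt_fieldThrough v)
      (mdifferentiableAt_fieldThrough w), hnab.mlieBracket_eq hdV (mdifferentiableAt_fieldThrough v),
      hnab.mlieBracket_eq hdV (mdifferentiableAt_fieldThrough w),
      fieldThrough_self, fieldThrough_self, inner_sub_left, inner_sub_right] at h
    rw [hN]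
    linarith

/-- Derivatives along a totally geodesic distribution do not leave it. -/
lemma IsComplexHomotheticFoliation.nab_mem (hD : IsComplexHomotheticFoliation nab J D)
    {W : Set M} {V : VecField E M} (hW : IsOpen W) (hV : IsSectionOn D V W) (hx : x ∈ W)
    {v : TangentSpace 𝓘(ℝ, E) x} (hv : v ∈ D x) : nab V x v ∈ D x := by
  obtain ⟨W', hW', hx', s, hs, hspan⟩ := hD.smooth.2 x
  have h : D x ≤ (D x).comap (nab V x).toLinearMap := by
    conv_lhs => rw [hspan x hx']
    refine Submodule.span_le.2 ?_
    rintro _ ⟨i, rfl⟩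
    refine hD.totallyGeodesic (W ∩ W') (s i) V (hW.inter hW')
      ⟨(hs i).mono inter_subset_right, fun y hy ↦ ?_⟩ (hV.mono inter_subset_left) x ⟨hx, hx'⟩
    rw [hspan y hy.2]
    exact Submodule.subset_span ⟨i, rfl⟩
  exact h hv

/-- Total geodesy and symmetry of `∇N` remove the component of `∇_w N` in `D`; the conformal
equation with `V = N` determines the component in `Dᗮ`. -/
lemma IsLeeField.nab_perp (hN : IsLeeField nab D N) (hD : IsComplexHomotheticFoliation nab J D)
    {w : TangentSpace 𝓘(ℝ, E) x} (hw : w ∈ (D x)ᗮ) :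
    nab N x w = ((1 / 2 : ℝ) * inner ℝ (N x) (N x)) • w := by
  have hs : IsSectionOn D N univ := ⟨hN.smooth, fun x _ ↦ hN.mem x⟩
  refine ext_inner_right ℝ fun v ↦ ?_
  obtain ⟨p, hp, q, hq, rfl⟩ := (D x).exists_add_mem_mem_orthogonal v
  have h1 := hN.conformal univ N isOpen_univ hs x trivial w hw q hq
  rw [← hN.nab_symm] at h1
  have h2 : inner ℝ (nab N x w) p = 0 := by
    rw [hN.nab_symm]
    exact (Submodule.mem_orthogonal' _ _).1 hw _ (hD.nab_mem isOpen_univ hs trivial hp)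
  have h3 : inner ℝ w p = 0 := (Submodule.mem_orthogonal' _ _).1 hw _ hp
  rw [inner_add_right, h2, real_inner_smul_left, inner_add_right, h3]
  linarith

lemma IsComplexHomotheticFoliation.eq_span (hJ : IsKaehler nab J)
    (hD : IsComplexHomotheticFoliation nab J D) {v : TangentSpace 𝓘(ℝ, E) x} (hv : v ∈ D x)
    (h0 : v ≠ 0) : D x = Submodule.span ℝ {v, J x v} := by
  have h1 : inner ℝ (J x v) v = 0 := by
    have h := hJ.orthogonal x v (J x v)
    rw [hJ.sq, inner_neg_right, real_inner_comm v] at h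
    rw [real_inner_comm]
    linarith
  have h2 : inner ℝ (J x v) (J x v) = inner ℝ v v := hJ.orthogonal x v v
  have hpos : 0 < inner ℝ v v := real_inner_self_pos.2 h0
  have hli : LinearIndependent ℝ ![v, J x v] := by
    refine LinearIndependent.pair_iff.2 fun a b hab ↦ ?_
    have e1 := congrArg (fun u ↦ inner ℝ u v) hab
    have e2 := congrArg (fun u ↦ inner ℝ u (J x v)) hab
    simp only [inner_add_left, real_inner_smul_left, h1, h2, inner_zero_left,
      real_inner_comm (J x v) v] at e1 e2
    constructor
    · nlinarith
    · nlinarith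
  symm
  refine Submodule.eq_of_le_of_finrank_eq ?_ ?_
  · refine Submodule.span_le.2 ?_
    rintro u (rfl | rfl)
    · exact hv
    · exact hD.complex x v hv
  · have := finrank_span_eq_card hli
    rw [Matrix.range_cons_cons_empty] at this
    rw [this, hD.smooth.1 x]
    rfl

lemma IsComplexHomotheticFoliation.mem_orthogonal (hJ : IsKaehler nab J)
    (hD : IsComplexHomotheticFoliation nab J D) {v w : TangentSpace 𝓘(ℝ, E) x} (hv : v ∈ D x)
    (h0 : v ≠ 0) (h1 : inner ℝ w v = 0) (h2 : inner ℝ w (J x v) = 0) : w ∈ (D x)ᗮ := by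
  rw [hD.eq_span hJ hv h0, Submodule.mem_orthogonal']
  intro u hu
  obtain ⟨a, b, rfl⟩ := Submodule.mem_span_pair.1 hu
  rw [inner_add_right, real_inner_smul_right, real_inner_smul_right, h1, h2]
  simp

lemma IsComplexHomotheticFoliation.eq_zero (hJ : IsKaehler nab J)
    (hD : IsComplexHomotheticFoliation nab J D) {v w : TangentSpace 𝓘(ℝ, E) x} (hv : v ∈ D x)
    (h0 : v ≠ 0) (hw : w ∈ D x) (h1 : inner ℝ w v = 0) (h2 : inner ℝ w (J x v) = 0) : w = 0 :=
  inner_self_eq_zero.1 ((Submodule.mem_orthogonal' _ _).1 (hD.mem_orthogonal hJ hv h0 h1 h2) w hw)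

lemma IsComplexHomotheticFoliation.finrank_orthogonal
    (hD : IsComplexHomotheticFoliation nab J D) (x : M) :
    2 + Module.finrank ℝ (D x)ᗮ = Module.finrank ℝ E := by
  have h := (D x).finrank_add_finrank_orthogonal
  rw [hD.smooth.1 x] at h
  exact h

end LeeField

/-! ### The Lee field in charts, partial divergence and `κ` -/

section Structure

variable [FiniteDimensional ℝ E] [IsManifold 𝓘(ℝ, E) ∞ M]
  [RiemannianBundle (fun x : M ↦ TangentSpace 𝓘(ℝ, E) x)]
  [IsContMDiffRiemannianBundle 𝓘(ℝ, E) ∞ E (fun x : M ↦ TangentSpace 𝓘(ℝ, E) x)]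

variable {x₀ x : M} {nab : Connection E M} {J : EndField E M} {D : Distribution E M}
  {N : VecField E M}

lemma IsKaehlerOn.mono {G : E → E →L[ℝ] E →L[ℝ] ℝ} {I : E → E →L[ℝ] E} {Ω Ω' : Set E}
    (h : IsKaehlerOn G I Ω) (hΩ : IsOpen Ω') (hsub : Ω' ⊆ Ω) : IsKaehlerOn G I Ω' where
  isOpen := hΩ
  smooth y hy := h.smooth y (hsub hy)
  symm := h.symm
  pos y hy := h.pos y (hsub hy)
  smooth_J y hy := h.smooth_J y (hsub hy)
  sq y hy := h.sq y (hsub hy)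
  orthogonal y hy := h.orthogonal y (hsub hy)
  parallel y hy := h.parallel y (hsub hy)

lemma IsLeeField.contDiffAt_hat (hN : IsLeeField nab D N)
    (hx : x ∈ (extChartAt 𝓘(ℝ, E) x₀).source) :
    ContDiffAt ℝ ∞ (hat x₀ N) (extChartAt 𝓘(ℝ, E) x₀ x) :=
  hN.smooth.contDiffAt_hat hx univ_mem

lemma IsLeeField.mdifferentiableAt (hN : IsLeeField nab D N) (x : M) :
    MDifferentiableAt 𝓘(ℝ, E) 𝓘(ℝ, E).tangent
      (fun x ↦ (⟨x, N x⟩ : TangentBundle 𝓘(ℝ, E) M)) x :=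
  hN.smooth.mdifferentiableAt univ_mem

/-- The part of the chart domain at `x₀` where `N` does not vanish. -/
def regularChart (x₀ : M) (N : VecField E M) : Set E :=
  (extChartAt 𝓘(ℝ, E) x₀).target ∩ hat x₀ N ⁻¹' {0}ᶜ

lemma mem_regularChart (hx : x ∈ (extChartAt 𝓘(ℝ, E) x₀).source) (h0 : N x ≠ 0) :
    extChartAt 𝓘(ℝ, E) x₀ x ∈ regularChart x₀ N := by
  refine ⟨(extChartAt 𝓘(ℝ, E) x₀).map_source hx, fun h ↦ h0 ?_⟩
  rw [mem_singleton_iff, hat_apply hx] at h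
  exact toChart_injective hx (h.trans (map_zero _).symm)

lemma IsLeeField.isHomotheticGradientOn (hN : IsLeeField nab D N) (hnab : IsLeviCivita nab)
    (hJ : IsKaehler nab J) (hD : IsComplexHomotheticFoliation nab J D)
    (hdim : 2 < Module.finrank ℝ E) (x₀ : M) :
    IsHomotheticGradientOn (chartMetric x₀) (chartEnd x₀ J) (hat x₀ N) (regularChart x₀ N) := by
  have hsm : ∀ y ∈ (extChartAt 𝓘(ℝ, E) x₀).target, ContDiffAt ℝ ∞ (hat x₀ N) y := by
    intro y hy
    have h := hN.contDiffAt_hat ((extChartAt 𝓘(ℝ, E) x₀).map_target hy)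
    rwa [(extChartAt 𝓘(ℝ, E) x₀).right_inv hy] at h
  have hopen : IsOpen (regularChart x₀ N) :=
    ContinuousOn.isOpen_inter_preimage (fun y hy ↦ (hsm y hy).continuousAt.continuousWithinAt)
      (isOpen_extChartAt_target x₀) isOpen_compl_singleton
  have key : ∀ y ∈ regularChart x₀ N, ∃ x, x ∈ (extChartAt 𝓘(ℝ, E) x₀).source ∧
      extChartAt 𝓘(ℝ, E) x₀ x = y ∧ N x ≠ 0 := by
    intro y hy
    refine ⟨(extChartAt 𝓘(ℝ, E) x₀).symm y, (extChartAt 𝓘(ℝ, E) x₀).map_target hy.1,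
      (extChartAt 𝓘(ℝ, E) x₀).right_inv hy.1, fun h ↦ hy.2 ?_⟩
    rw [mem_singleton_iff, hat, h, map_zero]
  have hnn {x : M} (hx : x ∈ (extChartAt 𝓘(ℝ, E) x₀).source) (u : E) :
      cov (chartMetric x₀) (hat x₀ N) (extChartAt 𝓘(ℝ, E) x₀ x) u
        = toChart x₀ x (nab N x (ofChart x₀ x u)) := by
    rw [hnab.toChart_nab hx (hN.mdifferentiableAt x), toChart_ofChart hx]
  have hJN {x : M} (hx : x ∈ (extChartAt 𝓘(ℝ, E) x₀).source) :
      chartEnd x₀ J (extChartAt 𝓘(ℝ, E) x₀ x) (hat x₀ N (extChartAt 𝓘(ℝ, E) x₀ x))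
        = toChart x₀ x (J x (N x)) := by
    rw [hat_apply hx, chartEnd_toChart hx]
  refine { (isKaehlerOn_chart hnab hJ x₀).mono hopen inter_subset_left with
    smooth_N := fun y hy ↦ hsm y hy.1
    ne_zero := fun y hy ↦ hy.2
    cov_symm := fun y hy u v ↦ ?_
    cov_perp := fun y hy w h1 h2 ↦ ?_
    exists_perp := fun y hy ↦ ?_ }
  all_goals obtain ⟨x, hx, rfl, h0⟩ := key y hy
  · rw [hnn hx, hnn hx, chartMetric_eq hx, chartMetric_eq hx, ofChart_toChart hx,
      ofChart_toChart hx, hN.nab_symm]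
  · rw [hJN hx, chartMetric_eq hx, ofChart_toChart hx] at h2
    rw [hat_apply hx, chartMetric_eq hx, ofChart_toChart hx] at h1
    rw [hnn hx, hN.nab_perp hD (hD.mem_orthogonal hJ (hN.mem x) h0 h1 h2), map_smul,
      toChart_ofChart hx, hat_apply hx, chartMetric_toChart hx]
  · have hfr := hD.finrank_orthogonal x
    -- The dimension bound enters here: real dimension above `2` leaves a nonzero `w ⊥ D` for the
    -- curvature comparison.
    have : Nontrivial (D x)ᗮ := Module.nontrivial_of_finrank_pos (R := ℝ) (by omega)
    obtain ⟨⟨w, hw⟩, hw0⟩ := exists_ne (0 : (D x)ᗮ)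
    have hw' := (Submodule.mem_orthogonal' _ _).1 hw
    refine ⟨toChart x₀ x w, fun h ↦ hw0 ?_, ?_, ?_⟩
    · exact Subtype.ext (toChart_injective hx (h.trans (map_zero _).symm))
    · rw [hat_apply hx, chartMetric_toChart hx]
      exact hw' _ (hN.mem x)
    · rw [hJN hx, chartMetric_toChart hx]
      exact hw' _ (hD.complex x _ (hN.mem x))

lemma IsLeeField.smul_nab_self (hN : IsLeeField nab D N) (hnab : IsLeviCivita nab)
    (hJ : IsKaehler nab J) (hD : IsComplexHomotheticFoliation nab J D)
    (hdim : 2 < Module.finrank ℝ E) (h0 : N x ≠ 0) :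
    inner ℝ (N x) (N x) • nab N x (N x) = inner ℝ (nab N x (N x)) (N x) • N x := by
  have hx := mem_extChartAt_source (I := 𝓘(ℝ, E)) x
  have h := (hN.isHomotheticGradientOn hnab hJ hD hdim x).smul_cov_N (mem_regularChart hx h0)
  rw [hat_apply hx, ← hnab.toChart_nab hx (hN.mdifferentiableAt x), chartMetric_toChart hx,
    chartMetric_toChart hx] at h
  exact toChart_injective hx ((map_smul _ _ _).trans (h.trans (map_smul _ _ _).symm))

lemma IsLeeField.inner_nab_J (hN : IsLeeField nab D N) (hnab : IsLeviCivita nab)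
    (hJ : IsKaehler nab J) (hD : IsComplexHomotheticFoliation nab J D)
    (hdim : 2 < Module.finrank ℝ E) (h0 : N x ≠ 0) :
    inner ℝ (nab N x (J x (N x))) (J x (N x))
      = inner ℝ (nab N x (N x)) (N x) + inner ℝ (N x) (N x) ^ 2 := by
  have hx := mem_extChartAt_source (I := 𝓘(ℝ, E)) x
  have h := (hN.isHomotheticGradientOn hnab hJ hD hdim x).inner_cov_JN_JN (mem_regularChart hx h0)
  rw [hat_apply hx, chartEnd_toChart hx, ← hnab.toChart_nab hx (hN.mdifferentiableAt x),
    ← hnab.toChart_nab hx (hN.mdifferentiableAt x), chartMetric_toChart hx,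
    chartMetric_toChart hx, chartMetric_toChart hx] at h
  exact h

/-- Each vector of the orthonormal basis contributes `½ g(N, V)`, by the conformal equation on the
diagonal. -/
lemma IsLeeField.divE_eq (hN : IsLeeField nab D N) {W : Set M} {V : VecField E M} (hW : IsOpen W)
    (hV : IsSectionOn D V W) (hx : x ∈ W) :
    divE nab D V x = (Module.finrank ℝ (D x)ᗮ : ℝ) / 2 * inner ℝ (N x) (V x) := by
  have h (i) : inner ℝ (nab V x (stdOrthonormalBasis ℝ (D x)ᗮ i : TangentSpace 𝓘(ℝ, E) x))
      (stdOrthonormalBasis ℝ (D x)ᗮ i : TangentSpace 𝓘(ℝ, E) x)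
      = (1 / 2 : ℝ) * inner ℝ (N x) (V x) := by
    have h1 := hN.conformal W V hW hV x hx _ (stdOrthonormalBasis ℝ (D x)ᗮ i).2 _
      (stdOrthonormalBasis ℝ (D x)ᗮ i).2
    have h2 : inner ℝ (stdOrthonormalBasis ℝ (D x)ᗮ i : TangentSpace 𝓘(ℝ, E) x)
        (stdOrthonormalBasis ℝ (D x)ᗮ i : TangentSpace 𝓘(ℝ, E) x) = (1 : ℝ) := by
      rw [real_inner_self_eq_norm_sq]
      exact (congrArg (· ^ 2) ((stdOrthonormalBasis ℝ (D x)ᗮ).norm_eq_one i)).trans (one_pow 2)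
    rw [h2, real_inner_comm (nab V x _) (stdOrthonormalBasis ℝ (D x)ᗮ i : TangentSpace 𝓘(ℝ, E) x)]
      at h1
    linarith
  rw [divE, Finset.sum_congr rfl fun i _ ↦ h i, Finset.sum_const, Finset.card_univ,
    Fintype.card_fin, nsmul_eq_mul]
  ring

lemma exists_unitSection (hD : IsComplexHomotheticFoliation nab J D) (x : M) :
    ∃ (ξ : VecField E M) (W : Set M), IsOpen W ∧ x ∈ W ∧ IsUnitSectionOn D ξ W := by
  obtain ⟨W, hW, hx, s, hs, hspan⟩ := hD.smooth.2 x
  obtain ⟨i, hi⟩ : ∃ i, s i x ≠ 0 := by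
    by_contra! h
    have h2 := hD.smooth.1 x
    have h3 : range (fun i ↦ s i x) = {0} := by simp [h, Set.range_const]
    rw [hspan x hx, h3, Submodule.span_zero_singleton, finrank_bot] at h2
    omega
  let ρ : M → ℝ := fun y ↦ inner ℝ (s i y) (s i y)
  have hρ : ContMDiffOn 𝓘(ℝ, E) 𝓘(ℝ, ℝ) ∞ ρ W :=
    ContMDiffOn.inner_bundle (IB := 𝓘(ℝ, E)) (IM := 𝓘(ℝ, E)) (F := E)
      (E := fun x : M ↦ TangentSpace 𝓘(ℝ, E) x) (b := fun x ↦ x) (hs i) (hs i)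
  have hpos {y : M} (hy : ρ y ≠ 0) : 0 < ρ y := lt_of_le_of_ne real_inner_self_nonneg hy.symm
  have hW' : IsOpen (W ∩ ρ ⁻¹' {0}ᶜ) := hρ.continuousOn.isOpen_inter_preimage hW
    isOpen_compl_singleton
  refine ⟨fun y ↦ (Real.sqrt (ρ y))⁻¹ • s i y, W ∩ ρ ⁻¹' {0}ᶜ, hW',
    ⟨hx, (real_inner_self_pos.2 hi).ne'⟩, ⟨?_, fun y hy ↦ ?_⟩, fun y hy ↦ ?_⟩
  · have hf : ContMDiffOn 𝓘(ℝ, E) 𝓘(ℝ, ℝ) ∞ (fun y ↦ (Real.sqrt (ρ y))⁻¹) (W ∩ ρ ⁻¹' {0}ᶜ) := by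
      intro y hy
      have hg : ContDiffAt ℝ ∞ (fun r ↦ (Real.sqrt r)⁻¹) (ρ y) :=
        (Real.contDiffAt_sqrt hy.2).inv (Real.sqrt_pos.2 (hpos hy.2)).ne'
      exact hg.contMDiffAt.comp_contMDiffWithinAt y ((hρ.mono inter_subset_left) y hy)
    exact hf.smul_section ((hs i).mono inter_subset_left)
  · refine Submodule.smul_mem _ _ ?_
    rw [hspan y hy.1]
    exact Submodule.subset_span ⟨i, rfl⟩
  · have h := hpos hy.2
    have h2 : Real.sqrt (ρ y) = ‖s i y‖ := by
      simp only [ρ, real_inner_self_eq_norm_sq, Real.sqrt_sq (norm_nonneg _)]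
    rw [norm_smul, norm_inv, Real.norm_eq_abs, abs_of_nonneg (Real.sqrt_nonneg _), h2]
    exact inv_mul_cancel₀ (h2 ▸ (Real.sqrt_pos.2 h).ne')

/-- By `divE_eq`, `κ` is a positive multiple of the norm of `(⟨N, ξ⟩, ⟨N, Jξ⟩)`, the components of
`N` in a frame of `D`. Existence of unit sections makes the choice in `kappa` a genuine one. -/
lemma IsLeeField.kappa_eq_zero_iff (hN : IsLeeField nab D N)
    (hJ : IsKaehler nab J) (hD : IsComplexHomotheticFoliation nab J D)
    (hdim : 2 < Module.finrank ℝ E) : kappa nab J D x = 0 ↔ N x = 0 := by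
  have hex := exists_unitSection hD x
  obtain ⟨W, hW, hx, hξ⟩ := Classical.epsilon_spec hex
  rw [kappa]
  set ξ : VecField E M := Classical.epsilon fun ξ : VecField E M ↦
    ∃ W : Set M, IsOpen W ∧ x ∈ W ∧ IsUnitSectionOn D ξ W
  have hJξ : IsSectionOn D (applyJ J ξ) W :=
    ⟨hJ.smoothOn_applyJ hξ.1.1, fun y hy ↦ hD.complex y _ (hξ.1.2 y hy)⟩
  have hfr := hD.finrank_orthogonal x
  have hm : (0 : ℝ) < Module.finrank ℝ (D x)ᗮ := by exact_mod_cast (by omega)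
  simp only [hN.divE_eq hW hξ.1 hx, hN.divE_eq hW hJξ hx]
  rw [Real.sqrt_eq_zero (by positivity)]
  constructor
  · intro h
    have h0 : ξ x ≠ 0 := by
      rw [← norm_ne_zero_iff, hξ.2 x hx]
      exact one_ne_zero
    have hm' : (Module.finrank ℝ (D x)ᗮ : ℝ) / 2 ≠ 0 := by positivity
    have e1 : (Module.finrank ℝ (D x)ᗮ : ℝ) / 2 * inner ℝ (N x) (ξ x) = 0 := by nlinarith
    have e2 : (Module.finrank ℝ (D x)ᗮ : ℝ) / 2 * inner ℝ (N x) (applyJ J ξ x) = 0 := by nlinarith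
    exact hD.eq_zero hJ (hξ.1.2 x hx) h0 (hN.mem x) ((mul_eq_zero_iff_left hm').1 e1)
      ((mul_eq_zero_iff_left hm').1 e2)
  · intro h
    simp [h]

end Structure

/-! ### Special Killing fields in terms of the Lee field -/

section InitialData

variable [FiniteDimensional ℝ E] [IsManifold 𝓘(ℝ, E) ∞ M]
  [RiemannianBundle (fun x : M ↦ TangentSpace 𝓘(ℝ, E) x)]
  [IsContMDiffRiemannianBundle 𝓘(ℝ, E) ∞ E (fun x : M ↦ TangentSpace 𝓘(ℝ, E) x)]

variable {x : M} {nab : Connection E M} {J : EndField E M} {D : Distribution E M}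
  {N X ξ : VecField E M} {V : Set M}

lemma nab_congr {X Y : VecField E M}
    (hX : MDifferentiableAt 𝓘(ℝ, E) 𝓘(ℝ, E).tangent
      (fun x ↦ (⟨x, X x⟩ : TangentBundle 𝓘(ℝ, E) M)) x)
    (h : X =ᶠ[𝓝 x] Y) : nab X x = nab Y x :=
  nab.isCovariantDerivativeOnUniv.congr_of_eventuallyEq hX
    (hX.congr_of_eventuallyEq (h.mono fun y hy ↦ by simp only [hy])) univ_mem h

lemma nab_smul {f : M → ℝ} {Y : VecField E M} (hf : MDifferentiableAt 𝓘(ℝ, E) 𝓘(ℝ, ℝ) f x)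
    (hY : MDifferentiableAt 𝓘(ℝ, E) 𝓘(ℝ, E).tangent
      (fun x ↦ (⟨x, Y x⟩ : TangentBundle 𝓘(ℝ, E) M)) x) (v : TangentSpace 𝓘(ℝ, E) x) :
    nab (f • Y) x v = mvfderiv 𝓘(ℝ, E) f x v • Y x + f x • nab Y x v := by
  rw [nab.isCovariantDerivativeOnUniv.leibniz hY hf]
  simp only [add_apply, smul_apply, ContinuousLinearMap.smulRight_apply]
  abel

lemma mvfderiv_exp {f : M → ℝ} (hf : MDifferentiableAt 𝓘(ℝ, E) 𝓘(ℝ, ℝ) f x)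
    (v : TangentSpace 𝓘(ℝ, E) x) :
    mvfderiv 𝓘(ℝ, E) (fun y ↦ Real.exp (f y)) x v = Real.exp (f x) * mvfderiv 𝓘(ℝ, E) f x v := by
  have hx := mem_extChartAt_source (I := 𝓘(ℝ, E)) x
  have h := (mdifferentiableAt_iff_chart hx).1 hf
  rw [mvfderiv_eq_chart hx h, mvfderiv_eq_chart (f := fun y ↦ Real.exp (f y)) hx h.exp]
  have h2 : (fun y ↦ Real.exp (f y)) ∘ (extChartAt 𝓘(ℝ, E) x).symm
      = fun z ↦ Real.exp ((f ∘ (extChartAt 𝓘(ℝ, E) x).symm) z) := rfl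
  rw [h2, h.hasFDerivAt.exp.fderiv, smul_apply, smul_eq_mul, Function.comp_apply,
    (extChartAt 𝓘(ℝ, E) x).left_inv hx]

lemma IsKaehler.inner_J_left (hJ : IsKaehler nab J) (v w : TangentSpace 𝓘(ℝ, E) x) :
    inner ℝ (J x v) w = -inner ℝ v (J x w) := by
  rw [← hJ.orthogonal x v (J x w), hJ.sq, inner_neg_right, neg_neg]

lemma IsKaehler.inner_J_self (hJ : IsKaehler nab J) (v : TangentSpace 𝓘(ℝ, E) x) :
    inner ℝ (J x v) v = 0 := by
  have h := hJ.inner_J_left v v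
  rw [real_inner_comm (J x v) v] at h
  linarith

/-- The rotation part of a special local Killing field. -/
def killing (nab : Connection E M) (J : EndField E M) (N : VecField E M) (x : M)
    (v : TangentSpace 𝓘(ℝ, E) x) : TangentSpace 𝓘(ℝ, E) x :=
  J x (nab N x v + (inner ℝ (N x) v : ℝ) • N x)

/-- The condition `div_𝓔 Jξ = 0` means `N ⊥ Jξ`, by `divE_eq`. -/
lemma IsLeeField.eq_smul (hN : IsLeeField nab D N) (hJ : IsKaehler nab J)
    (hD : IsComplexHomotheticFoliation nab J D) (hdim : 2 < Module.finrank ℝ E) (hV : IsOpen V)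
    (hξ : IsPrincipalOn nab J D ξ V) (hx : x ∈ V) :
    N x = (inner ℝ (N x) (ξ x) : ℝ) • ξ x := by
  have hJξ : IsSectionOn D (applyJ J ξ) V :=
    ⟨hJ.smoothOn_applyJ hξ.1.1.1, fun y hy ↦ hD.complex y _ (hξ.1.1.2 y hy)⟩
  have h := hξ.2 x hx
  have hfr := hD.finrank_orthogonal x
  have hm : (0 : ℝ) < Module.finrank ℝ (D x)ᗮ := by exact_mod_cast (by omega)
  rw [hN.divE_eq hV hJξ hx, mul_eq_zero_iff_left (by positivity)] at h
  have h1 : inner ℝ (ξ x) (ξ x) = (1 : ℝ) := by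
    rw [real_inner_self_eq_norm_sq, hξ.1.2 x hx, one_pow]
  have h0 : ξ x ≠ 0 := by
    rw [← norm_ne_zero_iff, hξ.1.2 x hx]
    exact one_ne_zero
  refine sub_eq_zero.1 (hD.eq_zero hJ (hξ.1.1.2 x hx) h0
    (Submodule.sub_mem _ (hN.mem x) (Submodule.smul_mem _ _ (hξ.1.1.2 x hx))) ?_ ?_)
  · rw [inner_sub_left, real_inner_smul_left, h1, mul_one, sub_self]
  · rw [inner_sub_left, real_inner_smul_left, real_inner_comm (J x (ξ x)) (ξ x), hJ.inner_J_self,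
      mul_zero, sub_zero]
    exact h

/-- Write `N = h ξ`, so that `e^F Jξ = (e^F / h) J N`. The eigenvalues of `∇N` turn `dF = -p* g(ξ,
·)` into `d(e^F / h) = (e^F / h) g(N, ·)`, the equation that produces `killing`. -/
lemma IsLeeField.special_initial_data (hN : IsLeeField nab D N) (hnab : IsLeviCivita nab)
    (hJ : IsKaehler nab J) (hD : IsComplexHomotheticFoliation nab J D)
    (hdim : 2 < Module.finrank ℝ E) (hX : IsSpecialFieldOn nab J D X V) (hx : x ∈ V) :
    ∃ b : ℝ, X x = b • J x (N x) ∧ ∀ v, nab X x v = b • killing nab J N x v := by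
  obtain ⟨hV, hVU, ξ, F, hξ, hF, hdF, hXF⟩ := hX
  set h : M → ℝ := fun y ↦ inner ℝ (N y) (ξ y) with hh
  have hNξ : ∀ y ∈ V, N y = h y • ξ y := fun y hy ↦ hN.eq_smul hJ hD hdim hV hξ hy
  have hN0 : N x ≠ 0 := fun h0 ↦ hVU hx ((hN.kappa_eq_zero_iff hJ hD hdim).2 h0)
  have hh0 : h x ≠ 0 := fun h0 ↦ hN0 (by rw [hNξ x hx, h0, zero_smul])
  have hVx : V ∈ 𝓝 x := hV.mem_nhds hx
  have hξξ : ∀ y ∈ V, inner ℝ (ξ y) (ξ y) = (1 : ℝ) := fun y hy ↦ by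
    rw [real_inner_self_eq_norm_sq, hξ.1.2 y hy, one_pow]
  have dN := hN.mdifferentiableAt x
  have dξ := hξ.1.1.1.mdifferentiableAt hVx
  have dJξ := (hJ.smoothOn_applyJ hξ.1.1.1).mdifferentiableAt hVx
  have dF : MDifferentiableAt 𝓘(ℝ, E) 𝓘(ℝ, ℝ) F x :=
    (hF.contMDiffAt hVx).mdifferentiableAt (by simp)
  have dexp : MDifferentiableAt 𝓘(ℝ, E) 𝓘(ℝ, ℝ) (fun y ↦ Real.exp (F y)) x :=
    (mdifferentiableAt_iff_chart (mem_extChartAt_source x)).2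
      ((mdifferentiableAt_iff_chart (mem_extChartAt_source x)).1 dF).exp
  have hNs : SmoothOn N V := hN.smooth.mono (subset_univ V)
  have hs : ContMDiffOn 𝓘(ℝ, E) 𝓘(ℝ, ℝ) ∞ h V :=
    ContMDiffOn.inner_bundle (IB := 𝓘(ℝ, E)) (IM := 𝓘(ℝ, E)) (F := E)
      (E := fun x : M ↦ TangentSpace 𝓘(ℝ, E) x) (b := fun x ↦ x) hNs hξ.1.1.1
  have dh : MDifferentiableAt 𝓘(ℝ, E) 𝓘(ℝ, ℝ) h x :=
    (hs.contMDiffAt hVx).mdifferentiableAt (by simp)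
  -- the derivatives of `ξ` in terms of those of `N`
  have hξ0 (v : TangentSpace 𝓘(ℝ, E) x) : inner ℝ (ξ x) (nab ξ x v) = (0 : ℝ) := by
    have e := hnab.mvfderiv_inner dξ dξ v
    have e2 : (fun y ↦ (inner ℝ (ξ y) (ξ y) : ℝ)) =ᶠ[𝓝 x] fun _ ↦ 1 := by
      filter_upwards [hVx] with y hy using hξξ y hy
    have e3 : mvfderiv 𝓘(ℝ, E) (fun y ↦ (inner ℝ (ξ y) (ξ y) : ℝ)) x v = 0 := by
      have hx' := mem_extChartAt_source (I := 𝓘(ℝ, E)) x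
      have e4 : (fun y ↦ (inner ℝ (ξ y) (ξ y) : ℝ)) ∘ (extChartAt 𝓘(ℝ, E) x).symm
          =ᶠ[𝓝 (extChartAt 𝓘(ℝ, E) x x)] fun _ ↦ 1 := by
        refine e2.comp_tendsto ?_
        have := continuousAt_extChartAt_symm (I := 𝓘(ℝ, E)) x
        rwa [ContinuousAt, extChartAt_to_inv] at this
      rw [mvfderiv_eq_chart hx' (e4.differentiableAt_iff.2 (differentiableAt_const _)),
        e4.fderiv_eq, fderiv_const_apply, zero_apply]
    rw [e3, real_inner_comm (ξ x) (nab ξ x v)] at e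
    linarith
  have hdh (v : TangentSpace 𝓘(ℝ, E) x) : mvfderiv 𝓘(ℝ, E) h x v = inner ℝ (nab N x v) (ξ x) := by
    rw [hh, hnab.mvfderiv_inner dN dξ, hNξ x hx, real_inner_smul_left, hξ0, mul_zero, add_zero]
  have hnN (v : TangentSpace 𝓘(ℝ, E) x) :
      nab N x v = mvfderiv 𝓘(ℝ, E) h x v • ξ x + h x • nab ξ x v := by
    rw [nab_congr dN (Y := h • ξ) (by filter_upwards [hVx] with y hy using hNξ y hy),
      nab_smul dh dξ]
  -- the eigenvalue of `∇N` in the direction `ξ`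
  set k : ℝ := inner ℝ (nab N x (ξ x)) (ξ x) with hk
  have hρ : inner ℝ (N x) (N x) = h x ^ 2 := by
    rw [hNξ x hx, real_inner_smul_left, real_inner_smul_right, hξξ x hx]
    ring
  have hk1 : inner ℝ (nab N x (N x)) (N x) = h x ^ 2 * k := by
    rw [hNξ x hx, map_smul, real_inner_smul_left, real_inner_smul_right]
    ring
  have hNk : nab N x (ξ x) = k • ξ x := by
    have e := hN.smul_nab_self hnab hJ hD hdim hN0
    rw [hρ, hk1, hNξ x hx, map_smul, smul_smul, smul_smul] at e
    have h3 : h x ^ 2 * h x ≠ 0 := by positivity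
    apply smul_right_injective _ h3
    simp only [e, smul_smul]
    congr 1
    ring
  -- As `J` is parallel and `ξ ⊥ Jξ`, `h p* = -⟨∇_{Jξ} N, Jξ⟩`, which is minus the eigenvalue `k +
  -- h²` on `J N`.
  have hp : h x * pStar nab J ξ x = -k - h x ^ 2 := by
    have e := hN.inner_nab_J hnab hJ hD hdim hN0
    rw [hρ, hk1, hNξ x hx, map_smul, map_smul, real_inner_smul_left, real_inner_smul_right] at e
    have e2 : h x * pStar nab J ξ x = -inner ℝ (nab N x (J x (ξ x))) (J x (ξ x)) := by
      rw [pStar, hJ.parallel V ξ hV hξ.1.1.1 x hx, hJ.inner_J_left, hnN (J x (ξ x)),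
        inner_add_left, real_inner_smul_left, real_inner_smul_left,
        real_inner_comm (J x (ξ x)) (ξ x),
        hJ.inner_J_self]
      ring
    rw [e2]
    have h3 : h x ^ 2 ≠ 0 := by positivity
    apply mul_left_cancel₀ h3
    linarith
  -- This is `dF - dh / h = g(N, ·)`, multiplied by `h`.
  have hkey (v : TangentSpace 𝓘(ℝ, E) x) :
      h x * mvfderiv 𝓘(ℝ, E) F x v - mvfderiv 𝓘(ℝ, E) h x v = h x ^ 2 * inner ℝ (ξ x) v := by
    rw [hdF x hx, hdh, hN.nab_symm, hNk, real_inner_smul_right, real_inner_comm (ξ x) v]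
    linear_combination (-inner ℝ (ξ x) v) * hp
  refine ⟨Real.exp (F x) / h x, ?_, fun v ↦ ?_⟩
  · rw [hXF x hx, hNξ x hx, map_smul, smul_smul, div_mul_cancel₀ _ hh0]
  · have e1 : nab X x v = (Real.exp (F x) * mvfderiv 𝓘(ℝ, E) F x v) • J x (ξ x)
        + Real.exp (F x) • J x (nab ξ x v) := by
      have e2 : (fun y ↦ Real.exp (F y)) • applyJ J ξ =ᶠ[𝓝 x] X := by
        filter_upwards [hVx] with y hy using (hXF y hy).symm
      rw [← nab_congr (dexp.smul_section dJξ) e2, nab_smul dexp dJξ, mvfderiv_exp dF,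
        hJ.parallel V ξ hV hξ.1.1.1 x hx]
      rfl
    rw [e1, killing, hnN, hNξ x hx, real_inner_smul_left, map_add, map_add, map_smul, map_smul,
      map_smul, map_smul]
    have e3 := hkey v
    have e4 : mvfderiv 𝓘(ℝ, E) F x v
        = (mvfderiv 𝓘(ℝ, E) h x v + h x ^ 2 * inner ℝ (ξ x) v) / h x := by
      field_simp
      linarith
    rw [e4]
    match_scalars
    · field_simp
    · field_simp

end InitialData

/-! ### The model Jacobi field along a geodesic -/

section SpecialJacobi

variable [FiniteDimensional ℝ E] [IsManifold 𝓘(ℝ, E) ∞ M]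
  [RiemannianBundle (fun x : M ↦ TangentSpace 𝓘(ℝ, E) x)]
  [IsContMDiffRiemannianBundle 𝓘(ℝ, E) ∞ E (fun x : M ↦ TangentSpace 𝓘(ℝ, E) x)]

variable {x₀ x : M} {nab : Connection E M} {J : EndField E M} {D : Distribution E M}
  {N : VecField E M} {c : ℝ → M} {S T : Set ℝ} {t : ℝ}
  {A B C : Π t : ℝ, TangentSpace 𝓘(ℝ, E) (c t)}

lemma contDiffWithinAt_derivWithin {f : ℝ → E} (hf : ContDiffWithinAt ℝ ∞ f S t)
    (hS : UniqueDiffOn ℝ S) (ht : t ∈ S) : ContDiffWithinAt ℝ ∞ (derivWithin f S) S t :=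
  (hf.fderivWithin_right hS (m := ∞) (by simp) ht).clm_apply contDiffWithinAt_const

lemma contDiffWithinAt_velocity (hc : ContMDiffOn 𝓘(ℝ, ℝ) 𝓘(ℝ, E) ∞ c S) (hS : UniqueDiffOn ℝ S)
    (ht : t ∈ S) (hx : c t ∈ (extChartAt 𝓘(ℝ, E) x₀).source) :
    ContDiffWithinAt ℝ ∞ (along x₀ c (velocity E c S)) S t := by
  have key {s : ℝ} (hs : s ∈ S) (hx : c s ∈ (extChartAt 𝓘(ℝ, E) x₀).source) :
      along x₀ c (velocity E c S) s
        = derivWithin (fun s ↦ extChartAt 𝓘(ℝ, E) x₀ (c s)) S s :=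
    ((hasDerivWithinAt_chart hx ((hc s hs).mdifferentiableWithinAt (by simp))).derivWithin
      (hS s hs)).symm
  refine (contDiffWithinAt_derivWithin (contDiffWithinAt_chart hx (hc t ht)) hS
    ht).congr_of_eventuallyEq ?_ (key ht hx)
  filter_upwards [self_mem_nhdsWithin, continuousWithinAt_chart_mem (hc t ht).continuousWithinAt hx]
    with s hs hs' using key hs hs'

lemma continuousWithinAt_inner (hc : ContinuousWithinAt c S t)
    (hx : c t ∈ (extChartAt 𝓘(ℝ, E) x₀).source)
    (hA : ContinuousWithinAt (along x₀ c A) S t) (hB : ContinuousWithinAt (along x₀ c B) S t) :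
    ContinuousWithinAt (fun s ↦ (inner ℝ (A s) (B s) : ℝ)) S t := by
  have hG := isMetricOn_chartMetric (E := E) x₀
  have h := continuousWithinAt_comp_chart hx hc
    (hG.differentiableAt ((extChartAt 𝓘(ℝ, E) x₀).map_source hx)).continuousAt
  refine ((h.clm_apply hA).clm_apply hB).congr_of_eventuallyEq ?_ (inner_eq_along hx)
  filter_upwards [continuousWithinAt_chart_mem hc hx] with s hs using inner_eq_along hs

lemma IsLeeField.continuousWithinAt_along (hN : IsLeeField nab D N) (hc : ContinuousWithinAt c S t)
    (hx : c t ∈ (extChartAt 𝓘(ℝ, E) x₀).source) :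
    ContinuousWithinAt (along x₀ c fun s ↦ N (c s)) S t := by
  refine (continuousWithinAt_comp_chart hx hc (hN.contDiffAt_hat hx).continuousAt).congr_of_eventuallyEq
    ?_ (hat_apply hx N).symm
  filter_upwards [continuousWithinAt_chart_mem hc hx] with s hs using (hat_apply hs N).symm

/-- The work lies in differentiability of `covAlong nab c S C`: in a fixed chart it is the
derivative of `C` plus a Christoffel term, and so inherits differentiability from `C`, `c` and the
metric. -/
lemma IsJacobiOn.isJacobiPairOn (hnab : IsLeviCivita nab)
    (hc : ContMDiffOn 𝓘(ℝ, ℝ) 𝓘(ℝ, E) ∞ c S) (hS : UniqueDiffOn ℝ S)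
    (hC : IsJacobiOn nab c S C) : IsJacobiPairOn c S S C (covAlong nab c S C) := by
  intro t ht x₀ hx
  have hct {s : ℝ} (hs : s ∈ S) := (hc s hs).mdifferentiableWithinAt (by simp)
  have hd {s : ℝ} (hs : s ∈ S) (hx : c s ∈ (extChartAt 𝓘(ℝ, E) x₀).source) :=
    hnab.hasDerivWithinAt_along hx (hct hs) ((hC.1.contDiffWithinAt hs hx).differentiableWithinAt
      (by simp))
  refine ⟨hd ht hx, ?_⟩
  have key {s : ℝ} (hs : s ∈ S) (hx : c s ∈ (extChartAt 𝓘(ℝ, E) x₀).source) :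
      along x₀ c (covAlong nab c S C) s = derivWithin (along x₀ c C) S s
        + christoffel (chartMetric x₀) (extChartAt 𝓘(ℝ, E) x₀ (c s))
          (along x₀ c (velocity E c S) s) (along x₀ c C s) := by
    rw [(hd hs hx).derivWithin (hS s hs)]
    abel
  have hG := isMetricOn_chartMetric (E := E) x₀
  have hΓ : DifferentiableWithinAt ℝ (fun s ↦ christoffel (chartMetric x₀)
      (extChartAt 𝓘(ℝ, E) x₀ (c s))) S t :=
    DifferentiableAt.comp_differentiableWithinAt (g := christoffel (chartMetric x₀))
      (f := fun s ↦ extChartAt 𝓘(ℝ, E) x₀ (c s)) t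
      (hG.differentiableAt_christoffel ((extChartAt 𝓘(ℝ, E) x₀).map_source hx))
      (hasDerivWithinAt_chart hx (hct ht)).differentiableWithinAt
  have hdiff : DifferentiableWithinAt ℝ (along x₀ c (covAlong nab c S C)) S t := by
    refine (((contDiffWithinAt_derivWithin (hC.1.contDiffWithinAt ht hx) hS
      ht).differentiableWithinAt (by simp)).add ((hΓ.clm_apply
      ((contDiffWithinAt_velocity hc hS ht hx).differentiableWithinAt (by simp))).clm_apply
      (hd ht hx).differentiableWithinAt)).congr_of_eventuallyEq ?_ (key ht hx)
    filter_upwards [self_mem_nhdsWithin,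
      continuousWithinAt_chart_mem (hc t ht).continuousWithinAt hx] with s hs hs' using key hs hs'
  refine (hnab.hasDerivWithinAt_along hx (hct ht) hdiff).congr_deriv ?_
  congr 1
  refine Eq.trans ?_ (hnab.toChart_curvature hx _ _ _)
  exact congrArg (toChart x₀ (c t)) (sub_eq_zero.1 (hC.2 t ht))

lemma IsLeeField.toChart_killing (hN : IsLeeField nab D N) (hnab : IsLeviCivita nab)
    (hx : x ∈ (extChartAt 𝓘(ℝ, E) x₀).source) (v : TangentSpace 𝓘(ℝ, E) x) :
    toChart x₀ x (killing nab J N x v) = killingEnd (chartMetric x₀) (chartEnd x₀ J) (hat x₀ N)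
      (extChartAt 𝓘(ℝ, E) x₀ x) (toChart x₀ x v) := by
  rw [killing, killingEnd_apply, ← chartEnd_toChart hx, map_add, map_smul,
    hnab.toChart_nab hx (hN.mdifferentiableAt x), hat_apply hx, chartMetric_toChart hx]

lemma IsLeeField.inner_killing_self (hN : IsLeeField nab D N) (hnab : IsLeviCivita nab)
    (hJ : IsKaehler nab J) (hD : IsComplexHomotheticFoliation nab J D)
    (hdim : 2 < Module.finrank ℝ E) (h0 : N x ≠ 0) (v : TangentSpace 𝓘(ℝ, E) x) :
    inner ℝ v (killing nab J N x v) = 0 := by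
  have hx := mem_extChartAt_source (I := 𝓘(ℝ, E)) x
  rw [real_inner_comm, ← chartMetric_toChart hx, hN.toChart_killing hnab hx]
  exact (hN.isHomotheticGradientOn hnab hJ hD hdim x).inner_killingEnd_self
    (mem_regularChart hx h0) _

/-- Along a geodesic, the field `a • J N` with `a' = ⟨N, ċ⟩ a` is a Jacobi field. -/
lemma IsLeeField.isJacobiPairOn (hN : IsLeeField nab D N) (hnab : IsLeviCivita nab)
    (hJ : IsKaehler nab J) (hD : IsComplexHomotheticFoliation nab J D)
    (hdim : 2 < Module.finrank ℝ E) (hS : UniqueDiffOn ℝ S) (hc : IsGeodesicOn nab c S)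
    (hTS : T ⊆ S) (h0 : ∀ t ∈ T, N (c t) ≠ 0) {a : ℝ → ℝ}
    (ha : ∀ t ∈ S, HasDerivWithinAt a (a t * inner ℝ (N (c t)) (velocity E c S t)) S t) :
    IsJacobiPairOn c S T (fun t ↦ a t • J (c t) (N (c t)))
      (fun t ↦ a t • killing nab J N (c t) (velocity E c S t)) := by
  intro t htT x₀ hx
  have ht := hTS htT
  have hct := (hc.1 t ht).mdifferentiableWithinAt (n := ∞) (by simp)
  have hH := hN.isHomotheticGradientOn hnab hJ hD hdim x₀
  have hy := mem_regularChart hx (h0 t htT)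
  have hγ := hasDerivWithinAt_chart hx hct
  have hev := continuousWithinAt_chart_mem (hc.1 t ht).continuousWithinAt hx
  have k1 {s : ℝ} (hs : c s ∈ (extChartAt 𝓘(ℝ, E) x₀).source) :
      along x₀ c (fun t ↦ a t • J (c t) (N (c t))) s = a s •
        chartEnd x₀ J (extChartAt 𝓘(ℝ, E) x₀ (c s)) (hat x₀ N (extChartAt 𝓘(ℝ, E) x₀ (c s))) := by
    rw [along, map_smul, hat_apply hs, chartEnd_toChart hs]
  have k2 {s : ℝ} (hs : c s ∈ (extChartAt 𝓘(ℝ, E) x₀).source) :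
      along x₀ c (fun t ↦ a t • killing nab J N (c t) (velocity E c S t)) s = a s •
        killingEnd (chartMetric x₀) (chartEnd x₀ J) (hat x₀ N) (extChartAt 𝓘(ℝ, E) x₀ (c s))
          (along x₀ c (velocity E c S) s) := by
    rw [along, map_smul, hN.toChart_killing hnab hs]
    rfl
  have hα : (inner ℝ (N (c t)) (velocity E c S t) : ℝ)
      = chartMetric x₀ (extChartAt 𝓘(ℝ, E) x₀ (c t)) (hat x₀ N (extChartAt 𝓘(ℝ, E) x₀ (c t)))
        (along x₀ c (velocity E c S) t) := by
    rw [hat_apply hx, along, chartMetric_toChart hx]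
  have hat' := ha t ht
  rw [hα] at hat'
  rw [k1 hx, k2 hx]
  have hu := hnab.hasDerivWithinAt_along hx hct
    ((contDiffWithinAt_velocity hc.1 hS ht hx).differentiableWithinAt (by simp))
  have hz : along x₀ c (covAlong nab c S (velocity E c S)) t = 0 := by
    rw [along, hc.2 t ht, map_zero]
  rw [hz, zero_sub] at hu
  set y := extChartAt 𝓘(ℝ, E) x₀ (c t)
  set u := along x₀ c (velocity E c S) t
  constructor
  · have hd : HasDerivWithinAt (fun s ↦ chartEnd x₀ J (extChartAt 𝓘(ℝ, E) x₀ (c s))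
        (hat x₀ N (extChartAt 𝓘(ℝ, E) x₀ (c s))))
        (fderiv ℝ (fun z ↦ chartEnd x₀ J z (hat x₀ N z)) y u) S t :=
      HasFDerivAt.comp_hasDerivWithinAt (l := fun z ↦ chartEnd x₀ J z (hat x₀ N z))
        (f := fun s ↦ extChartAt 𝓘(ℝ, E) x₀ (c s)) t (hH.differentiableAt_JN hy).hasFDerivAt hγ
    refine ((hat'.smul hd).congr_of_eventuallyEq (hev.mono fun s hs ↦ k1 hs)
      (k1 hx)).congr_deriv ?_
    have hcov := hH.cov_J hy (hH.differentiableAt_N hy) u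
    rw [cov_apply] at hcov
    rw [eq_sub_of_add_eq hcov, killingEnd_apply, map_add, map_smul, map_smul]
    module
  · have hd : HasDerivWithinAt (fun s ↦ killingEnd (chartMetric x₀) (chartEnd x₀ J) (hat x₀ N)
        (extChartAt 𝓘(ℝ, E) x₀ (c s)))
        (fderiv ℝ (killingEnd (chartMetric x₀) (chartEnd x₀ J) (hat x₀ N)) y u) S t :=
      HasFDerivAt.comp_hasDerivWithinAt
        (l := killingEnd (chartMetric x₀) (chartEnd x₀ J) (hat x₀ N))
        (f := fun s ↦ extChartAt 𝓘(ℝ, E) x₀ (c s)) t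
        (hH.differentiableAt_killingEnd hy).hasFDerivAt hγ
    refine ((hat'.smul (hd.clm_apply hu)).congr_of_eventuallyEq (hev.mono fun s hs ↦ k2 hs)
      (k2 hx)).congr_deriv ?_
    -- The geodesic equation cancels the acceleration, so the covariant derivative of `a K ċ` is `a`
    -- times the left side of the Killing identity at `u = ċ`.
    have hK := hH.covEnd_killingEnd_self hy u
    have hsm (v w : E) (r : ℝ) : curv (chartMetric x₀) y v (r • w) v
        = r • curv (chartMetric x₀) y v w v := by
      simp only [curv, map_smul, smul_apply, smul_add, smul_sub]
    rw [hsm, ← hK, covEnd, map_neg, map_smul]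
    module

lemma exists_linear_solution {β : ℝ → ℝ} {l : ℝ} (hl : 0 < l) (hβ : ContinuousOn β (Icc 0 l))
    (b : ℝ) : ∃ a : ℝ → ℝ, a 0 = b ∧
      ∀ t ∈ Icc 0 l, HasDerivWithinAt a (a t * β t) (Icc 0 l) t := by
  have hcont : Continuous (IccExtend hl.le ((Icc 0 l).domRestrict β)) :=
    (continuousOn_iff_continuous_domRestrict.1 hβ).Icc_extend'
  refine ⟨fun t ↦ b * Real.exp (∫ s in (0 : ℝ)..t, IccExtend hl.le ((Icc 0 l).domRestrict β) s),
    by simp, fun t ht ↦ ?_⟩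
  have h := ((hcont.integral_hasStrictDerivAt 0 t).hasDerivAt.exp.const_mul b).hasDerivWithinAt
    (s := Icc 0 l)
  refine h.congr_deriv ?_
  rw [IccExtend_of_mem _ _ ht, domRestrict_apply]
  ring

end SpecialJacobi

end HomotheticFoliation

end

/-! ### The limit and the orthogonality -/

open HomotheticFoliation in
theorem lemma5p1
    {E : Type*} [NormedAddCommGroup E] [NormedSpace ℝ E] [FiniteDimensional ℝ E]
    {M : Type*} [TopologicalSpace M] [T2Space M] [SecondCountableTopology M]
    [ChartedSpace E M] [IsManifold 𝓘(ℝ, E) ∞ M]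
    [RiemannianBundle (fun x : M ↦ TangentSpace 𝓘(ℝ, E) x)]
    [IsContMDiffRiemannianBundle 𝓘(ℝ, E) ∞ E (fun x : M ↦ TangentSpace 𝓘(ℝ, E) x)]
    (n : ℕ) (hn : 2 ≤ n) (hdim : Module.finrank ℝ E = 2 * n)
    (nab : Connection E M) (hnab : IsLeviCivita nab)
    (J : EndField E M) (hJ : IsKaehler nab J)
    (D : Distribution E M) (hD : IsComplexHomotheticFoliation nab J D)
    (l : ℝ) (hl : 0 < l) (c : ℝ → M) (hc : IsGeodesicOn nab c (Icc 0 l))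
    (hunit : ∀ t ∈ Icc 0 l, ‖velocity E c (Icc 0 l) t‖ = 1)
    (hU : ∀ t ∈ Ico 0 l, c t ∈ setU nab J D) (hK : c l ∈ setK nab J D)
    (C : Π t : ℝ, TangentSpace 𝓘(ℝ, E) (c t)) (hC : IsSpecialJacobi nab J D c l C) :
    Tendsto (fun t ↦ ‖C t‖) (𝓝[<] l) (𝓝 0) ∧
      ∀ t ∈ Icc 0 l, inner ℝ (velocity E c (Icc 0 l) t) (C t) = 0 := by
  have hdim' : 2 < Module.finrank ℝ E := by omega
  obtain ⟨N, hN⟩ := hD.exists_isLeeField hnab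
  have hS := uniqueDiffOn_Icc hl
  have hTS : Ico 0 l ⊆ Icc 0 l := Ico_subset_Icc_self
  have h0 : ∀ t ∈ Ico 0 l, N (c t) ≠ 0 := fun t ht h ↦
    hU t ht ((hN.kappa_eq_zero_iff hJ hD hdim').2 h)
  have hl0 : N (c l) = 0 := (hN.kappa_eq_zero_iff hJ hD hdim').1 hK
  have hct {t : ℝ} (ht : t ∈ Icc 0 l) : ContinuousWithinAt c (Icc 0 l) t :=
    (hc.1 t ht).continuousWithinAt
  have hv (t : ℝ) (ht : t ∈ Icc 0 l) :
      ContinuousWithinAt (along (c t) c (velocity E c (Icc 0 l))) (Icc 0 l) t :=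
    (contDiffWithinAt_velocity hc.1 hS ht (mem_extChartAt_source _)).continuousWithinAt
  have hCd (t : ℝ) (ht : t ∈ Icc 0 l) : ContDiffWithinAt ℝ ∞ (along (c t) c C) (Icc 0 l) t :=
    hC.1.1.contDiffWithinAt ht (mem_extChartAt_source _)
  obtain ⟨V, X, hcV, -, hX, hC0, hC0'⟩ := hC.2
  obtain ⟨b, hb, hb'⟩ := hN.special_initial_data hnab hJ hD hdim' hX hcV
  -- `N` is continuous along `c` up to `t = l`, so `a` exists on the closed interval and stays
  -- bounded near `l`.
  obtain ⟨a, ha0, ha⟩ := exists_linear_solution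
    (β := fun t ↦ inner ℝ (N (c t)) (velocity E c (Icc 0 l) t)) hl
    (fun t ht ↦ continuousWithinAt_inner (hct ht) (mem_extChartAt_source _)
      (hN.continuousWithinAt_along (hct ht) (mem_extChartAt_source _)) (hv t ht)) b
  have hpair : IsJacobiPairOn c (Icc 0 l) (Ico 0 l) C (covAlong nab c (Icc 0 l) C) :=
    fun t ht ↦ hC.1.isJacobiPairOn hnab hc.1 hS t (hTS ht)
  have hmodel := hN.isJacobiPairOn hnab hJ hD hdim' hS hc hTS h0 ha
  have h00 : (0 : ℝ) ∈ Ico 0 l := ⟨le_rfl, hl⟩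
  have hll : l ∈ Icc 0 l := ⟨hl.le, le_rfl⟩
  have heq {t : ℝ} (ht : t ∈ Ico 0 l) : C t = a t • J (c t) (N (c t)) ∧
      covAlong nab c (Icc 0 l) C t = a t • killing nab J N (c t) (velocity E c (Icc 0 l) t) :=
    hpair.eqOn hmodel hTS ordConnected_Ico hc.1 hv h00 ht
      ⟨by rw [hC0, hb, ha0], by rw [hC0', hb', ha0]⟩
  have hle : 𝓝[<] l ≤ 𝓝[Icc 0 l] l :=
    nhdsWithin_le_of_mem (mem_of_superset (Ico_mem_nhdsLT hl) hTS)
  have hnorm : Tendsto (fun t ↦ ‖C t‖) (𝓝[<] l) (𝓝 0) := by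
    have hcont : ContinuousWithinAt (fun t ↦ |a t| * Real.sqrt (inner ℝ (N (c t)) (N (c t))))
        (Icc 0 l) l := by
      have hNc := hN.continuousWithinAt_along (hct hll) (mem_extChartAt_source (I := 𝓘(ℝ, E)) (c l))
      exact (ha l hll).continuousWithinAt.abs.mul (continuousWithinAt_inner
        (A := fun t ↦ N (c t)) (B := fun t ↦ N (c t)) (hct hll)
        (mem_extChartAt_source _) hNc hNc).sqrt
    have hlim := hcont.tendsto.mono_left hle
    rw [hl0, inner_zero_left, Real.sqrt_zero, mul_zero] at hlim
    refine hlim.congr' ?_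
    filter_upwards [Ico_mem_nhdsLT hl] with t ht
    have hJN : ‖J (c t) (N (c t))‖ = Real.sqrt (inner ℝ (N (c t)) (N (c t))) := by
      rw [← hJ.orthogonal, real_inner_self_eq_norm_sq, Real.sqrt_sq (norm_nonneg _)]
    rw [(heq ht).1, norm_smul, hJN, Real.norm_eq_abs]
  refine ⟨hnorm, ?_⟩
  -- The identity `C = a J N` was obtained on `[0, l)` only; the value at `l` follows from
  -- continuity of `C`.
  have hCl : C l = 0 := by
    have hx := mem_extChartAt_source (I := 𝓘(ℝ, E)) (c l)
    have h1 := (continuousWithinAt_inner (hct hll) hx (hCd l hll).continuousWithinAt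
      (hCd l hll).continuousWithinAt).tendsto.mono_left hle
    have h2 := hnorm.pow 2
    simp only [real_inner_self_eq_norm_sq] at h1
    have h3 := tendsto_nhds_unique h1 h2
    rw [← norm_eq_zero]
    simpa using h3
  -- Only right derivatives on `[0, l)` are required, so the end point, where `N` vanishes, needs
  -- continuity alone.
  have hconst := constant_of_has_deriv_right_zero
    (f := fun t ↦ (inner ℝ (velocity E c (Icc 0 l) t) (C t) : ℝ)) (a := 0) (b := l)
    (fun t ht ↦ continuousWithinAt_inner (hct ht) (mem_extChartAt_source _) (hv t ht)
      (hCd t ht).continuousWithinAt) (fun t ht ↦ ?_)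
  · intro t ht
    have h1 := (hconst t ht).trans (hconst l hll).symm
    simp only [hCl, inner_zero_right] at h1
    exact h1
  · have hx := mem_extChartAt_source (I := 𝓘(ℝ, E)) (c t)
    have hd := hnab.hasDerivWithinAt_inner hx
      ((hc.1 t (hTS ht)).mdifferentiableWithinAt (by simp))
      ((contDiffWithinAt_velocity hc.1 hS (hTS ht) hx).differentiableWithinAt (by simp))
      ((hCd t (hTS ht)).differentiableWithinAt (by simp))
    rw [hc.2 t (hTS ht), (heq ht).2, inner_zero_left, real_inner_smul_right,
      hN.inner_killing_self hnab hJ hD hdim' (h0 t ht), mul_zero, add_zero] at hd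
    exact hd.mono_of_mem_nhdsWithin (Icc_mem_nhdsGE_of_mem ht)
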